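/- Let $\beta>0$, $M_\beta(z)=\frac{z-i\beta}{z+i\beta}$, $M_\beta^{-1}(z)=\frac{\beta}{i}\frac{z+1}{z-1}$, and $T(\theta)=M_\beta^{-1}(e^{i\theta})\in\mathbb R$ for $\theta\in(0,2\pi)$. For continuous $f:\mathbb R\to\mathbb C$ let $F$ be the function on the circle $\mathbb T=\mathbb R/2\pi\mathbb Z$ with $F(\theta)=f(T(\theta))$ for $\theta\in(0,2\pi)$ and $F(0)=\lim_{|x|\to\infty}f(x)$ (so $F(0)=0$ if $f$ vanishes at infinity). For $n\ge 1$ put $\theta_\ell=2\pi\ell/n$, $n_+=\lfloor n/2\rfloor$, $n_-=\lfloor (n-1)/2\rfloor$, and define the rational interpolant $$\mathcal R_nf(x)=\sum_{k=-n_-}^{n_+}\tilde F_k\,M_\beta(x)^k,\qquad \tilde F_k=\frac1n\sum_{\ell=0}^{n-1}e^{-ik\theta_\ell}F(\theta_\ell).$$ Write $\hat F_k=\frac1{2\pi}\int_0^{2\pi}e^{-ik\theta}F(\theta)\,d\theta$ and $\mathcal Fg(k)=\int_{\mathbb R}e^{-ikx}g(x)\,dx$ (in the $L^2$ sense). The space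 $H^s(\mathbb T)$ consists of the $F\in L^2(\mathbb T)$ for which $\|F\|_{H^s(\mathbb T)}^2=\sum_{k\in\mathbb Z}(1+|k|)^{2s}|\hat F_k|^2$ is finite, and $H^t(\mathbb R)$ consists of the $g\in L^2(\mathbb R)$ for which $\|g\|_{H^t(\mathbb R)}^2=\int_{\mathbb R}(1+|k|)^{2t}|\mathcal Fg(k)|^2\,dk$ is finite. The space $C_0^r(\mathbb R)$ consists of the $r$ times continuously differentiable $g$ with $g^{(j)}(x)\to0$ as $|x|\to\infty$ for $0\le j\le r$, and $\|g\|_{C_0^r(\mathbb R)}=\sum_{j=0}^r\sup_x|g^{(j)}(x)|$. Finally, $\mathcal D^j$ is the $j$-th weak derivative, and $\mathrm{p.v.}\!\int_{\mathbb R}g\,dx=\lim_{R\to\infty}\int_{-R}^Rg(x)\,dx$. Theorem. Let $s>1/2$. In the following, the constants do not depend on $n$ or $f$; besides $\beta$ they depend only on their subscripts, and no uniformity as $\epsilon\to0^+$ is claimed. For every continuous $f:\mathbb R\to\mathbb C$ with $F\in H^s(\mathbb T)$ and every $n\ge1$: - for every integer $r\ge0$ with $r<s-\frac12$: $\mathcal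 R_nf-f\in C_0^r(\mathbb R)$ and $$\|\mathcal R_nf-f\|_{C_0^r(\mathbb R)}\le C_{r,s}\,n^{1/2+r-s}\,\|F\|_{H^s(\mathbb T)};$$ - for all real $\epsilon>0$ and $t<s$ with $s>1+\epsilon$: $\mathcal R_nf-f\in H^t(\mathbb R)$ and $$\|\mathcal R_nf-f\|_{H^t(\mathbb R)}\le\left[C_{\epsilon,s}\,n^{1+\epsilon-s}+C_{s,t}\,n^{t-s}\right]\|F\|_{H^s(\mathbb T)};$$ - for every $\epsilon>0$ with $s>\frac32+\epsilon$: the principal-value integral exists and $$\left|\mathrm{p.v.}\!\int_{\mathbb R}(\mathcal R_nf(x)-f(x))\,dx\right|\le C_{\epsilon,s}\,n^{3/2+\epsilon-s}\,\|F\|_{H^s(\mathbb T)};$$ - for every integer $j$ with $0<j\le s$: the weak derivative $\mathcal D^j[\mathcal R_nf-f]$ exists, belongs to $L^1(\mathbb R)$, and $$\|\mathcal D^j[\mathcal R_nf-f]\|_{L^1(\mathbb R)}\le C_{j,s}\,n^{j-s}\,\|F\|_{H^s(\mathbb T)}.$$ -/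

import Mathlib

namespace RationalInterpolation

open MeasureTheory Filter Topology
open scoped FourierTransform ContDiff

noncomputable section

/-- The circle `ℝ / 2πℤ` is an instance of `AddCircle`. -/
instance instFactTwoPiPos : Fact (0 < 2 * Real.pi) := ⟨Real.two_pi_pos⟩

/-- The periodic interval `𝕋 = [0, 2π)` with its end points identified. -/
abbrev Torus : Type := AddCircle (2 * Real.pi)

/-! ### The change of variables -/

/-- The Möbius transformation `M_β(z) = (z - iβ) / (z + iβ)`. -/
def mobius (β : ℝ) (z : ℂ) : ℂ := (z - Complex.I * β) / (z + Complex.I * β)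

/-- The inverse Möbius transformation `M_β⁻¹(z) = (β / i) (z + 1) / (z - 1)`. -/
def mobiusInv (β : ℝ) (z : ℂ) : ℂ := (β / Complex.I) * ((z + 1) / (z - 1))

/-- `T(θ) = M_β⁻¹(e^{iθ})`. This number is real (see `ofReal_lineParam`), so it is recorded as a
real number. It is meaningful for `θ ≠ 0`. -/
def lineParam (β : ℝ) (θ : Torus) : ℝ := (mobiusInv β (AddCircle.toCircle θ : ℂ)).re

theorem toCircle_torus_coe (θ : ℝ) :
    ((AddCircle.toCircle (θ : Torus) : Circle) : ℂ) = Complex.exp (Complex.I * θ) := by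
  rw [AddCircle.toCircle_apply_mk, Circle.coe_exp, div_self Real.two_pi_pos.ne', one_mul, mul_comm]

theorem ofReal_lineParam (β : ℝ) (θ : Torus) :
    (lineParam β θ : ℂ) = mobiusInv β (AddCircle.toCircle θ : ℂ) := by
  refine Complex.conj_eq_iff_re.mp ?_
  set z : ℂ := (AddCircle.toCircle θ : ℂ) with hz
  have hz0 : z ≠ 0 := Circle.coe_ne_zero _
  have hc : (starRingEnd ℂ) z = z⁻¹ := by
    rw [hz, ← Circle.coe_inv_eq_conj, Circle.coe_inv]
  unfold mobiusInv
  simp only [map_mul, map_div₀, map_add, map_sub, map_one, Complex.conj_I, Complex.conj_ofReal, hc]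
  by_cases h1 : z = 1
  · simp [h1]
  · have h2 : z - 1 ≠ 0 := sub_ne_zero.mpr h1
    have h3 : z⁻¹ - 1 ≠ 0 := by
      intro h
      exact h1 (by simpa using congrArg Inv.inv (sub_eq_zero.mp h))
    have h4 : (1 : ℂ) - z ≠ 0 := fun h => h2 (by linear_combination -h)
    have e1 : z⁻¹ + 1 = (1 + z) / z := by field_simp
    have e2 : z⁻¹ - 1 = (1 - z) / z := by field_simp
    rw [e1, e2]
    field_simp
    ring

/-- The function on the circle that corresponds to `f : ℝ → ℂ`: `F(θ) = f(T(θ))` for `θ ≠ 0`, and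
`F(0)` is the limit of `f(x)` as `|x| → ∞`. -/
def toTorus (β : ℝ) (f : ℝ → ℂ) (θ : Torus) : ℂ :=
  open Classical in
  if θ = 0 then limUnder (cocompact ℝ) f else f (lineParam β θ)

/-! ### The periodic Sobolev spaces -/

/-- `F ∈ H^s(𝕋)`: `F ∈ L²(𝕋)` and `∑ (1 + |k|)^{2s} |F̂_k|² < ∞`, where
`F̂_k = (1 / 2π) ∫₀^{2π} e^{-ikθ} F(θ) dθ`. -/
def MemSobolevTorus (s : ℝ) (F : Torus → ℂ) : Prop :=
  MemLp F 2 (volume : Measure Torus) ∧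
    Summable fun k : ℤ => (1 + |(k : ℝ)|) ^ (2 * s) * ‖fourierCoeff F k‖ ^ 2

/-- `‖F‖_{H^s(𝕋)}`. -/
def normSobolevTorus (s : ℝ) (F : Torus → ℂ) : ℝ :=
  Real.sqrt (∑' k : ℤ, (1 + |(k : ℝ)|) ^ (2 * s) * ‖fourierCoeff F k‖ ^ 2)

/-! ### Trigonometric interpolation and its image on the line -/

/-- The node `θ_ℓ = 2πℓ / n`. -/
def node (n ℓ : ℕ) : Torus := ((2 * Real.pi * ℓ / n : ℝ) : Torus)

/-- The discrete Fourier coefficient `F̃_k = (1 / n) ∑_{ℓ < n} e^{-ikθ_ℓ} F(θ_ℓ)`. -/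
def discreteFourierCoeff (n : ℕ) (F : Torus → ℂ) (k : ℤ) : ℂ :=
  (1 / (n : ℂ)) * ∑ ℓ ∈ Finset.range n, fourier (-k) (node n ℓ) * F (node n ℓ)

/-- The rational interpolant `ℛ_n f(x) = ∑_{k = -n₋}^{n₊} F̃_k M_β(x)^k`, where `n₊ = ⌊n / 2⌋` and
`n₋ = ⌊(n - 1) / 2⌋`, that is, the trigonometric interpolant
`ℐ_n F(θ) = ∑_{k = -n₋}^{n₊} F̃_k e^{ikθ}` at `θ = T⁻¹(x)`. -/
def ratInterp (β : ℝ) (n : ℕ) (f : ℝ → ℂ) (x : ℝ) : ℂ :=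
  ∑ k ∈ Finset.Icc (-(((n - 1) / 2 : ℕ) : ℤ)) ((n / 2 : ℕ) : ℤ),
    discreteFourierCoeff n (toTorus β f) k * mobius β x ^ k

/-! ### Function spaces on the line -/

/-- `g ∈ C_0^r(ℝ)`. -/
def MemC0 (r : ℕ) (g : ℝ → ℂ) : Prop :=
  ContDiff ℝ r g ∧ ∀ j ≤ r, Tendsto (iteratedDeriv j g) (cocompact ℝ) (𝓝 0)

/-- `‖g‖_{C_0^r(ℝ)} = ∑_{j ≤ r} sup_x |g^{(j)}(x)|`. -/
def normC0 (r : ℕ) (g : ℝ → ℂ) : ℝ :=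
  ∑ j ∈ Finset.range (r + 1), ⨆ x : ℝ, ‖iteratedDeriv j g x‖

/-- The Fourier transform `ℱ g(k) = ∫ e^{-ikx} g(x) dx` of `g ∈ L²(ℝ)`, in the sense of
Plancherel (a function that is determined up to null sets). Mathlib's transform `𝓕` on `L²` has
the kernel `e^{-2πikx}`, which explains the rescaling. -/
def fourierL2 (g : ℝ → ℂ) (k : ℝ) : ℂ :=
  open Classical in
  if hg : MemLp g 2 (volume : Measure ℝ) then
    (𝓕 (hg.toLp g) : Lp ℂ 2 (volume : Measure ℝ)) (k / (2 * Real.pi))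
  else 0

/-- `g ∈ H^t(ℝ)`: `g ∈ L²(ℝ)` and `∫ (1 + |k|)^{2t} |ℱ g(k)|² dk < ∞`. -/
def MemSobolevLine (t : ℝ) (g : ℝ → ℂ) : Prop :=
  MemLp g 2 (volume : Measure ℝ) ∧
    Integrable fun k : ℝ => (1 + |k|) ^ (2 * t) * ‖fourierL2 g k‖ ^ 2

/-- `‖g‖_{H^t(ℝ)}`. -/
def normSobolevLine (t : ℝ) (g : ℝ → ℂ) : ℝ :=
  Real.sqrt (∫ k : ℝ, (1 + |k|) ^ (2 * t) * ‖fourierL2 g k‖ ^ 2)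

/-- The principal-value integral `lim_{R → ∞} ∫_{-R}^R g(x) dx` exists and equals `I`. -/
def HasPVIntegral (g : ℝ → ℂ) (I : ℂ) : Prop :=
  LocallyIntegrable g ∧ Tendsto (fun R : ℝ => ∫ x in (-R)..R, g x) atTop (𝓝 I)

/-- `w` is the `j`-th weak derivative `𝒟^j g` of `g` on `ℝ`. -/
def IsWeakDeriv (j : ℕ) (g w : ℝ → ℂ) : Prop :=
  LocallyIntegrable g ∧ LocallyIntegrable w ∧
    ∀ φ : ℝ → ℝ, ContDiff ℝ ∞ φ → HasCompactSupport φ →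
      ∫ x, ((iteratedDeriv j φ x : ℝ) : ℂ) * g x = (-1) ^ j * ∫ x, (φ x : ℂ) * w x

end

end RationalInterpolation

namespace RationalInterpolation

open MeasureTheory Filter Topology
open scoped FourierTransform ContDiff

noncomputable section

/-! ### The Möbius transformation on the real line -/

section Mobius

variable {β : ℝ}

/-! Since `mobius β x` is e^{iθ} with θ = `angle β x`, Fourier series on the circle become series in
powers of M = `mobius β` on the line. For s > 1/2 the coefficients a of F are absolutely summable,
so f is the Möbius series of a, and the series also gives the right value at the node 0, the image
of infinity (`eq_mobiusSeries`, `hasSum_toTorus`). Interpolation folds each a_l onto the congruent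
frequency in `freqs n`. Hence the error is the Möbius series of c = `errCoeff n a`
(`ratInterp_sub_eq`), and ∑ c_k = 0 (`tsum_errCoeff`). Cauchy–Schwarz on residue classes gives
weighted ℓ² and ℓ¹ bounds on c of orders n^{t-s} and n^{1/2+r-s} (`exists_tsum_sq_errCoeff_le`,
`exists_tsum_errCoeff_le`). It remains to bound norms on the line by norms of coefficients.

The Jacobian dθ/dx is (2 - M - M⁻¹)/(2β), so d/dx acts on coefficients as a tridiagonal operator
that costs one power of `wt`. The ℓ¹ norm then controls all suprema. A derivative carries the
Jacobian as a factor, so its L¹ norm on the line is an L¹ norm on the circle, which Parseval bounds.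

Because ∑ c_k = 0, the powers M^k may be replaced by M^k - 1, of L² norm O(wt^{1/2}). After
averaging x and -x they are replaced by (M^k + M^{-k})/2 - 1, of integral O(wt), which gives the
principal value (`exists_hasPVIntegral_mobiusSeries`).

For real t, the L² norms of the error and of its first derivative are O(n^{1-s}), which settles t ≤
1. For t > 1 the spectrum above N has squared mass O(N^{-2s})
(`exists_setLIntegral_fourier_tsum_mobiusLp_le`), and dyadic summation from N = n converges as t <
s. All these bounds hold without the loss of ε, which enters only by monotonicity of powers of n. -/

theorem real_add_I_mul_ne_zero (hβ : 0 < β) (x : ℝ) : (x : ℂ) + Complex.I * β ≠ 0 := by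
  intro h
  have := congrArg Complex.im h
  simp at this
  exact hβ.ne' this

theorem real_sub_I_mul_ne_zero (hβ : 0 < β) (x : ℝ) : (x : ℂ) - Complex.I * β ≠ 0 := by
  intro h
  have := congrArg Complex.im h
  simp at this
  exact hβ.ne' this

theorem mobius_ne_zero (hβ : 0 < β) (x : ℝ) : mobius β x ≠ 0 :=
  div_ne_zero (real_sub_I_mul_ne_zero hβ x) (real_add_I_mul_ne_zero hβ x)

theorem norm_mobius (hβ : 0 < β) (x : ℝ) : ‖mobius β x‖ = 1 := by
  have h : ‖(x : ℂ) - Complex.I * β‖ = ‖(x : ℂ) + Complex.I * β‖ := by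
    rw [← Complex.norm_conj]
    simp [sub_eq_add_neg]
  rw [mobius, norm_div, h, div_self]
  exact norm_ne_zero_iff.mpr (real_add_I_mul_ne_zero hβ x)

theorem norm_mobius_zpow (hβ : 0 < β) (x : ℝ) (k : ℤ) : ‖mobius β x ^ k‖ = 1 := by
  rw [norm_zpow, norm_mobius hβ, one_zpow]

theorem mobius_neg (x : ℝ) : mobius β ((-x : ℝ) : ℂ) = (mobius β x)⁻¹ := by
  rw [mobius, mobius, inv_div, ← neg_div_neg_eq]
  push_cast
  congr 1 <;> ring

theorem tendsto_mobius (hβ : 0 < β) :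
    Tendsto (fun x : ℝ => mobius β x) (cocompact ℝ) (𝓝 1) := by
  have h1 : ∀ x : ℝ, mobius β x = 1 - 2 * Complex.I * β * ((x : ℂ) + Complex.I * β)⁻¹ := by
    intro x
    have := real_add_I_mul_ne_zero hβ x
    rw [mobius]
    field_simp
    ring
  have h2 : Tendsto (fun x : ℝ => ((x : ℂ) + Complex.I * β)⁻¹) (cocompact ℝ) (𝓝 0) := by
    refine tendsto_inv₀_cobounded.comp ?_
    have h3 : Tendsto (fun x : ℝ => (x : ℂ)) (cocompact ℝ) (Bornology.cobounded ℂ) := by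
      rw [← tendsto_norm_atTop_iff_cobounded]
      simpa only [Complex.norm_real] using tendsto_norm_cocompact_atTop (E := ℝ)
    rw [← tendsto_norm_atTop_iff_cobounded] at h3 ⊢
    refine tendsto_atTop_mono (fun x => ?_) (tendsto_atTop_add_const_right _ (-β) h3)
    have := norm_sub_le ((x : ℂ) + Complex.I * β) (Complex.I * β)
    simp [abs_of_pos hβ] at this ⊢
    linarith
  simp_rw [h1]
  simpa using (tendsto_const_nhds (x := (1 : ℂ))).sub (h2.const_mul (2 * Complex.I * (β : ℂ)))

/-- The derivative of the angle `T⁻¹(x)`. -/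
def angleDeriv (β x : ℝ) : ℝ := 2 * β / (x ^ 2 + β ^ 2)

theorem angleDeriv_pos (hβ : 0 < β) (x : ℝ) : 0 < angleDeriv β x := by
  unfold angleDeriv; positivity

theorem angleDeriv_le (hβ : 0 < β) (x : ℝ) : angleDeriv β x ≤ 2 / β := by
  unfold angleDeriv
  rw [div_le_div_iff₀ (by positivity) hβ]
  nlinarith [sq_nonneg x]

theorem continuous_angleDeriv (hβ : 0 < β) : Continuous (angleDeriv β) := by
  unfold angleDeriv
  refine continuous_const.div (by fun_prop) fun x => by positivity

theorem tendsto_angleDeriv : Tendsto (angleDeriv β) (cocompact ℝ) (𝓝 0) := by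
  unfold angleDeriv
  refine Tendsto.div_atTop tendsto_const_nhds ?_
  refine tendsto_atTop_add_const_right _ _ ?_
  have := (tendsto_pow_atTop (α := ℝ) two_ne_zero).comp (tendsto_norm_cocompact_atTop (E := ℝ))
  refine this.congr fun x => ?_
  simp

/-- In the angle this is (1 - cos θ)/β. Being a trigonometric polynomial of degree one, the Jacobian
multiplies a Möbius series by a three-term rule on coefficients. -/
theorem ofReal_angleDeriv (hβ : 0 < β) (x : ℝ) :
    (angleDeriv β x : ℂ) = (2 - mobius β x - (mobius β x)⁻¹) / (2 * β) := by
  have h1 := real_add_I_mul_ne_zero hβ x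
  have h2 := real_sub_I_mul_ne_zero hβ x
  have h3 : (x : ℂ) ^ 2 + β ^ 2 = ((x : ℂ) + Complex.I * β) * ((x : ℂ) - Complex.I * β) := by
    linear_combination (β ^ 2 : ℂ) * Complex.I_sq
  have h4 : (β : ℂ) ≠ 0 := by exact_mod_cast hβ.ne'
  rw [angleDeriv, mobius]
  push_cast
  rw [h3]
  have hab : ((x : ℂ) + Complex.I * β) - ((x : ℂ) - Complex.I * β) = 2 * Complex.I * β := by ring
  generalize (x : ℂ) + Complex.I * β = b at *
  generalize (x : ℂ) - Complex.I * β = a at *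
  field_simp
  linear_combination (b - a + 2 * Complex.I * β) * hab + (4 * β ^ 2 : ℂ) * Complex.I_sq

theorem hasDerivAt_mobius_zpow (hβ : 0 < β) (k : ℤ) (x : ℝ) :
    HasDerivAt (fun x : ℝ => mobius β x ^ k)
      (angleDeriv β x * (Complex.I * k * mobius β x ^ k)) x := by
  have h1 := real_add_I_mul_ne_zero hβ x
  have h2 := real_sub_I_mul_ne_zero hβ x
  have h0 : HasDerivAt (fun x : ℝ => (x : ℂ)) 1 x := Complex.ofRealCLM.hasDerivAt
  have hm : HasDerivAt (fun x : ℝ => mobius β x) (angleDeriv β x * (Complex.I * mobius β x)) x := by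
    have := (h0.sub_const (Complex.I * β)).div (h0.add_const (Complex.I * β)) h1
    refine this.congr_deriv ?_
    have h3 : (x : ℂ) ^ 2 + β ^ 2 = ((x : ℂ) + Complex.I * β) * ((x : ℂ) - Complex.I * β) := by
      linear_combination (β ^ 2 : ℂ) * Complex.I_sq
    rw [angleDeriv, mobius]
    push_cast
    rw [h3]
    field_simp
    ring
  have := (hasDerivAt_zpow k (mobius β x) (Or.inl (mobius_ne_zero hβ x))).scomp x hm
  refine this.congr_deriv ?_
  rw [smul_eq_mul, zpow_sub_one₀ (mobius_ne_zero hβ x)]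
  have := mobius_ne_zero hβ x
  field_simp

theorem continuous_mobius_zpow (hβ : 0 < β) (k : ℤ) : Continuous fun x : ℝ => mobius β x ^ k :=
  continuous_iff_continuousAt.mpr fun x => (hasDerivAt_mobius_zpow hβ k x).continuousAt

end Mobius

/-! ### Weighted coefficient sequences -/

/-- The weight `1 + |k|`. -/
def wt (k : ℤ) : ℝ := 1 + |(k : ℝ)|

theorem one_le_wt (k : ℤ) : 1 ≤ wt k := by simp [wt]

theorem wt_pos (k : ℤ) : 0 < wt k := one_pos.trans_le (one_le_wt k)

theorem abs_le_wt (k : ℤ) : |(k : ℝ)| ≤ wt k := by simp [wt]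

theorem wt_le_two_mul_wt {k l : ℤ} (h : |k - l| ≤ 1) : wt k ≤ 2 * wt l := by
  have h' : |(k : ℝ) - l| ≤ 1 := by exact_mod_cast h
  have := abs_sub_abs_le_abs_sub (k : ℝ) l
  have := abs_nonneg (l : ℝ)
  unfold wt
  linarith

theorem wt_rpow_le {k l : ℤ} (h : |k - l| ≤ 1) {p : ℝ} (hp : 0 ≤ p) :
    wt k ^ p ≤ 2 ^ p * wt l ^ p := by
  rw [← Real.mul_rpow zero_le_two (wt_pos l).le]
  exact Real.rpow_le_rpow (wt_pos k).le (wt_le_two_mul_wt h) hp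

theorem wt_rpow_pos (k : ℤ) (p : ℝ) : 0 < wt k ^ p := Real.rpow_pos_of_pos (wt_pos k) p

theorem summable_of_wt_rpow {c : ℤ → ℂ} {p q : ℝ} (hpq : p ≤ q)
    (hc : Summable fun k => wt k ^ q * ‖c k‖) : Summable fun k => wt k ^ p * ‖c k‖ :=
  hc.of_nonneg_of_le (fun k => mul_nonneg (wt_rpow_pos k p).le (norm_nonneg _)) fun k =>
    mul_le_mul_of_nonneg_right (Real.rpow_le_rpow_of_exponent_le (one_le_wt k) hpq) (norm_nonneg _)

theorem summable_norm_of_wt_rpow {c : ℤ → ℂ} {q : ℝ} (hq : 0 ≤ q)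
    (hc : Summable fun k => wt k ^ q * ‖c k‖) : Summable fun k => ‖c k‖ := by
  simpa using summable_of_wt_rpow hq hc

theorem summable_and_tsum_le_of_le_neighbours {u b : ℤ → ℝ} {K : ℝ} (hu : ∀ k, 0 ≤ u k)
    (hub : ∀ k, u k ≤ K * (b k + b (k - 1) + b (k + 1))) (hb : Summable b) :
    Summable u ∧ ∑' k, u k ≤ 3 * K * ∑' k, b k := by
  have h1 : Summable fun k => b (k - 1) := (Equiv.subRight (1 : ℤ)).summable_iff.mpr hb
  have h2 : Summable fun k => b (k + 1) := (Equiv.addRight (1 : ℤ)).summable_iff.mpr hb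
  have e1 : ∑' k, b (k - 1) = ∑' k, b k := (Equiv.subRight (1 : ℤ)).tsum_eq b
  have e2 : ∑' k, b (k + 1) = ∑' k, b k := (Equiv.addRight (1 : ℤ)).tsum_eq b
  have h3 := ((hb.add h1).add h2).mul_left K
  have hs : Summable u := h3.of_nonneg_of_le hu hub
  refine ⟨hs, (hs.tsum_le_tsum hub h3).trans_eq ?_⟩
  rw [tsum_mul_left, (hb.add h1).tsum_add h2, hb.tsum_add h1, e1, e2]
  ring

/-- The coefficients of the derivative of a Fourier series. -/
def derivCoeff (c : ℤ → ℂ) (k : ℤ) : ℂ := Complex.I * k * c k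

/-- The coefficients of a Fourier series multiplied by `angleDeriv β`. -/
def weightCoeff (β : ℝ) (c : ℤ → ℂ) (k : ℤ) : ℂ := (2 * c k - c (k - 1) - c (k + 1)) / (2 * β)

/-- The coefficients of the derivative on the line of a series in powers of `mobius β`. -/
def lineDerivCoeff (β : ℝ) (c : ℤ → ℂ) : ℤ → ℂ := weightCoeff β (derivCoeff c)

theorem wt_mul_norm_derivCoeff_le (c : ℤ → ℂ) (p : ℝ) (k : ℤ) :
    wt k ^ p * ‖derivCoeff c k‖ ≤ wt k ^ (p + 1) * ‖c k‖ := by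
  have : ‖derivCoeff c k‖ = |(k : ℝ)| * ‖c k‖ := by simp [derivCoeff]
  rw [this, Real.rpow_add_one (wt_pos k).ne', mul_assoc]
  have := abs_le_wt k
  have := wt_rpow_pos k p
  gcongr

theorem wt_mul_norm_weightCoeff_le {β : ℝ} (hβ : 0 < β) (c : ℤ → ℂ) {p : ℝ} (hp : 0 ≤ p) (k : ℤ) :
    wt k ^ p * ‖weightCoeff β c k‖ ≤ (2 * 2 ^ p / (2 * β)) *
      (wt k ^ p * ‖c k‖ + wt (k - 1) ^ p * ‖c (k - 1)‖ + wt (k + 1) ^ p * ‖c (k + 1)‖) := by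
  have h2 : (1 : ℝ) ≤ 2 ^ p := Real.one_le_rpow one_le_two hp
  have hn : ‖weightCoeff β c k‖ ≤ (2 * ‖c k‖ + ‖c (k - 1)‖ + ‖c (k + 1)‖) / (2 * β) := by
    rw [weightCoeff, norm_div]
    have : ‖(2 * β : ℂ)‖ = 2 * β := by simp [abs_of_pos hβ]
    rw [this]
    gcongr
    refine (norm_sub_le _ _).trans ?_
    gcongr
    refine (norm_sub_le _ _).trans ?_
    gcongr
    simp
  have a1 : wt k ^ p ≤ 2 ^ p * wt (k - 1) ^ p := wt_rpow_le (by simp) hp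
  have a2 : wt k ^ p ≤ 2 ^ p * wt (k + 1) ^ p := wt_rpow_le (by simp) hp
  have a0 := wt_rpow_pos k p
  have b1 := mul_le_mul_of_nonneg_right a1 (norm_nonneg (c (k - 1)))
  have b2 := mul_le_mul_of_nonneg_right a2 (norm_nonneg (c (k + 1)))
  have b0 : wt k ^ p * ‖c k‖ ≤ 2 ^ p * (wt k ^ p * ‖c k‖) :=
    le_mul_of_one_le_left (by positivity) h2
  have c1 := wt_rpow_pos (k - 1) p
  have c2 := wt_rpow_pos (k + 1) p
  have d1 : 0 ≤ 2 ^ p * wt (k - 1) ^ p * ‖c (k - 1)‖ := by positivity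
  have d2 : 0 ≤ 2 ^ p * wt (k + 1) ^ p * ‖c (k + 1)‖ := by positivity
  calc wt k ^ p * ‖weightCoeff β c k‖
      ≤ wt k ^ p * ((2 * ‖c k‖ + ‖c (k - 1)‖ + ‖c (k + 1)‖) / (2 * β)) := by gcongr
    _ = (2 * (wt k ^ p * ‖c k‖) + wt k ^ p * ‖c (k - 1)‖ + wt k ^ p * ‖c (k + 1)‖) / (2 * β) := by
        ring
    _ ≤ (2 * (2 ^ p * (wt k ^ p * ‖c k‖)) + 2 * (2 ^ p * wt (k - 1) ^ p * ‖c (k - 1)‖)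
          + 2 * (2 ^ p * wt (k + 1) ^ p * ‖c (k + 1)‖)) / (2 * β) := by
        refine div_le_div_of_nonneg_right ?_ (by positivity)
        linarith
    _ = _ := by ring

theorem wt_mul_norm_lineDerivCoeff_le {β : ℝ} (hβ : 0 < β) (c : ℤ → ℂ) {p : ℝ} (hp : 0 ≤ p)
    (k : ℤ) : wt k ^ p * ‖lineDerivCoeff β c k‖ ≤ (2 * 2 ^ p / (2 * β)) *
      (wt k ^ (p + 1) * ‖c k‖ + wt (k - 1) ^ (p + 1) * ‖c (k - 1)‖
        + wt (k + 1) ^ (p + 1) * ‖c (k + 1)‖) := by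
  refine (wt_mul_norm_weightCoeff_le hβ _ hp k).trans ?_
  have h := wt_mul_norm_derivCoeff_le c p
  exact mul_le_mul_of_nonneg_left (add_le_add (add_le_add (h k) (h _)) (h _)) (by positivity)

theorem exists_tsum_lineDerivCoeff_le {β : ℝ} (hβ : 0 < β) {p : ℝ} (hp : 0 ≤ p) :
    ∃ K, 0 ≤ K ∧ ∀ c : ℤ → ℂ, Summable (fun k => wt k ^ (p + 1) * ‖c k‖) →
      Summable (fun k => wt k ^ p * ‖lineDerivCoeff β c k‖) ∧
      ∑' k, wt k ^ p * ‖lineDerivCoeff β c k‖ ≤ K * ∑' k, wt k ^ (p + 1) * ‖c k‖ := by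
  refine ⟨3 * (2 * 2 ^ p / (2 * β)), by positivity, fun c hc => ?_⟩
  exact summable_and_tsum_le_of_le_neighbours
    (fun k => mul_nonneg (wt_rpow_pos k p).le (norm_nonneg _))
    (wt_mul_norm_lineDerivCoeff_le hβ c hp) hc

theorem exists_tsum_sq_lineDerivCoeff_le {β : ℝ} (hβ : 0 < β) {p : ℝ} (hp : 0 ≤ p) :
    ∃ K, 0 ≤ K ∧ ∀ c : ℤ → ℂ, Summable (fun k => (wt k ^ (p + 1) * ‖c k‖) ^ 2) →
      Summable (fun k => (wt k ^ p * ‖lineDerivCoeff β c k‖) ^ 2) ∧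
      ∑' k, (wt k ^ p * ‖lineDerivCoeff β c k‖) ^ 2
        ≤ K * ∑' k, (wt k ^ (p + 1) * ‖c k‖) ^ 2 := by
  -- The outer 3 counts the three shifts of the majorant; the inner 3 is from (x + y + z)² ≤ 3 (x² +
  -- y² + z²).
  refine ⟨3 * (3 * (2 * 2 ^ p / (2 * β)) ^ 2), by positivity, fun c hc => ?_⟩
  refine summable_and_tsum_le_of_le_neighbours (fun k => sq_nonneg _) (fun k => ?_) hc
  have h := wt_mul_norm_lineDerivCoeff_le hβ c hp k
  have h0 : 0 ≤ wt k ^ p * ‖lineDerivCoeff β c k‖ :=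
    mul_nonneg (wt_rpow_pos k p).le (norm_nonneg _)
  refine (pow_le_pow_left₀ h0 h 2).trans ?_
  rw [mul_pow, mul_comm (3 : ℝ), mul_assoc]
  gcongr
  generalize wt k ^ (p + 1) * ‖c k‖ = x
  generalize wt (k - 1) ^ (p + 1) * ‖c (k - 1)‖ = y
  generalize wt (k + 1) ^ (p + 1) * ‖c (k + 1)‖ = z
  nlinarith [sq_nonneg (x - y), sq_nonneg (y - z), sq_nonneg (x - z)]

theorem exists_tsum_iterate_lineDerivCoeff_le {β : ℝ} (hβ : 0 < β) {p : ℝ} (hp : 0 ≤ p) (j : ℕ) :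
    ∃ K, 0 ≤ K ∧ ∀ c : ℤ → ℂ, Summable (fun k => wt k ^ (p + j) * ‖c k‖) →
      Summable (fun k => wt k ^ p * ‖(lineDerivCoeff β)^[j] c k‖) ∧
      ∑' k, wt k ^ p * ‖(lineDerivCoeff β)^[j] c k‖ ≤ K * ∑' k, wt k ^ (p + j) * ‖c k‖ := by
  induction j generalizing p with
  | zero => exact ⟨1, zero_le_one, fun c hc => by simpa using hc⟩
  | succ j ih =>
    obtain ⟨K₁, hK₁, h₁⟩ := exists_tsum_lineDerivCoeff_le hβ hp
    -- The outermost derivative lowers the exponent from p + 1 to p, so the other j derivatives must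
    -- be controlled at p + 1.
    obtain ⟨K₂, hK₂, h₂⟩ := ih (p := p + 1) (by linarith)
    refine ⟨K₁ * K₂, mul_nonneg hK₁ hK₂, fun c hc => ?_⟩
    have e : p + ((j + 1 : ℕ) : ℝ) = p + 1 + j := by push_cast; ring
    rw [e] at hc ⊢
    obtain ⟨s₂, t₂⟩ := h₂ c hc
    obtain ⟨s₁, t₁⟩ := h₁ _ s₂
    simp only [Function.iterate_succ_apply']
    refine ⟨s₁, t₁.trans ?_⟩
    rw [mul_assoc]
    gcongr

theorem exists_tsum_sq_iterate_lineDerivCoeff_le {β : ℝ} (hβ : 0 < β) {p : ℝ} (hp : 0 ≤ p)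
    (j : ℕ) :
    ∃ K, 0 ≤ K ∧ ∀ c : ℤ → ℂ, Summable (fun k => (wt k ^ (p + j) * ‖c k‖) ^ 2) →
      Summable (fun k => (wt k ^ p * ‖(lineDerivCoeff β)^[j] c k‖) ^ 2) ∧
      ∑' k, (wt k ^ p * ‖(lineDerivCoeff β)^[j] c k‖) ^ 2
        ≤ K * ∑' k, (wt k ^ (p + j) * ‖c k‖) ^ 2 := by
  induction j generalizing p with
  | zero => exact ⟨1, zero_le_one, fun c hc => by simpa using hc⟩
  | succ j ih =>
    obtain ⟨K₁, hK₁, h₁⟩ := exists_tsum_sq_lineDerivCoeff_le hβ hp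
    obtain ⟨K₂, hK₂, h₂⟩ := ih (p := p + 1) (by linarith)
    refine ⟨K₁ * K₂, mul_nonneg hK₁ hK₂, fun c hc => ?_⟩
    have e : p + ((j + 1 : ℕ) : ℝ) = p + 1 + j := by push_cast; ring
    rw [e] at hc ⊢
    obtain ⟨s₂, t₂⟩ := h₂ c hc
    obtain ⟨s₁, t₁⟩ := h₁ _ s₂
    simp only [Function.iterate_succ_apply']
    refine ⟨s₁, t₁.trans ?_⟩
    rw [mul_assoc]
    gcongr

/-! ### Series in powers of the Möbius transformation -/

/-- The function `x ↦ ∑ c_k M_β(x)^k`. -/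
def mobiusSeries (β : ℝ) (c : ℤ → ℂ) (x : ℝ) : ℂ := ∑' k : ℤ, c k * mobius β x ^ k

section MobiusSeries

variable {β : ℝ} {c : ℤ → ℂ}

theorem norm_mul_mobius_zpow (hβ : 0 < β) (k : ℤ) (x : ℝ) : ‖c k * mobius β x ^ k‖ = ‖c k‖ := by
  rw [norm_mul, norm_mobius_zpow hβ, mul_one]

theorem summable_mul_mobius_zpow (hβ : 0 < β) (hc : Summable fun k => ‖c k‖) (x : ℝ) :
    Summable fun k => c k * mobius β x ^ k :=
  Summable.of_norm (by simpa only [norm_mul_mobius_zpow hβ] using hc)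

theorem norm_mobiusSeries_le (hβ : 0 < β) (hc : Summable fun k => ‖c k‖) (x : ℝ) :
    ‖mobiusSeries β c x‖ ≤ ∑' k, ‖c k‖ := by
  refine (norm_tsum_le_tsum_norm ?_).trans_eq ?_ <;> simp only [norm_mul_mobius_zpow hβ, hc]

theorem continuous_mobiusSeries (hβ : 0 < β) (hc : Summable fun k => ‖c k‖) :
    Continuous (mobiusSeries β c) :=
  continuous_tsum (fun k => continuous_const.mul (continuous_mobius_zpow hβ k)) hc
    fun k x => (norm_mul_mobius_zpow hβ k x).le

theorem tendsto_mobiusSeries (hβ : 0 < β) (hc : Summable fun k => ‖c k‖) :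
    Tendsto (mobiusSeries β c) (cocompact ℝ) (𝓝 (∑' k, c k)) := by
  refine tendsto_tsum_of_dominated_convergence hc (fun k => ?_)
    (Eventually.of_forall fun x k => (norm_mul_mobius_zpow hβ k x).le)
  simpa using ((tendsto_mobius hβ).zpow₀ k (Or.inl one_ne_zero)).const_mul (c k)

theorem hasSum_shift {E : Type*} [AddCommMonoid E] [TopologicalSpace E] {g : ℤ → E} {a : E}
    (h : HasSum g a) (m : ℤ) : HasSum (fun k => g (k + m)) a :=
  (Equiv.hasSum_iff (Equiv.addRight m)).mpr h

theorem hasSum_mobiusSeries (hβ : 0 < β) (hc : Summable fun k => ‖c k‖) (x : ℝ) :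
    HasSum (fun k => c k * mobius β x ^ k) (mobiusSeries β c x) :=
  (summable_mul_mobius_zpow hβ hc x).hasSum

theorem hasSum_mobiusSeries_shift (hβ : 0 < β) (hc : Summable fun k => ‖c k‖) (x : ℝ) (m : ℤ) :
    HasSum (fun k => c (k + m) * mobius β x ^ (k + m)) (mobiusSeries β c x) :=
  hasSum_shift (hasSum_mobiusSeries hβ hc x) m

/-- Multiplication by M or M⁻¹ shifts the coefficients by one, so the formula for the Jacobian can
be applied term by term. -/
theorem mobiusSeries_weightCoeff (hβ : 0 < β) (hc : Summable fun k => ‖c k‖) (x : ℝ) :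
    mobiusSeries β (weightCoeff β c) x = angleDeriv β x * mobiusSeries β c x := by
  have hM := mobius_ne_zero hβ x
  have h := (((hasSum_mobiusSeries hβ hc x).mul_left 2).sub
    ((hasSum_mobiusSeries_shift hβ hc x (-1)).mul_left (mobius β x))).sub
    ((hasSum_mobiusSeries_shift hβ hc x 1).mul_left (mobius β x)⁻¹)
  rw [ofReal_angleDeriv hβ]
  have e : ∀ k, weightCoeff β c k * mobius β x ^ k = 1 / (2 * β : ℂ) *
      (2 * (c k * mobius β x ^ k) - mobius β x * (c (k + -1) * mobius β x ^ (k + -1)) -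
        (mobius β x)⁻¹ * (c (k + 1) * mobius β x ^ (k + 1))) := by
    intro k
    rw [weightCoeff, ← sub_eq_add_neg, zpow_sub_one₀ hM, zpow_add_one₀ hM]
    field_simp
  rw [mobiusSeries, tsum_congr e]
  refine (h.mul_left (1 / (2 * β : ℂ))).tsum_eq.trans ?_
  ring

theorem summable_norm_derivCoeff (hc : Summable fun k => wt k ^ (1 : ℝ) * ‖c k‖) :
    Summable fun k => ‖derivCoeff c k‖ :=
  hc.of_nonneg_of_le (fun _ => norm_nonneg _) fun k => by
    simpa using wt_mul_norm_derivCoeff_le c 0 k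

theorem mobiusSeries_lineDerivCoeff (hβ : 0 < β) (hc : Summable fun k => wt k ^ (1 : ℝ) * ‖c k‖)
    (x : ℝ) : mobiusSeries β (lineDerivCoeff β c) x =
      angleDeriv β x * mobiusSeries β (derivCoeff c) x :=
  mobiusSeries_weightCoeff hβ (summable_norm_derivCoeff hc) x

/-- Termwise differentiation is legitimate because the Jacobian is at most 2/β, which makes the
differentiated series uniformly dominated by ∑ |k| ‖c_k‖. -/
theorem hasDerivAt_mobiusSeries (hβ : 0 < β) (hc : Summable fun k => wt k ^ (1 : ℝ) * ‖c k‖)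
    (x : ℝ) : HasDerivAt (mobiusSeries β c) (mobiusSeries β (lineDerivCoeff β c) x) x := by
  have h0 : Summable fun k => ‖c k‖ := summable_norm_of_wt_rpow zero_le_one hc
  have h1 := summable_norm_derivCoeff hc
  have := hasDerivAt_tsum (𝕜 := ℝ) (F := ℂ) (h1.mul_left (2 / β))
    (fun k y => (hasDerivAt_mobius_zpow hβ k y).const_mul (c k)) (fun k y => ?_)
    (summable_mul_mobius_zpow hβ h0 x) x
  · refine this.congr_deriv ?_
    rw [mobiusSeries_lineDerivCoeff hβ hc, mobiusSeries, ← tsum_mul_left]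
    refine tsum_congr fun k => ?_
    rw [derivCoeff]
    ring
  · have e : c k * (angleDeriv β y * (Complex.I * k * mobius β y ^ k)) =
        angleDeriv β y * (derivCoeff c k * mobius β y ^ k) := by rw [derivCoeff]; ring
    rw [e, norm_mul, norm_mul_mobius_zpow hβ, Complex.norm_real, Real.norm_eq_abs,
      abs_of_pos (angleDeriv_pos hβ y)]
    have := angleDeriv_le hβ y
    gcongr

theorem summable_iterate_lineDerivCoeff (hβ : 0 < β) {p : ℝ} (hp : 0 ≤ p) {j : ℕ}
    (hc : Summable fun k => wt k ^ (p + j) * ‖c k‖) :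
    Summable fun k => wt k ^ p * ‖(lineDerivCoeff β)^[j] c k‖ :=
  ((exists_tsum_iterate_lineDerivCoeff_le hβ hp j).choose_spec.2 c hc).1

theorem iteratedDeriv_mobiusSeries (hβ : 0 < β) {j : ℕ}
    (hc : Summable fun k => wt k ^ (j : ℝ) * ‖c k‖) :
    iteratedDeriv j (mobiusSeries β c) = mobiusSeries β ((lineDerivCoeff β)^[j] c) := by
  induction j with
  | zero => simp
  | succ j ih =>
    rw [iteratedDeriv_succ, ih (summable_of_wt_rpow (by simp) hc), Function.iterate_succ_apply']
    ext x
    refine (hasDerivAt_mobiusSeries hβ ?_ x).deriv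
    refine summable_iterate_lineDerivCoeff hβ zero_le_one ?_
    refine hc.congr fun k => ?_
    push_cast
    rw [add_comm]

theorem differentiable_iteratedDeriv_mobiusSeries (hβ : 0 < β) {j : ℕ}
    (hc : Summable fun k => wt k ^ ((j : ℝ) + 1) * ‖c k‖) :
    Differentiable ℝ (iteratedDeriv j (mobiusSeries β c)) := by
  rw [iteratedDeriv_mobiusSeries hβ (summable_of_wt_rpow (by simp) hc)]
  intro x
  refine (hasDerivAt_mobiusSeries hβ ?_ x).differentiableAt
  refine summable_iterate_lineDerivCoeff hβ zero_le_one ?_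
  refine hc.congr fun k => ?_
  rw [add_comm]

theorem contDiff_mobiusSeries (hβ : 0 < β) {r : ℕ}
    (hc : Summable fun k => wt k ^ (r : ℝ) * ‖c k‖) : ContDiff ℝ r (mobiusSeries β c) := by
  rw [contDiff_nat_iff_iteratedDeriv]
  constructor
  · intro m hm
    have hm' : (m : ℝ) ≤ r := by exact_mod_cast hm
    rw [iteratedDeriv_mobiusSeries hβ (summable_of_wt_rpow hm' hc)]
    refine continuous_mobiusSeries hβ ?_
    have := summable_iterate_lineDerivCoeff hβ le_rfl (c := c) (j := m)
      (summable_of_wt_rpow (by simpa using hm') hc)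
    simpa using this
  · intro m hm
    refine differentiable_iteratedDeriv_mobiusSeries hβ (summable_of_wt_rpow ?_ hc)
    exact_mod_cast hm

/-- At infinity M tends to 1, so the series tends to ∑ c_k. Only order zero needs this sum to
vanish: a derivative contains the Jacobian, which decays, times a bounded function. -/
theorem tendsto_iteratedDeriv_mobiusSeries (hβ : 0 < β) {j : ℕ} (h0 : ∑' k, c k = 0)
    (hc : Summable fun k => wt k ^ (j : ℝ) * ‖c k‖) :
    Tendsto (iteratedDeriv j (mobiusSeries β c)) (cocompact ℝ) (𝓝 0) := by
  rw [iteratedDeriv_mobiusSeries hβ hc]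
  cases j with
  | zero =>
    rw [← h0]
    exact tendsto_mobiusSeries hβ (by simpa using hc)
  | succ j =>
    have h1 : Summable fun k => wt k ^ (1 : ℝ) * ‖(lineDerivCoeff β)^[j] c k‖ := by
      refine summable_iterate_lineDerivCoeff hβ zero_le_one ?_
      refine hc.congr fun k => ?_
      push_cast
      rw [add_comm]
    rw [Function.iterate_succ_apply']
    have h2 := summable_norm_derivCoeff h1
    have := ((Complex.continuous_ofReal.tendsto 0).comp (tendsto_angleDeriv (β := β))).mul
      (tendsto_mobiusSeries hβ h2)
    rw [Complex.ofReal_zero, zero_mul] at this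
    exact this.congr fun x => (mobiusSeries_lineDerivCoeff hβ h1 x).symm

end MobiusSeries

/-! ### Frequencies of the interpolant and aliasing -/

theorem summable_mul_and_tsum_mul_le {ι : Type*} {u v : ι → ℝ} (hu : ∀ i, 0 ≤ u i)
    (hv : ∀ i, 0 ≤ v i) (hu2 : Summable fun i => u i ^ 2) (hv2 : Summable fun i => v i ^ 2) :
    (Summable fun i => u i * v i) ∧
      ∑' i, u i * v i ≤ √(∑' i, u i ^ 2) * √(∑' i, v i ^ 2) := by
  have h := Real.summable_and_inner_le_Lp_mul_Lq_tsum_of_nonneg Real.HolderConjugate.two_two hu hv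
    (by simpa using hu2) (by simpa using hv2)
  simpa [Real.sqrt_eq_rpow] using h

/-- The frequencies `-n₋, …, n₊` of the trigonometric interpolant. -/
def freqs (n : ℕ) : Finset ℤ := Finset.Icc (-(((n - 1) / 2 : ℕ) : ℤ)) ((n / 2 : ℕ) : ℤ)

theorem card_freqs {n : ℕ} (hn : 1 ≤ n) : (freqs n).card = n := by
  rw [freqs, Int.card_Icc]
  omega

theorem abs_le_of_mem_freqs {n : ℕ} {k : ℤ} (hk : k ∈ freqs n) : 2 * |(k : ℝ)| ≤ n := by
  rw [freqs, Finset.mem_Icc] at hk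
  have : 2 * |k| ≤ n := by
    rcases abs_cases k with h | h <;> omega
  exact_mod_cast this

theorem wt_le_of_mem_freqs {n : ℕ} (hn : 1 ≤ n) {k : ℤ} (hk : k ∈ freqs n) : wt k ≤ 2 * n := by
  have h := abs_le_of_mem_freqs hk
  have : (1 : ℝ) ≤ n := by exact_mod_cast hn
  unfold wt
  linarith

theorem le_wt_of_notMem_freqs {n : ℕ} {k : ℤ} (hk : k ∉ freqs n) : (n : ℝ) / 2 ≤ wt k := by
  rw [freqs, Finset.mem_Icc] at hk
  have : (n : ℤ) ≤ 2 * |k| := by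
    rcases abs_cases k with h | h <;> omega
  have : (n : ℝ) ≤ 2 * |(k : ℝ)| := by exact_mod_cast this
  unfold wt
  linarith

/-- The frequencies are n consecutive integers, hence a complete residue system modulo n. -/
theorem exists_mem_freqs_dvd_iff {n : ℕ} (hn : 1 ≤ n) (l : ℤ) :
    ∃ k₀ ∈ freqs n, ∀ k ∈ freqs n, (n : ℤ) ∣ l - k ↔ k = k₀ := by
  set m : ℤ := (((n - 1) / 2 : ℕ) : ℤ) with hm
  have h0 : (n : ℤ) ≠ 0 := by omega
  have h1 := Int.emod_nonneg (l + m) h0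
  have h2 := Int.emod_lt_of_pos (l + m) (b := (n : ℤ)) (by omega)
  have h3 := Int.mul_ediv_add_emod (l + m) n
  -- Shifting by n₋ moves the frequencies to 0, …, n - 1, where the representative is the remainder.
  refine ⟨(l + m) % n - m, ?_, fun k hk => ⟨?_, ?_⟩⟩
  · rw [freqs, Finset.mem_Icc]
    omega
  · rintro ⟨q, hq⟩
    rw [freqs, Finset.mem_Icc] at hk
    have : (l + m) % n = k + m := by
      have e : l + m = (k + m) + n * q := by linarith
      rw [e, Int.add_mul_emod_self_left]
      exact Int.emod_eq_of_lt (by omega) (by omega)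
    omega
  · rintro rfl
    exact ⟨(l + m) / n, by linarith⟩

theorem sum_freqs_ite_dvd {E : Type*} [AddCommMonoid E] {n : ℕ} (hn : 1 ≤ n) (l : ℤ) (x : E) :
    (∑ k ∈ freqs n, if (n : ℤ) ∣ l - k then x else 0) = x := by
  obtain ⟨k₀, h₀, h⟩ := exists_mem_freqs_dvd_iff hn l
  rw [Finset.sum_congr rfl fun k hk => if_congr (h k hk) rfl rfl, Finset.sum_ite_eq' _ _ _,
    if_pos h₀]

theorem summable_ite {E : Type*} [NormedAddCommGroup E] [CompleteSpace E] {ι : Type*} {h : ι → E}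
    (hs : Summable h) (p : ι → Prop) [DecidablePred p] :
    Summable fun l => if p l then h l else 0 := by
  refine (hs.indicator {l | p l}).congr fun l => ?_
  by_cases hp : p l <;> simp [hp]

theorem sum_freqs_tsum_ite_dvd {E : Type*} [NormedAddCommGroup E] [CompleteSpace E] {n : ℕ}
    (hn : 1 ≤ n) {h : ℤ → E} (hs : Summable h) :
    (∑ k ∈ freqs n, ∑' l, if (n : ℤ) ∣ l - k then h l else 0) = ∑' l, h l := by
  rw [← Summable.tsum_finsetSum fun k _ => summable_ite hs _]
  exact tsum_congr fun l => sum_freqs_ite_dvd hn l (h l)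

theorem hasSum_ite_mem {E ι : Type*} [AddCommMonoid E] [TopologicalSpace E] [DecidableEq ι]
    (s : Finset ι) (f : ι → E) : HasSum (fun k => if k ∈ s then f k else 0) (∑ k ∈ s, f k) := by
  have h : HasSum (fun k => if k ∈ s then f k else 0) (∑ k ∈ s, if k ∈ s then f k else 0) :=
    hasSum_sum_of_ne_finset_zero fun k hk => if_neg hk
  rwa [Finset.sum_congr rfl fun k hk => if_pos hk] at h

/-- The proper aliases of k are k + nm with m ≠ 0. As |k| ≤ n/2, they have size at least n|m|/2, so
the sum is dominated by n^{-p} times a convergent p-series. -/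
theorem exists_tsum_wt_rpow_residue_le {p : ℝ} (hp : 1 < p) :
    ∃ C, 0 ≤ C ∧ ∀ n : ℕ, 1 ≤ n → ∀ k ∈ freqs n,
      Summable (fun l => if (n : ℤ) ∣ l - k ∧ l ≠ k then wt l ^ (-p) else 0) ∧
      (∑' l, if (n : ℤ) ∣ l - k ∧ l ≠ k then wt l ^ (-p) else 0) ≤ C * (n : ℝ) ^ (-p) := by
  have hsum : Summable fun m : ℤ => |(m : ℝ)| ^ (-p) := Real.summable_abs_int_rpow hp
  refine ⟨2 ^ p * ∑' m : ℤ, |(m : ℝ)| ^ (-p),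
    mul_nonneg (by positivity) (tsum_nonneg fun m => by positivity), fun n hn k hk => ?_⟩
  have hn0 : n ≠ 0 := by omega
  have hnpos : (0 : ℝ) < n := by exact_mod_cast hn
  set u : ℤ → ℝ := fun l => if (n : ℤ) ∣ l - k ∧ l ≠ k then wt l ^ (-p) else 0 with hu
  set φ : ℤ → ℤ := fun m => k + n * m with hφ
  have hinj : Function.Injective φ := fun a b hab => by
    simpa [hφ, hn0] using hab
  have hsupp : Function.support u ⊆ Set.range φ := by
    intro l hl
    by_contra hcon
    refine hl (if_neg fun h => hcon ?_)
    obtain ⟨q, hq⟩ := h.1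
    exact ⟨q, by simp only [hφ]; linarith⟩
  have hle : ∀ m, u (φ m) ≤ 2 ^ p * (n : ℝ) ^ (-p) * |(m : ℝ)| ^ (-p) := by
    intro m
    by_cases hm : m = 0
    · simp only [hu, hφ, hm]
      simp
      positivity
    · have hm1 : (1 : ℝ) ≤ |(m : ℝ)| := by exact_mod_cast Int.one_le_abs hm
      have h1 : u (φ m) = wt (φ m) ^ (-p) := by
        refine if_pos ⟨⟨m, by simp [hφ]⟩, ?_⟩
        simp [hφ, hn0, hm]
      have h2 : (n : ℝ) * |(m : ℝ)| / 2 ≤ wt (φ m) := by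
        have hk' := abs_le_of_mem_freqs hk
        have h3 : |(n : ℝ) * m| - |(k : ℝ)| ≤ |(n : ℝ) * m + k| := by
          have := abs_sub_abs_le_abs_sub ((n : ℝ) * m) (-k)
          simpa using this
        rw [abs_mul, Nat.abs_cast] at h3
        have h4 : wt (φ m) = 1 + |(n : ℝ) * m + k| := by
          simp [wt, hφ, add_comm]
        rw [h4]
        nlinarith
      rw [h1]
      calc wt (φ m) ^ (-p) ≤ ((n : ℝ) * |(m : ℝ)| / 2) ^ (-p) :=
            Real.rpow_le_rpow_of_nonpos (by positivity) h2 (by linarith)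
        _ = _ := by
          rw [Real.div_rpow (by positivity) zero_le_two, Real.mul_rpow hnpos.le (abs_nonneg _),
            Real.rpow_neg zero_le_two]
          field_simp
  have hs' : Summable (u ∘ φ) := by
    refine (hsum.mul_left _).of_nonneg_of_le (fun m => ?_) hle
    simp only [Function.comp, hu]
    split_ifs
    · exact (wt_rpow_pos _ _).le
    · exact le_rfl
  have hsupp' : ∀ x ∉ Set.range φ, u x = 0 := fun x hx => by
    by_contra h
    exact hx (hsupp h)
  refine ⟨(hinj.summable_iff hsupp').mp hs', ?_⟩
  rw [← hinj.tsum_eq hsupp]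
  refine (hs'.tsum_le_tsum hle (hsum.mul_left _)).trans_eq ?_
  rw [tsum_mul_left]
  ring

theorem summable_wt_rpow {p : ℝ} (hp : 1 < p) : Summable fun k => wt k ^ (-p) := by
  have hsum : Summable fun m : ℤ => |(m : ℝ)| ^ (-p) := Real.summable_abs_int_rpow hp
  refine Summable.of_norm_bounded_eventually hsum ?_
  filter_upwards [(Set.finite_singleton (0 : ℤ)).compl_mem_cofinite] with k hk
  rw [Real.norm_of_nonneg (wt_rpow_pos k _).le]
  refine Real.rpow_le_rpow_of_nonpos ?_ (abs_le_wt k) (by linarith)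
  have : k ≠ 0 := hk
  positivity

/-- Each frequency outside the band is a proper alias of exactly one frequency inside it. Adding the
n residue class bounds turns n^{-p} into n^{1-p}. -/
theorem exists_tsum_wt_rpow_tail_le {p : ℝ} (hp : 1 < p) :
    ∃ C, 0 ≤ C ∧ ∀ n : ℕ, 1 ≤ n →
      (∑' l, if l ∉ freqs n then wt l ^ (-p) else 0) ≤ C * (n : ℝ) ^ (1 - p) := by
  obtain ⟨C, hC, h⟩ := exists_tsum_wt_rpow_residue_le hp
  refine ⟨C, hC, fun n hn => ?_⟩
  have hnpos : (0 : ℝ) < n := by exact_mod_cast hn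
  have hs := summable_ite (summable_wt_rpow hp) (fun l => l ∉ freqs n)
  rw [← sum_freqs_tsum_ite_dvd hn hs]
  refine (Finset.sum_le_sum (g := fun _ => C * (n : ℝ) ^ (-p)) fun k hk => ?_).trans_eq ?_
  · refine ((summable_ite hs _).tsum_le_tsum (fun l => ?_) (h n hn k hk).1).trans (h n hn k hk).2
    have := (wt_rpow_pos l (-p)).le
    by_cases h1 : (n : ℤ) ∣ l - k
    · by_cases h2 : l = k
      · simp [h2, hk]
      · by_cases h3 : l ∈ freqs n <;> simp [h1, h2, h3, this]
    · simp [h1]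
  · rw [Finset.sum_const, card_freqs hn, nsmul_eq_mul, sub_eq_add_neg, Real.rpow_add hnpos,
      Real.rpow_one]
    ring

/-- The Fourier coefficients of the error of trigonometric interpolation of `∑ a_k e^{ikθ}`. -/
def errCoeff (n : ℕ) (a : ℤ → ℂ) (k : ℤ) : ℂ :=
  (if k ∈ freqs n then ∑' l, if (n : ℤ) ∣ l - k then a l else 0 else 0) - a k

section ErrCoeff

variable {n : ℕ} {a : ℤ → ℂ}

theorem errCoeff_of_notMem {k : ℤ} (hk : k ∉ freqs n) : errCoeff n a k = -a k := by
  simp [errCoeff, hk]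

theorem errCoeff_of_mem (ha : Summable a) {k : ℤ} (hk : k ∈ freqs n) :
    errCoeff n a k = ∑' l, if (n : ℤ) ∣ l - k ∧ l ≠ k then a l else 0 := by
  rw [errCoeff, if_pos hk, (summable_ite ha _).tsum_eq_add_tsum_ite k]
  simp only [sub_self, dvd_zero, if_true, add_sub_cancel_left]
  refine tsum_congr fun l => ?_
  by_cases h : l = k <;> simp [h]

/-- Aliasing only regroups the coefficients, so their total is preserved. Equivalently, the
interpolant is exact at the node θ = 0, and the error vanishes at infinity. -/
theorem tsum_errCoeff (hn : 1 ≤ n) (ha : Summable a) : ∑' k, errCoeff n a k = 0 := by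
  have h1 : HasSum (fun k => if k ∈ freqs n then ∑' l, if (n : ℤ) ∣ l - k then a l else 0 else 0)
      (∑ k ∈ freqs n, ∑' l, if (n : ℤ) ∣ l - k then a l else 0) := hasSum_ite_mem _ _
  rw [sum_freqs_tsum_ite_dvd hn ha] at h1
  exact (h1.sub ha.hasSum).tsum_eq.trans (sub_self _)

theorem wt_neg_mul_wt_mul (s : ℝ) (k : ℤ) (x : ℝ) : wt k ^ (-s) * (wt k ^ s * x) = x := by
  rw [← mul_assoc, ← Real.rpow_add (wt_pos k), neg_add_cancel, Real.rpow_zero, one_mul]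

theorem wt_rpow_sq (k : ℤ) (s : ℝ) : (wt k ^ s) ^ 2 = wt k ^ (2 * s) := by
  rw [← Real.rpow_natCast, ← Real.rpow_mul (wt_pos k).le, mul_comm]
  norm_num

/-- Cauchy–Schwarz against wt^{-s}, which is square summable exactly because 2s > 1. -/
theorem summable_norm_of_summable_sq {s : ℝ} (hs : 1 / 2 < s)
    (ha : Summable fun k => (wt k ^ s * ‖a k‖) ^ 2) : Summable fun k => ‖a k‖ := by
  have h := (summable_mul_and_tsum_mul_le (u := fun k => wt k ^ (-s))
    (fun k => (wt_rpow_pos k _).le) (fun k => mul_nonneg (wt_rpow_pos k s).le (norm_nonneg _))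
    ?_ ha).1
  · simpa only [wt_neg_mul_wt_mul] using h
  · refine (summable_wt_rpow (p := 2 * s) (by linarith)).congr fun k => ?_
    rw [wt_rpow_sq]
    ring_nf

/-- Inside the band the error is a sum over proper aliases. Cauchy–Schwarz with the weights wt^{-s}
and wt^s bounds it by n^{-s} times the weighted ℓ² norm on one residue class, and the classes
partition ℤ. -/
theorem exists_sum_freqs_sq_errCoeff_le {s : ℝ} (hs : 1 / 2 < s) :
    ∃ C, 0 ≤ C ∧ ∀ n : ℕ, 1 ≤ n → ∀ a : ℤ → ℂ, Summable (fun k => (wt k ^ s * ‖a k‖) ^ 2) →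
      ∑ k ∈ freqs n, ‖errCoeff n a k‖ ^ 2 ≤
        C * (n : ℝ) ^ (-(2 * s)) * ∑' k, (wt k ^ s * ‖a k‖) ^ 2 := by
  obtain ⟨C, hC, h⟩ := exists_tsum_wt_rpow_residue_le (p := 2 * s) (by linarith)
  refine ⟨C, hC, fun n hn a ha => ?_⟩
  have hnpos : (0 : ℝ) < n := by exact_mod_cast hn
  have ha1 := summable_norm_of_summable_sq hs ha
  rw [← sum_freqs_tsum_ite_dvd hn ha, Finset.mul_sum]
  refine Finset.sum_le_sum fun k hk => ?_
  obtain ⟨h1, h2⟩ := h n hn k hk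
  set u : ℤ → ℝ := fun l => if (n : ℤ) ∣ l - k ∧ l ≠ k then wt l ^ (-s) else 0 with hu
  set v : ℤ → ℝ := fun l => if (n : ℤ) ∣ l - k then wt l ^ s * ‖a l‖ else 0 with hv
  have hu2 : ∀ l, u l ^ 2 = if (n : ℤ) ∣ l - k ∧ l ≠ k then wt l ^ (-(2 * s)) else 0 := by
    intro l
    simp only [hu, ite_pow, wt_rpow_sq]
    norm_num
  have hv2 : ∀ l, v l ^ 2 = if (n : ℤ) ∣ l - k then (wt l ^ s * ‖a l‖) ^ 2 else 0 := by
    intro l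
    simp only [hv, ite_pow]
    norm_num
  have hu0 : ∀ l, 0 ≤ u l := fun l => by
    simp only [hu]
    split_ifs
    exacts [(wt_rpow_pos _ _).le, le_rfl]
  have hv0 : ∀ l, 0 ≤ v l := fun l => by
    simp only [hv]
    have := (wt_rpow_pos l s).le
    split_ifs
    exacts [by positivity, le_rfl]
  obtain ⟨hs1, hs2⟩ := summable_mul_and_tsum_mul_le hu0 hv0 (by simpa only [hu2] using h1)
    (by simpa only [hv2] using summable_ite ha _)
  have huv : ∀ l, u l * v l = ‖if (n : ℤ) ∣ l - k ∧ l ≠ k then a l else 0‖ := by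
    intro l
    simp only [hu, hv]
    by_cases h3 : (n : ℤ) ∣ l - k
    · by_cases h4 : l = k
      · simp [h4]
      · simp [h3, h4, wt_neg_mul_wt_mul]
    · simp [h3]
  simp only [huv, hu2, hv2] at hs1 hs2
  have hle := (norm_tsum_le_tsum_norm hs1).trans hs2
  rw [← errCoeff_of_mem ha1.of_norm hk] at hle
  refine (pow_le_pow_left₀ (norm_nonneg _) hle 2).trans ?_
  have hB : 0 ≤ ∑' l, if (n : ℤ) ∣ l - k then (wt l ^ s * ‖a l‖) ^ 2 else 0 :=
    tsum_nonneg fun l => by split_ifs <;> positivity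
  have hA : 0 ≤ ∑' l, if (n : ℤ) ∣ l - k ∧ l ≠ k then wt l ^ (-(2 * s)) else 0 :=
    tsum_nonneg fun l => by
      have := (wt_rpow_pos l (-(2 * s))).le
      split_ifs <;> simp [this]
  rw [mul_pow, Real.sq_sqrt hA, Real.sq_sqrt hB]
  gcongr

/-- Inside the band wt ≤ 2n, so the weight costs n^{2t} against the aliasing gain n^{-2s}. Outside
it the error is -a_k and wt ≥ n/2, so lowering the exponent from s to t gains n^{2(t-s)}. -/
theorem exists_tsum_sq_errCoeff_le {s t : ℝ} (hs : 1 / 2 < s) (ht : 0 ≤ t) (hts : t ≤ s) :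
    ∃ C, 0 ≤ C ∧ ∀ n : ℕ, 1 ≤ n → ∀ a : ℤ → ℂ, Summable (fun k => (wt k ^ s * ‖a k‖) ^ 2) →
      Summable (fun k => (wt k ^ t * ‖errCoeff n a k‖) ^ 2) ∧
      ∑' k, (wt k ^ t * ‖errCoeff n a k‖) ^ 2 ≤
        C * (n : ℝ) ^ (2 * (t - s)) * ∑' k, (wt k ^ s * ‖a k‖) ^ 2 := by
  obtain ⟨C, hC, h⟩ := exists_sum_freqs_sq_errCoeff_le hs
  refine ⟨2 ^ (2 * t) * C + 2 ^ (2 * (s - t)), by positivity, fun n hn a ha => ?_⟩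
  have hnpos : (0 : ℝ) < n := by exact_mod_cast hn
  set u : ℤ → ℝ := fun k => if k ∈ freqs n then (2 * n : ℝ) ^ (2 * t) * ‖errCoeff n a k‖ ^ 2 else 0
  set v : ℤ → ℝ := fun k => ((n : ℝ) / 2) ^ (2 * (t - s)) * (wt k ^ s * ‖a k‖) ^ 2
  have hu : HasSum u (∑ k ∈ freqs n, (2 * n : ℝ) ^ (2 * t) * ‖errCoeff n a k‖ ^ 2) :=
    hasSum_ite_mem _ _
  have hv : Summable v := ha.mul_left _
  have hle : ∀ k, (wt k ^ t * ‖errCoeff n a k‖) ^ 2 ≤ u k + v k := by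
    intro k
    have hv0 : 0 ≤ v k := by positivity
    by_cases hk : k ∈ freqs n
    · have : (wt k ^ t * ‖errCoeff n a k‖) ^ 2 ≤ u k := by
        simp only [u, if_pos hk, mul_pow, wt_rpow_sq]
        have h1 := wt_le_of_mem_freqs hn hk
        have h2 := wt_pos k
        gcongr
      linarith
    · have h1 : u k = 0 := if_neg hk
      rw [h1, zero_add, errCoeff_of_notMem hk, norm_neg]
      have h2 : wt k ^ (2 * (t - s)) ≤ ((n : ℝ) / 2) ^ (2 * (t - s)) :=
        Real.rpow_le_rpow_of_nonpos (by positivity) (le_wt_of_notMem_freqs hk) (by linarith)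
      calc (wt k ^ t * ‖a k‖) ^ 2 = wt k ^ (2 * (t - s)) * (wt k ^ s * ‖a k‖) ^ 2 := by
            rw [mul_pow, mul_pow, wt_rpow_sq, wt_rpow_sq, ← mul_assoc, ← Real.rpow_add (wt_pos k)]
            ring_nf
        _ ≤ v k := mul_le_mul_of_nonneg_right h2 (sq_nonneg _)
  have hsum := (hu.summable.add hv).of_nonneg_of_le (fun k => sq_nonneg _) hle
  refine ⟨hsum, (hsum.tsum_le_tsum hle (hu.summable.add hv)).trans ?_⟩
  rw [hu.summable.tsum_add hv, hu.tsum_eq, ← Finset.mul_sum, tsum_mul_left]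
  have h3 := h n hn a ha
  have e1 : (2 * n : ℝ) ^ (2 * t) * (n : ℝ) ^ (-(2 * s)) = 2 ^ (2 * t) * (n : ℝ) ^ (2 * (t - s)) := by
    rw [Real.mul_rpow zero_le_two hnpos.le, mul_assoc, ← Real.rpow_add hnpos]
    ring_nf
  have e2 : ((n : ℝ) / 2) ^ (2 * (t - s)) = 2 ^ (2 * (s - t)) * (n : ℝ) ^ (2 * (t - s)) := by
    have : 2 * (s - t) = -(2 * (t - s)) := by ring
    rw [Real.div_rpow hnpos.le zero_le_two, this, Real.rpow_neg zero_le_two]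
    ring
  rw [e2, add_mul, add_mul]
  refine add_le_add ?_ le_rfl
  calc _ ≤ (2 * n : ℝ) ^ (2 * t) * (C * (n : ℝ) ^ (-(2 * s)) * ∑' k, (wt k ^ s * ‖a k‖) ^ 2) := by
        gcongr
    _ = ((2 * n : ℝ) ^ (2 * t) * (n : ℝ) ^ (-(2 * s))) * C * ∑' k, (wt k ^ s * ‖a k‖) ^ 2 := by
        ring
    _ = _ := by rw [e1]; ring

theorem sqrt_mul_rpow {x : ℝ} (hx : 0 ≤ x) (C p : ℝ) (hC : 0 ≤ C) :
    √(C * x ^ (2 * p)) = √C * x ^ p := by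
  rw [Real.sqrt_mul hC, mul_comm 2 p, Real.rpow_mul hx]
  norm_cast
  rw [Real.sqrt_sq (Real.rpow_nonneg hx p)]

/-- The extra n^{1/2} over the ℓ² bound is the price of Cauchy–Schwarz: n terms inside the band, and
outside it the tail of wt^{2(r-s)}, which is summable since r < s - 1/2. -/
theorem exists_tsum_errCoeff_le {s r : ℝ} (hr : 0 ≤ r) (hrs : r < s - 1 / 2) :
    ∃ C, 0 ≤ C ∧ ∀ n : ℕ, 1 ≤ n → ∀ a : ℤ → ℂ, Summable (fun k => (wt k ^ s * ‖a k‖) ^ 2) →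
      Summable (fun k => wt k ^ r * ‖errCoeff n a k‖) ∧
      ∑' k, wt k ^ r * ‖errCoeff n a k‖ ≤
        C * (n : ℝ) ^ (1 / 2 + r - s) * √(∑' k, (wt k ^ s * ‖a k‖) ^ 2) := by
  have hs : 1 / 2 < s := by linarith
  obtain ⟨C, hC, h⟩ := exists_sum_freqs_sq_errCoeff_le hs
  obtain ⟨C', hC', h'⟩ := exists_tsum_wt_rpow_tail_le (p := 2 * (s - r)) (by linarith)
  refine ⟨2 ^ r * √C + √C', by positivity, fun n hn a ha => ?_⟩
  have hnpos : (0 : ℝ) < n := by exact_mod_cast hn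
  set A := ∑' k, (wt k ^ s * ‖a k‖) ^ 2
  set u : ℤ → ℝ := fun k => if k ∈ freqs n then (2 * n : ℝ) ^ r * ‖errCoeff n a k‖ else 0
  set w : ℤ → ℝ := fun k => if k ∉ freqs n then wt k ^ (r - s) else 0 with hw
  have hw2 : ∀ k, w k ^ 2 = if k ∉ freqs n then wt k ^ (-(2 * (s - r))) else 0 := by
    intro k
    have : -(2 * (s - r)) = 2 * (r - s) := by ring
    simp only [hw, ite_pow, wt_rpow_sq, this]
    norm_num
  have hw0 : ∀ k, 0 ≤ w k := fun k => by
    simp only [hw]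
    split_ifs
    exacts [le_rfl, (wt_rpow_pos _ _).le]
  have hu : HasSum u (∑ k ∈ freqs n, (2 * n : ℝ) ^ r * ‖errCoeff n a k‖) :=
    hasSum_ite_mem _ _
  obtain ⟨hv, hv'⟩ := summable_mul_and_tsum_mul_le hw0
    (fun k => mul_nonneg (wt_rpow_pos k s).le (norm_nonneg (a k)))
    (by simpa only [hw2] using summable_ite (summable_wt_rpow (by linarith)) _) ha
  have hle : ∀ k, wt k ^ r * ‖errCoeff n a k‖ ≤ u k + w k * (wt k ^ s * ‖a k‖) := by
    intro k
    have hv0 : 0 ≤ w k * (wt k ^ s * ‖a k‖) :=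
      mul_nonneg (hw0 k) (mul_nonneg (wt_rpow_pos k s).le (norm_nonneg (a k)))
    by_cases hk : k ∈ freqs n
    · have : wt k ^ r * ‖errCoeff n a k‖ ≤ u k := by
        simp only [u, if_pos hk]
        have h1 := wt_le_of_mem_freqs hn hk
        have h2 := wt_pos k
        gcongr
      linarith
    · have h1 : u k = 0 := if_neg hk
      rw [h1, zero_add, errCoeff_of_notMem hk, norm_neg, hw]
      simp only [hk, not_false_eq_true, if_true]
      rw [← mul_assoc, ← Real.rpow_add (wt_pos k), sub_add_cancel]
  have hsum := (hu.summable.add hv).of_nonneg_of_le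
    (fun k => mul_nonneg (wt_rpow_pos k r).le (norm_nonneg _)) hle
  refine ⟨hsum, (hsum.tsum_le_tsum hle (hu.summable.add hv)).trans ?_⟩
  rw [hu.summable.tsum_add hv, hu.tsum_eq, ← Finset.mul_sum, add_mul, add_mul]
  have hA : 0 ≤ A := tsum_nonneg fun k => sq_nonneg _
  refine add_le_add ?_ (hv'.trans ?_)
  · have h1 : ∑ k ∈ freqs n, ‖errCoeff n a k‖ ≤ √(n * (C * (n : ℝ) ^ (-(2 * s)) * A)) := by
      refine Real.le_sqrt_of_sq_le ?_
      refine (sq_sum_le_card_mul_sum_sq (s := freqs n)).trans ?_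
      rw [card_freqs hn]
      have := h n hn a ha
      gcongr
    have h2 : √(n * (C * (n : ℝ) ^ (-(2 * s)) * A)) = √C * (n : ℝ) ^ (1 / 2 - s) * √A := by
      rw [← sqrt_mul_rpow hnpos.le _ _ hC, ← Real.sqrt_mul (by positivity)]
      congr 1
      have : 2 * (1 / 2 - s) = 1 + -(2 * s) := by ring
      rw [this, Real.rpow_add hnpos, Real.rpow_one]
      ring
    calc _ ≤ (2 * n : ℝ) ^ r * (√C * (n : ℝ) ^ (1 / 2 - s) * √A) := by
          rw [← h2]; gcongr
      _ = _ := by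
        rw [Real.mul_rpow zero_le_two hnpos.le, add_sub_right_comm, Real.rpow_add hnpos]
        ring
  · simp only [hw2]
    gcongr
    rw [← sqrt_mul_rpow hnpos.le _ _ hC']
    have : 2 * (1 / 2 + r - s) = 1 - 2 * (s - r) := by ring
    rw [this]
    exact Real.sqrt_le_sqrt (h' n hn)

end ErrCoeff

/-! ### The discrete Fourier coefficients -/

theorem fourier_node (n ℓ : ℕ) (m : ℤ) :
    fourier m (node n ℓ) = (Complex.exp (2 * Real.pi * Complex.I / n) ^ m) ^ ℓ := by
  rw [node, fourier_coe_apply, ← Complex.exp_int_mul, ← Complex.exp_nat_mul]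
  congr 1
  have : (Real.pi : ℂ) ≠ 0 := by exact_mod_cast Real.pi_ne_zero
  push_cast
  field_simp

theorem sum_fourier_node {n : ℕ} (hn : 1 ≤ n) (m : ℤ) :
    ∑ ℓ ∈ Finset.range n, fourier m (node n ℓ) = if (n : ℤ) ∣ m then (n : ℂ) else 0 := by
  have hζ := Complex.isPrimitiveRoot_exp n (by omega)
  simp only [fourier_node]
  split_ifs with h
  · rw [(hζ.zpow_eq_one_iff_dvd m).mpr h]
    simp
  · have h1 : Complex.exp (2 * Real.pi * Complex.I / n) ^ m ≠ 1 :=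
      fun h1 => h ((hζ.zpow_eq_one_iff_dvd m).mp h1)
    rw [geom_sum_eq h1, ← zpow_natCast, zpow_comm, zpow_natCast, hζ.pow_eq_one]
    simp

/-- Aliasing: the nodes are n-th roots of unity, whose discrete orthogonality keeps only the
frequencies congruent to k. The pointwise expansion is needed at every node, θ = 0 included. -/
theorem discreteFourierCoeff_eq_tsum {n : ℕ} (hn : 1 ≤ n) {F : Torus → ℂ} {a : ℤ → ℂ}
    (hF : ∀ θ, HasSum (fun k => a k * fourier k θ) (F θ)) (k : ℤ) :
    discreteFourierCoeff n F k = ∑' l, if (n : ℤ) ∣ l - k then a l else 0 := by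
  have hn0 : (n : ℂ) ≠ 0 := by
    have : n ≠ 0 := by omega
    exact_mod_cast this
  have h : HasSum (fun l => (1 / (n : ℂ)) * ∑ ℓ ∈ Finset.range n,
      fourier (-k) (node n ℓ) * (a l * fourier l (node n ℓ))) (discreteFourierCoeff n F k) :=
    (hasSum_sum fun ℓ _ => (hF (node n ℓ)).mul_left _).mul_left _
  rw [← h.tsum_eq]
  refine tsum_congr fun l => ?_
  have e : ∀ ℓ, fourier (-k) (node n ℓ) * (a l * fourier l (node n ℓ)) =
      a l * fourier (l - k) (node n ℓ) := by
    intro ℓ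
    rw [sub_eq_add_neg, fourier_add]
    ring
  simp only [e, ← Finset.mul_sum, sum_fourier_node hn]
  split_ifs
  · field_simp
  · simp

/-! ### The angle of a point of the line -/

/-- The real number `T⁻¹(x) ∈ (0, 2π)`. -/
def angle (β x : ℝ) : ℝ := Real.pi + 2 * Real.arctan (x / β)

section Angle

variable {β : ℝ}

/-- With α = arctan(x/β), the exponential is -(cos α + i sin α)², and sin α = (x/β) cos α together
with cos² α (1 + (x/β)²) = 1 reduces the claim to algebra. -/
theorem exp_angle (hβ : 0 < β) (x : ℝ) : Complex.exp (Complex.I * angle β x) = mobius β x := by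
  set y := x / β with hy
  have hx : x = y * β := by rw [hy]; field_simp
  have hc0 : (Real.cos (Real.arctan y) : ℂ) ≠ 0 := by
    exact_mod_cast (Real.cos_arctan_pos y).ne'
  have hs : (Real.sin (Real.arctan y) : ℂ) = y * Real.cos (Real.arctan y) := by
    rw [← Complex.ofReal_mul, Complex.ofReal_inj]
    nth_rw 2 [← Real.tan_arctan y]
    rw [Real.tan_mul_cos (Real.cos_arctan_pos y).ne']
  have hc : (Real.cos (Real.arctan y) : ℂ) ^ 2 * (1 + (y : ℂ) ^ 2) = 1 := by
    have h := Real.cos_sq_arctan y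
    have h' : (1 : ℝ) + y ^ 2 ≠ 0 := by positivity
    rw [eq_div_iff h'] at h
    exact_mod_cast h
  have he : Complex.exp (Complex.I * angle β x) =
      -((Real.cos (Real.arctan y) : ℂ) + Real.sin (Real.arctan y) * Complex.I) ^ 2 := by
    have : Complex.I * (angle β x : ℂ) = Real.pi * Complex.I +
        ((2 : ℕ) : ℂ) * (Real.arctan y * Complex.I) := by
      rw [angle, ← hy]
      push_cast
      ring
    rw [this, Complex.exp_add, Complex.exp_pi_mul_I, Complex.exp_nat_mul, Complex.exp_mul_I,
      ← Complex.ofReal_cos, ← Complex.ofReal_sin]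
    ring
  rw [he, hs, mobius, eq_div_iff (real_add_I_mul_ne_zero hβ x), hx]
  generalize (Real.cos (Real.arctan y) : ℂ) = c at *
  push_cast
  have hI := Complex.I_sq
  have hI3 : Complex.I ^ 3 = -Complex.I := by rw [pow_succ, hI]; ring
  linear_combination (β * (y - Complex.I) : ℂ) * hc +
    (-(c ^ 2 * β * y * (2 + y ^ 2)) : ℂ) * hI - (c ^ 2 * β * y ^ 2) * hI3

theorem hasDerivAt_angle (hβ : 0 < β) (x : ℝ) : HasDerivAt (angle β) (angleDeriv β x) x := by
  have := ((((hasDerivAt_id x).div_const β).arctan).const_mul 2).const_add Real.pi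
  refine this.congr_deriv ?_
  simp only [id, angleDeriv]
  field_simp
  ring

theorem continuous_angle (hβ : 0 < β) : Continuous (angle β) :=
  continuous_iff_continuousAt.mpr fun x => (hasDerivAt_angle hβ x).continuousAt

theorem injective_angle (hβ : 0 < β) : Function.Injective (angle β) := by
  intro x y h
  have h1 : Real.arctan (x / β) = Real.arctan (y / β) := by
    unfold angle at h
    linarith
  have h2 := Real.arctan_injective h1
  field_simp at h2
  exact h2

theorem range_angle (hβ : 0 < β) : Set.range (angle β) = Set.Ioo 0 (2 * Real.pi) := by
  ext θ
  constructor
  · rintro ⟨x, rfl⟩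
    have h1 := Real.neg_pi_div_two_lt_arctan (x / β)
    have h2 := Real.arctan_lt_pi_div_two (x / β)
    constructor <;> unfold angle <;> linarith
  · rintro ⟨h1, h2⟩
    refine ⟨Real.tan ((θ - Real.pi) / 2) * β, ?_⟩
    rw [angle, mul_div_cancel_right₀ _ hβ.ne', Real.arctan_tan] <;> linarith

theorem toCircle_angle (hβ : 0 < β) (x : ℝ) :
    ((AddCircle.toCircle (angle β x : Torus) : Circle) : ℂ) = mobius β x := by
  rw [toCircle_torus_coe, exp_angle hβ]

theorem fourier_angle (hβ : 0 < β) (k : ℤ) (x : ℝ) :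
    fourier k (angle β x : Torus) = mobius β x ^ k := by
  rw [fourier_apply, AddCircle.toCircle_zsmul, Circle.coe_zpow, toCircle_angle hβ]

theorem mobius_ne_one (hβ : 0 < β) (x : ℝ) : mobius β x ≠ 1 := by
  intro h
  have := ofReal_angleDeriv hβ x
  rw [h] at this
  norm_num at this
  exact (angleDeriv_pos hβ x).ne' this

theorem coe_angle_ne_zero (hβ : 0 < β) (x : ℝ) : (angle β x : Torus) ≠ 0 := by
  intro h
  have h1 := toCircle_angle hβ x
  rw [h, AddCircle.toCircle_zero] at h1
  exact mobius_ne_one hβ x h1.symm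

theorem mobius_lineParam (hβ : 0 < β) {θ : Torus} (hθ : θ ≠ 0) :
    mobius β (lineParam β θ) = (AddCircle.toCircle θ : Circle) := by
  rw [ofReal_lineParam]
  have hz : ((AddCircle.toCircle θ : Circle) : ℂ) ≠ 1 := by
    intro h
    have h1 : AddCircle.toCircle θ = AddCircle.toCircle (0 : Torus) := by
      rw [AddCircle.toCircle_zero]
      exact Circle.coe_eq_one.mp h
    exact hθ (AddCircle.injective_toCircle Real.two_pi_pos.ne' h1)
  generalize ((AddCircle.toCircle θ : Circle) : ℂ) = z at *
  have h1 : z - 1 ≠ 0 := sub_ne_zero.mpr hz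
  have hb : (β : ℂ) ≠ 0 := by exact_mod_cast hβ.ne'
  have e1 : mobiusInv β z - Complex.I * β = Complex.I * β * (-2 * z / (z - 1)) := by
    rw [mobiusInv, Complex.div_I]
    field_simp
    ring
  have e2 : mobiusInv β z + Complex.I * β = Complex.I * β * (-2 / (z - 1)) := by
    rw [mobiusInv, Complex.div_I]
    field_simp
    ring
  rw [mobius, e1, e2, mul_div_mul_left _ _ (mul_ne_zero Complex.I_ne_zero hb),
    div_div_div_cancel_right₀ h1]
  field_simp

theorem injective_mobius (hβ : 0 < β) : Function.Injective fun x : ℝ => mobius β x := by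
  intro x y h
  simp only [mobius] at h
  rw [div_eq_div_iff (real_add_I_mul_ne_zero hβ x) (real_add_I_mul_ne_zero hβ y)] at h
  have hb : (β : ℂ) ≠ 0 := by exact_mod_cast hβ.ne'
  have h2 : (2 * Complex.I * β : ℂ) * (x - y) = 0 := by linear_combination h
  have h3 := (mul_eq_zero.mp h2).resolve_left (by simp [hb])
  exact_mod_cast sub_eq_zero.mp h3

theorem lineParam_angle (hβ : 0 < β) (x : ℝ) : lineParam β (angle β x : Torus) = x :=
  injective_mobius hβ <| by
    beta_reduce
    rw [mobius_lineParam hβ (coe_angle_ne_zero hβ x), toCircle_angle hβ]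

theorem toTorus_angle (hβ : 0 < β) (f : ℝ → ℂ) (x : ℝ) :
    toTorus β f (angle β x : Torus) = f x := by
  rw [toTorus, if_neg (coe_angle_ne_zero hβ x), lineParam_angle hβ]

/-- Change of variables: the angle is injective with image (0, 2π), which misses a single point of
the circle. -/
theorem lintegral_angle (hβ : 0 < β) (h : Torus → ENNReal) :
    ∫⁻ x : ℝ, ENNReal.ofReal (angleDeriv β x) * h (angle β x : Torus) = ∫⁻ θ, h θ := by
  rw [← AddCircle.lintegral_preimage (2 * Real.pi) 0, zero_add,
    ← restrict_Ioo_eq_restrict_Ioc, ← range_angle hβ, ← Set.image_univ,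
    lintegral_image_eq_lintegral_abs_deriv_mul MeasurableSet.univ
      (fun x _ => (hasDerivAt_angle hβ x).hasDerivWithinAt) (injective_angle hβ).injOn,
    Measure.restrict_univ]
  simp only [abs_of_pos (angleDeriv_pos hβ _)]

theorem ae_angle (hβ : 0 < β) {p : Torus → Prop} (hp : ∀ᵐ θ, p θ) :
    ∀ᵐ x : ℝ, p (angle β x : Torus) := by
  have hcont : Continuous fun x : ℝ => (angle β x : Torus) :=
    (AddCircle.continuous_mk' _).comp (continuous_angle hβ)
  -- The exceptional set need not be measurable, so it is enlarged to a measurable null set.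
  -- Positivity of the Jacobian then makes its preimage null.
  set N := toMeasurable (volume : Measure Torus) {θ | ¬ p θ} with hN
  have hN0 : (volume : Measure Torus) N = 0 := by rw [hN, measure_toMeasurable]; exact hp
  have hNm : MeasurableSet N := measurableSet_toMeasurable _ _
  have h := lintegral_angle hβ (N.indicator 1)
  rw [lintegral_indicator_one hNm, hN0, lintegral_eq_zero_iff] at h
  · filter_upwards [h] with x hx
    by_contra hcon
    have hmem : (angle β x : Torus) ∈ N := subset_toMeasurable _ _ hcon
    simp [Set.indicator_of_mem hmem, not_le.mpr (angleDeriv_pos hβ x)] at hx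
  · refine ((continuous_angleDeriv hβ).measurable.ennreal_ofReal).mul ?_
    exact (measurable_one.indicator hNm).comp hcont.measurable

end Angle

/-! ### Absolutely convergent Fourier series -/

section FourierSeries

variable {a : ℤ → ℂ}

/-- The sum of a Fourier series. -/
def fourierSum (a : ℤ → ℂ) : C(Torus, ℂ) := ∑' k, a k • fourier k

theorem hasSum_fourierSum (ha : Summable fun k => ‖a k‖) :
    HasSum (fun k => a k • fourier k) (fourierSum a) := by
  refine Summable.hasSum (Summable.of_norm ?_)
  simpa only [norm_smul, fourier_norm, mul_one] using ha

theorem hasSum_fourierSum_apply (ha : Summable fun k => ‖a k‖) (θ : Torus) :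
    HasSum (fun k => a k * fourier k θ) (fourierSum a θ) := by
  simpa using (ContinuousMap.evalCLM ℂ θ).hasSum (hasSum_fourierSum ha)

/-- The series converges uniformly, hence in L², and pairing with the k-th exponential is continuous
there, so orthonormality picks out one term. -/
theorem fourierCoeff_fourierSum (ha : Summable fun k => ‖a k‖) (k : ℤ) :
    fourierCoeff (fourierSum a) k = a k := by
  have h := (ContinuousMap.toLp (E := ℂ) 2 (AddCircle.haarAddCircle (T := 2 * Real.pi))
    ℂ).hasSum (hasSum_fourierSum ha)
  have h2 := (innerSL ℂ (fourierLp (T := 2 * Real.pi) 2 k)).hasSum h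
  have h3 : innerSL ℂ (fourierLp (T := 2 * Real.pi) 2 k)
      (ContinuousMap.toLp (E := ℂ) 2 AddCircle.haarAddCircle ℂ (fourierSum a)) =
      fourierCoeff (fourierSum a) k := by
    rw [← fourierCoeff_toLp, ← fourierBasis_repr, HilbertBasis.repr_apply_apply, coe_fourierBasis]
    rfl
  have horth := orthonormal_iff_ite.mp (orthonormal_fourier (T := 2 * Real.pi))
  have e : ∀ l, innerSL ℂ (fourierLp (T := 2 * Real.pi) 2 k)
      (ContinuousMap.toLp (E := ℂ) 2 AddCircle.haarAddCircle ℂ (a l • fourier l)) =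
      if l = k then a k else 0 := by
    intro l
    have h4 : inner ℂ (fourierLp (T := 2 * Real.pi) 2 k) (fourierLp 2 l) = if k = l then 1 else 0 :=
      horth k l
    rw [map_smul, map_smul, innerSL_apply_apply]
    refine (congrArg (a l • ·) h4).trans ?_
    by_cases hkl : l = k
    · simp [hkl]
    · simp [hkl, Ne.symm hkl]
  have h5 := h2.tsum_eq
  rw [tsum_congr e, tsum_ite_eq, h3] at h5
  exact h5.symm

theorem summable_sq_of_summable_norm {u : ℤ → ℝ} (h0 : ∀ k, 0 ≤ u k) (h : Summable u) :
    Summable fun k => u k ^ 2 := by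
  refine Summable.of_norm_bounded_eventually h ?_
  have := h.tendsto_cofinite_zero.eventually (eventually_le_nhds (zero_lt_one' ℝ))
  filter_upwards [this] with k hk
  rw [Real.norm_of_nonneg (sq_nonneg _)]
  nlinarith [h0 k]

theorem lintegral_sq_fourierSum (ha : Summable fun k => ‖a k‖) :
    ∫⁻ θ, ‖fourierSum a θ‖ₑ ^ 2 ∂AddCircle.haarAddCircle = ENNReal.ofReal (∑' k, ‖a k‖ ^ 2) := by
  have h := tsum_sq_fourierCoeff (ContinuousMap.toLp (E := ℂ) 2
    (AddCircle.haarAddCircle (T := 2 * Real.pi)) ℂ (fourierSum a))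
  simp only [fourierCoeff_toLp, fourierCoeff_fourierSum ha] at h
  have h2 : ∫ t, ‖(ContinuousMap.toLp (E := ℂ) 2 (AddCircle.haarAddCircle (T := 2 * Real.pi)) ℂ
      (fourierSum a)) t‖ ^ 2 ∂AddCircle.haarAddCircle =
      ∫ t, ‖fourierSum a t‖ ^ 2 ∂AddCircle.haarAddCircle := by
    refine integral_congr_ae ?_
    filter_upwards [ContinuousMap.coeFn_toLp (p := 2) (𝕜 := ℂ)
      (AddCircle.haarAddCircle (T := 2 * Real.pi)) (fourierSum a)] with t ht
    rw [ht]
  rw [h, h2, ofReal_integral_eq_lintegral_ofReal]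
  · refine lintegral_congr fun θ => ?_
    rw [ENNReal.ofReal_pow (norm_nonneg _), ofReal_norm]
  · refine Continuous.integrable_of_hasCompactSupport (by fun_prop) ?_
    exact HasCompactSupport.of_compactSpace _
  · exact Eventually.of_forall fun θ => sq_nonneg _

theorem mobiusSeries_eq_fourierSum {β : ℝ} (hβ : 0 < β) (ha : Summable fun k => ‖a k‖) (x : ℝ) :
    mobiusSeries β a x = fourierSum a (angle β x : Torus) := by
  rw [← (hasSum_fourierSum_apply ha _).tsum_eq]
  simp only [fourier_angle hβ, mobiusSeries]

theorem lintegral_torus (h : Torus → ENNReal) :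
    ∫⁻ θ, h θ = ENNReal.ofReal (2 * Real.pi) * ∫⁻ θ, h θ ∂AddCircle.haarAddCircle := by
  rw [AddCircle.volume_eq_smul_haarAddCircle, lintegral_smul_measure, smul_eq_mul]

theorem lintegral_angleDeriv_mul_sq_mobiusSeries {β : ℝ} (hβ : 0 < β)
    (ha : Summable fun k => ‖a k‖) :
    ∫⁻ x, ENNReal.ofReal (angleDeriv β x) * ‖mobiusSeries β a x‖ₑ ^ 2 =
      ENNReal.ofReal (2 * Real.pi * ∑' k, ‖a k‖ ^ 2) := by
  simp only [mobiusSeries_eq_fourierSum hβ ha]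
  rw [lintegral_angle hβ fun θ => ‖fourierSum a θ‖ₑ ^ 2, lintegral_torus,
    lintegral_sq_fourierSum ha, ENNReal.ofReal_mul Real.two_pi_pos.le]

theorem lintegral_angleDeriv_mul_mobiusSeries_le {β : ℝ} (hβ : 0 < β)
    (ha : Summable fun k => ‖a k‖) :
    ∫⁻ x, ENNReal.ofReal (angleDeriv β x) * ‖mobiusSeries β a x‖ₑ ≤
      ENNReal.ofReal (2 * Real.pi * √(∑' k, ‖a k‖ ^ 2)) := by
  simp only [mobiusSeries_eq_fourierSum hβ ha]
  rw [lintegral_angle hβ fun θ => ‖fourierSum a θ‖ₑ, lintegral_torus,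
    ENNReal.ofReal_mul Real.two_pi_pos.le]
  gcongr
  have h := eLpNorm_le_eLpNorm_of_exponent_le (p := 1) (q := 2) one_le_two
    (μ := AddCircle.haarAddCircle (T := 2 * Real.pi))
    (fourierSum a).continuous.aestronglyMeasurable
  rw [eLpNorm_one_eq_lintegral_enorm] at h
  refine h.trans_eq ?_
  rw [eLpNorm_eq_lintegral_rpow_enorm_toReal two_ne_zero ENNReal.ofNat_ne_top]
  have h2 := lintegral_sq_fourierSum ha
  simp only [ENNReal.toReal_ofNat, ENNReal.rpow_ofNat]
  rw [h2, Real.sqrt_eq_rpow, ENNReal.ofReal_rpow_of_nonneg (tsum_nonneg fun k => sq_nonneg _)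
    (by norm_num)]

end FourierSeries

/-! ### Identification of the interpolation error -/

section Identification

variable {β s : ℝ} {f : ℝ → ℂ}

theorem summable_sq_of_memSobolevTorus (h : MemSobolevTorus s (toTorus β f)) :
    Summable fun k => (wt k ^ s * ‖fourierCoeff (toTorus β f) k‖) ^ 2 := by
  simp only [mul_pow, wt_rpow_sq]
  exact h.2

theorem normSobolevTorus_eq (F : Torus → ℂ) :
    normSobolevTorus s F = √(∑' k, (wt k ^ s * ‖fourierCoeff F k‖) ^ 2) := by
  simp only [normSobolevTorus, mul_pow, wt_rpow_sq]
  rfl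

/-- F and its Fourier series have the same coefficients, so they agree almost everywhere on the
circle. This transfers to the line, where continuity of both sides upgrades it to every point. -/
theorem eq_mobiusSeries (hβ : 0 < β) (hs : 1 / 2 < s) (hf : Continuous f)
    (h : MemSobolevTorus s (toTorus β f)) :
    f = mobiusSeries β (fourierCoeff (toTorus β f)) := by
  have ha := summable_norm_of_summable_sq hs (summable_sq_of_memSobolevTorus h)
  set a := fourierCoeff (toTorus β f) with ha_def
  have hmem : MemLp (toTorus β f) 2 (AddCircle.haarAddCircle (T := 2 * Real.pi)) :=
    memLp_haarAddCircle_iff.mpr h.1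
  have hLp : hmem.toLp = ContinuousMap.toLp (E := ℂ) 2 AddCircle.haarAddCircle ℂ (fourierSum a) := by
    refine fourierBasis.repr.injective (lp.ext (funext fun k => ?_))
    rw [fourierBasis_repr, fourierBasis_repr, fourierCoeff_toLp, fourierCoeff_fourierSum ha,
      fourierCoeff_congr_ae hmem.coeFn_toLp]
  have hae : toTorus β f =ᵐ[AddCircle.haarAddCircle] fourierSum a := by
    have h1 := hmem.coeFn_toLp
    rw [hLp] at h1
    exact h1.symm.trans (ContinuousMap.coeFn_toLp _ _)
  have hae' : ∀ᵐ θ, toTorus β f θ = fourierSum a θ := by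
    rw [AddCircle.volume_eq_smul_haarAddCircle]
    exact Measure.ae_smul_measure hae _
  have hline : f =ᵐ[volume] mobiusSeries β a := by
    filter_upwards [ae_angle hβ hae'] with x hx
    rwa [toTorus_angle hβ, ← mobiusSeries_eq_fourierSum hβ ha] at hx
  exact (hf.ae_eq_iff_eq volume (continuous_mobiusSeries hβ ha)).mp hline

theorem hasSum_toTorus (hβ : 0 < β) (hs : 1 / 2 < s) (hf : Continuous f)
    (h : MemSobolevTorus s (toTorus β f)) (θ : Torus) :
    HasSum (fun k => fourierCoeff (toTorus β f) k * fourier k θ) (toTorus β f θ) := by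
  have ha := summable_norm_of_summable_sq hs (summable_sq_of_memSobolevTorus h)
  have hfeq := eq_mobiusSeries hβ hs hf h
  generalize fourierCoeff (toTorus β f) = a at *
  by_cases hθ : θ = 0
  · subst hθ
    -- The existence of the limit of f at infinity is not assumed; it follows from absolute
    -- convergence.
    have hlim : limUnder (cocompact ℝ) f = ∑' k, a k := by
      refine Tendsto.limUnder_eq ?_
      rw [hfeq]
      exact tendsto_mobiusSeries hβ ha
    rw [toTorus, if_pos rfl, hlim]
    simpa using ha.of_norm.hasSum
  · rw [toTorus, if_neg hθ, hfeq]
    have e : ∀ k, fourier k θ = mobius β (lineParam β θ) ^ k := by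
      intro k
      rw [fourier_apply, AddCircle.toCircle_zsmul, Circle.coe_zpow, mobius_lineParam hβ hθ]
    simp only [e]
    exact hasSum_mobiusSeries hβ ha _

theorem ratInterp_sub_eq (hβ : 0 < β) (hs : 1 / 2 < s) (hf : Continuous f)
    (h : MemSobolevTorus s (toTorus β f)) {n : ℕ} (hn : 1 ≤ n) :
    (fun x => ratInterp β n f x - f x) =
      mobiusSeries β (errCoeff n (fourierCoeff (toTorus β f))) := by
  have ha := summable_norm_of_summable_sq hs (summable_sq_of_memSobolevTorus h)
  have hfeq := eq_mobiusSeries hβ hs hf h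
  have hF := discreteFourierCoeff_eq_tsum hn (hasSum_toTorus hβ hs hf h)
  funext x
  have h1 : f x = mobiusSeries β (fourierCoeff (toTorus β f)) x := congrFun hfeq x
  rw [h1]
  simp only [ratInterp, hF]
  have h2 := (hasSum_ite_mem (freqs n) fun k =>
    (∑' l, if (n : ℤ) ∣ l - k then fourierCoeff (toTorus β f) l else 0) * mobius β x ^ k).sub
    (hasSum_mobiusSeries hβ ha x)
  refine h2.tsum_eq.symm.trans (tsum_congr fun k => ?_)
  rw [errCoeff]
  split_ifs <;> ring

end Identification

/-! ### Derivatives of the error in `L¹` and `L²` -/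

/-- The Jacobian of the last derivative is kept outside the series, to serve as the density that
carries integrals over to the circle. Only the first j - 1 derivatives are absorbed into the
coefficients. -/
theorem exists_iteratedDeriv_mobiusSeries {β : ℝ} (hβ : 0 < β) {j : ℕ} (hj : 0 < j) :
    ∃ K, 0 ≤ K ∧ ∀ c : ℤ → ℂ, Summable (fun k => wt k ^ (j : ℝ) * ‖c k‖) →
      ∃ d : ℤ → ℂ, Summable (fun k => ‖d k‖) ∧
        (∀ x, iteratedDeriv j (mobiusSeries β c) x = angleDeriv β x * mobiusSeries β d x) ∧
        ∑' k, ‖d k‖ ^ 2 ≤ K * ∑' k, (wt k ^ (j : ℝ) * ‖c k‖) ^ 2 := by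
  obtain ⟨i, rfl⟩ : ∃ i, j = i + 1 := ⟨j - 1, by omega⟩
  obtain ⟨K, hK, h⟩ := exists_tsum_sq_iterate_lineDerivCoeff_le hβ zero_le_one i
  refine ⟨K, hK, fun c hc => ?_⟩
  have e : ((i + 1 : ℕ) : ℝ) = 1 + i := by push_cast; ring
  have h1 : Summable fun k => wt k ^ (1 : ℝ) * ‖(lineDerivCoeff β)^[i] c k‖ :=
    summable_iterate_lineDerivCoeff hβ zero_le_one (by rwa [e] at hc)
  refine ⟨derivCoeff ((lineDerivCoeff β)^[i] c), summable_norm_derivCoeff h1, fun x => ?_, ?_⟩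
  · rw [iteratedDeriv_mobiusSeries hβ hc, Function.iterate_succ_apply',
      mobiusSeries_lineDerivCoeff hβ h1]
  · rw [e] at hc ⊢
    obtain ⟨h2, h3⟩ := h c (summable_sq_of_summable_norm
      (fun k => mul_nonneg (wt_rpow_pos k _).le (norm_nonneg _)) hc)
    refine le_trans ?_ h3
    have h4 : ∀ k, ‖derivCoeff ((lineDerivCoeff β)^[i] c) k‖ ^ 2 ≤
        (wt k ^ (1 : ℝ) * ‖(lineDerivCoeff β)^[i] c k‖) ^ 2 := fun k =>
      pow_le_pow_left₀ (norm_nonneg _)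
        (by simpa using wt_mul_norm_derivCoeff_le ((lineDerivCoeff β)^[i] c) 0 k) 2
    exact (h2.of_nonneg_of_le (fun k => sq_nonneg _) h4).tsum_le_tsum h4 h2

theorem exists_lintegral_iteratedDeriv_mobiusSeries_le {β : ℝ} (hβ : 0 < β) {j : ℕ} (hj : 0 < j) :
    ∃ K, 0 ≤ K ∧ ∀ c : ℤ → ℂ, Summable (fun k => wt k ^ (j : ℝ) * ‖c k‖) →
      ∫⁻ x, ‖iteratedDeriv j (mobiusSeries β c) x‖ₑ ≤
        ENNReal.ofReal (K * √(∑' k, (wt k ^ (j : ℝ) * ‖c k‖) ^ 2)) := by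
  obtain ⟨K, hK, h⟩ := exists_iteratedDeriv_mobiusSeries hβ hj
  refine ⟨2 * Real.pi * √K, by positivity, fun c hc => ?_⟩
  obtain ⟨d, hd, h1, h2⟩ := h c hc
  simp only [h1, enorm_mul]
  have h3 : ∀ x, ‖(angleDeriv β x : ℂ)‖ₑ = ENNReal.ofReal (angleDeriv β x) := fun x => by
    rw [← ofReal_norm, Complex.norm_real, Real.norm_of_nonneg (angleDeriv_pos hβ x).le]
  simp only [h3]
  refine (lintegral_angleDeriv_mul_mobiusSeries_le hβ hd).trans (ENNReal.ofReal_le_ofReal ?_)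
  rw [mul_assoc _ (√K), ← Real.sqrt_mul hK]
  gcongr

theorem exists_lintegral_sq_iteratedDeriv_mobiusSeries_le {β : ℝ} (hβ : 0 < β) {j : ℕ}
    (hj : 0 < j) :
    ∃ K, 0 ≤ K ∧ ∀ c : ℤ → ℂ, Summable (fun k => wt k ^ (j : ℝ) * ‖c k‖) →
      ∫⁻ x, ‖iteratedDeriv j (mobiusSeries β c) x‖ₑ ^ 2 ≤
        ENNReal.ofReal (K * ∑' k, (wt k ^ (j : ℝ) * ‖c k‖) ^ 2) := by
  obtain ⟨K, hK, h⟩ := exists_iteratedDeriv_mobiusSeries hβ hj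
  refine ⟨2 / β * (2 * Real.pi * K), by positivity, fun c hc => ?_⟩
  obtain ⟨d, hd, h1, h2⟩ := h c hc
  simp only [h1, enorm_mul]
  -- The square produces the Jacobian twice: one factor is bounded by 2/β, the other is spent on the
  -- change of variables.
  have h3 : ∀ x, (‖(angleDeriv β x : ℂ)‖ₑ * ‖mobiusSeries β d x‖ₑ) ^ 2 ≤
      ENNReal.ofReal (2 / β) * (ENNReal.ofReal (angleDeriv β x) * ‖mobiusSeries β d x‖ₑ ^ 2) := by
    intro x
    rw [← ofReal_norm, Complex.norm_real, Real.norm_of_nonneg (angleDeriv_pos hβ x).le, mul_pow,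
      sq (ENNReal.ofReal _), mul_assoc]
    gcongr
    exact angleDeriv_le hβ x
  refine (lintegral_mono h3).trans ?_
  rw [lintegral_const_mul' _ _ ENNReal.ofReal_ne_top,
    lintegral_angleDeriv_mul_sq_mobiusSeries hβ hd, ← ENNReal.ofReal_mul (by positivity)]
  refine ENNReal.ofReal_le_ofReal ?_
  rw [mul_assoc (2 / β), mul_assoc (2 * Real.pi) K]
  gcongr

/-! ### Convergence in `C_0^r` -/

theorem exists_memC0_mobiusSeries {β : ℝ} (hβ : 0 < β) (r : ℕ) :
    ∃ K, 0 ≤ K ∧ ∀ c : ℤ → ℂ, Summable (fun k => wt k ^ (r : ℝ) * ‖c k‖) → ∑' k, c k = 0 →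
      MemC0 r (mobiusSeries β c) ∧
        normC0 r (mobiusSeries β c) ≤ K * ∑' k, wt k ^ (r : ℝ) * ‖c k‖ := by
  choose K hK h using fun j : ℕ => exists_tsum_iterate_lineDerivCoeff_le hβ le_rfl j
  refine ⟨∑ j ∈ Finset.range (r + 1), K j, Finset.sum_nonneg fun j _ => hK j, fun c hc h0 => ?_⟩
  have hcj : ∀ j ≤ r, Summable fun k => wt k ^ (j : ℝ) * ‖c k‖ := fun j hj =>
    summable_of_wt_rpow (by exact_mod_cast hj) hc
  refine ⟨⟨contDiff_mobiusSeries hβ hc,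
    fun j hj => tendsto_iteratedDeriv_mobiusSeries hβ h0 (hcj j hj)⟩, ?_⟩
  rw [normC0, Finset.sum_mul]
  refine Finset.sum_le_sum fun j hj => ciSup_le fun x => ?_
  have hj' : j ≤ r := Nat.lt_succ_iff.mp (Finset.mem_range.mp hj)
  obtain ⟨h1, h2⟩ := h j c (by simpa using hcj j hj')
  rw [iteratedDeriv_mobiusSeries hβ (hcj j hj')]
  simp only [Real.rpow_zero, one_mul, zero_add] at h1 h2
  refine (norm_mobiusSeries_le hβ h1 x).trans (h2.trans ?_)
  refine mul_le_mul_of_nonneg_left ((hcj j hj').tsum_le_tsum (fun k => ?_) hc) (hK j)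
  exact mul_le_mul_of_nonneg_right
    (Real.rpow_le_rpow_of_exponent_le (one_le_wt k) (by exact_mod_cast hj')) (norm_nonneg _)

/-! ### The principal value -/

theorem norm_zpow_sub_one_le {z : ℂ} (hz : ‖z‖ = 1) (k : ℤ) : ‖z ^ k - 1‖ ≤ |(k : ℝ)| * ‖z - 1‖ := by
  have hpow : ∀ m : ℕ, ‖z ^ m - 1‖ ≤ m * ‖z - 1‖ := by
    intro m
    induction m with
    | zero => simp
    | succ m ih =>
      have e : z ^ (m + 1) - 1 = z ^ m * (z - 1) + (z ^ m - 1) := by ring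
      rw [e]
      refine (norm_add_le _ _).trans ?_
      rw [norm_mul, norm_pow, hz, one_pow, one_mul]
      push_cast
      linarith
  obtain ⟨m, rfl | rfl⟩ := k.eq_nat_or_neg
  · simpa using hpow m
  · have hz0 : z ≠ 0 := by
      rintro rfl
      simp at hz
    have e : z ^ (-(m : ℤ)) - 1 = -(z ^ m)⁻¹ * (z ^ m - 1) := by
      rw [zpow_neg, zpow_natCast]
      field_simp
      ring
    rw [e, norm_mul, norm_neg, norm_inv, norm_pow, hz]
    simpa using hpow m

/-- The norm is at most 2, and also at most 2β wt(k)/|x|, because M - 1 decays like 2β/|x| and the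
k-th power costs a factor |k|. Squaring both bounds and adding them gives the 8. -/
theorem norm_sq_mobius_zpow_sub_one_le {β : ℝ} (hβ : 0 < β) (k : ℤ) (x : ℝ) :
    ‖mobius β x ^ k - 1‖ ^ 2 ≤ 8 * (1 + (x / (β * wt k)) ^ 2)⁻¹ := by
  have hw := wt_pos k
  have h1 : ‖mobius β x ^ k - 1‖ ≤ 2 := by
    refine (norm_sub_le _ _).trans ?_
    rw [norm_mobius_zpow hβ, norm_one]
    norm_num
  have h2 : |x| * ‖mobius β x - 1‖ ≤ 2 * β := by
    have hne := real_add_I_mul_ne_zero hβ x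
    have e : mobius β x - 1 = -(2 * Complex.I * β) / (x + Complex.I * β) := by
      rw [mobius]
      field_simp
      ring
    have h3 : |x| ≤ ‖(x : ℂ) + Complex.I * β‖ := by
      have := Complex.abs_re_le_norm ((x : ℂ) + Complex.I * β)
      simpa using this
    rw [e, norm_div, norm_neg, mul_div_assoc', div_le_iff₀ (norm_pos_iff.mpr hne)]
    have h4 : ‖2 * Complex.I * (β : ℂ)‖ = 2 * β := by simp [abs_of_pos hβ]
    rw [h4, mul_comm]
    gcongr
  have h3 : |x| * ‖mobius β x ^ k - 1‖ ≤ 2 * (β * wt k) := by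
    calc |x| * ‖mobius β x ^ k - 1‖ ≤ |x| * (|(k : ℝ)| * ‖mobius β x - 1‖) := by
          gcongr
          exact norm_zpow_sub_one_le (norm_mobius hβ x) k
      _ = |(k : ℝ)| * (|x| * ‖mobius β x - 1‖) := by ring
      _ ≤ wt k * (2 * β) := by
          gcongr
          exact abs_le_wt k
      _ = _ := by ring
  have h4 := pow_le_pow_left₀ (by positivity) h3 2
  have h5 := pow_le_pow_left₀ (norm_nonneg _) h1 2
  rw [mul_pow, sq_abs] at h4
  rw [← div_eq_mul_inv, le_div_iff₀ (by positivity), div_pow, mul_add, mul_one, mul_div_assoc']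
  have h6 : ‖mobius β x ^ k - 1‖ ^ 2 * x ^ 2 / (β * wt k) ^ 2 ≤ 4 := by
    rw [div_le_iff₀ (by positivity)]
    linarith
  linarith

theorem integrable_inv_one_add_div_sq {κ : ℝ} (hκ : 0 < κ) :
    Integrable fun x : ℝ => (1 + (x / κ) ^ 2)⁻¹ :=
  integrable_inv_one_add_sq.comp_div hκ.ne'

theorem integral_inv_one_add_div_sq {κ : ℝ} (hκ : 0 < κ) :
    ∫ x : ℝ, (1 + (x / κ) ^ 2)⁻¹ = κ * Real.pi := by
  rw [Measure.integral_comp_div (fun x : ℝ => (1 + x ^ 2)⁻¹) κ, integral_univ_inv_one_add_sq,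
    abs_of_pos hκ, smul_eq_mul]

theorem exists_hasPVIntegral_mobiusSeries {β : ℝ} (hβ : 0 < β) {c : ℤ → ℂ}
    (hc : Summable fun k => wt k ^ (1 : ℝ) * ‖c k‖) (h0 : ∑' k, c k = 0) :
    ∃ I, HasPVIntegral (mobiusSeries β c) I ∧
      ‖I‖ ≤ 4 * Real.pi * β * ∑' k, wt k ^ (1 : ℝ) * ‖c k‖ := by
  have hc0 : Summable fun k => ‖c k‖ := summable_norm_of_wt_rpow zero_le_one hc
  -- Averaging over ±x turns M^k into (M^k + M^{-k})/2, and the -1 is free since ∑ c_k = 0. The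
  -- result is M^{-k}(M^k - 1)²/2, which decays quadratically and is integrable although M^k - 1
  -- need not be.
  set q : ℤ → ℝ → ℂ := fun k x => c k * ((mobius β x ^ k + (mobius β x ^ k)⁻¹) / 2 - 1) with hq
  have hqbound : ∀ k x, ‖q k x‖ ≤ ‖c k‖ * (4 * (1 + (x / (β * wt k)) ^ 2)⁻¹) := by
    intro k x
    have hne : mobius β x ^ k ≠ 0 := zpow_ne_zero k (mobius_ne_zero hβ x)
    have hn := norm_mobius_zpow hβ x k
    have e : (mobius β x ^ k + (mobius β x ^ k)⁻¹) / 2 - 1 =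
        (mobius β x ^ k)⁻¹ * (mobius β x ^ k - 1) ^ 2 / 2 := by
      field_simp
      ring
    simp only [hq]
    rw [norm_mul, e, norm_div, norm_mul, norm_inv, hn, norm_pow, inv_one, one_mul]
    have := norm_sq_mobius_zpow_sub_one_le hβ k x
    gcongr
    rw [Complex.norm_ofNat]
    linarith
  have hκ : ∀ k, 0 < β * wt k := fun k => mul_pos hβ (wt_pos k)
  have hdom : ∀ k, Integrable fun x : ℝ => ‖c k‖ * (4 * (1 + (x / (β * wt k)) ^ 2)⁻¹) :=
    fun k => ((integrable_inv_one_add_div_sq (hκ k)).const_mul 4).const_mul _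
  have hqcont : ∀ k, Continuous (q k) := fun k => by
    have h1 := continuous_mobius_zpow hβ k
    have h2 := h1.inv₀ fun x => zpow_ne_zero k (mobius_ne_zero hβ x)
    exact continuous_const.mul (((h1.add h2).div_const 2).sub continuous_const)
  have hqint : ∀ k, Integrable (q k) := fun k =>
    (hdom k).mono' (hqcont k).aestronglyMeasurable (Eventually.of_forall (hqbound k))
  have hqnorm : ∀ k, ∫ x, ‖q k x‖ ≤ 4 * Real.pi * β * (wt k ^ (1 : ℝ) * ‖c k‖) := by
    intro k
    refine (integral_mono (hqint k).norm (hdom k) (hqbound k)).trans_eq ?_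
    rw [integral_const_mul, integral_const_mul, integral_inv_one_add_div_sq (hκ k), Real.rpow_one]
    ring
  have hsum : Summable fun k => ∫ x, ‖q k x‖ :=
    (hc.mul_left _).of_nonneg_of_le (fun k => integral_nonneg fun x => norm_nonneg _) hqnorm
  have hI := hasSum_integral_of_summable_integral_norm hqint hsum
  have hqsum : ∀ x, ∑' k, q k x = (mobiusSeries β c x + mobiusSeries β c (-x)) / 2 := by
    intro x
    have h1 := hasSum_mobiusSeries hβ hc0 x
    have h2 := hasSum_mobiusSeries hβ hc0 (-x)
    have h3 : HasSum c 0 := h0 ▸ hc0.of_norm.hasSum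
    have h4 := ((h1.add h2).div_const 2).sub h3
    rw [sub_zero] at h4
    rw [← h4.tsum_eq]
    refine tsum_congr fun k => ?_
    rw [mobius_neg, inv_zpow]
    simp only [hq]
    ring
  have hqint' : Integrable fun x => (mobiusSeries β c x + mobiusSeries β c (-x)) / 2 := by
    simp only [← hqsum]
    have hq' : ∀ k, ∫⁻ x, ‖q k x‖ₑ = ENNReal.ofReal (∫ x, ‖q k x‖) := fun k =>
      (ofReal_integral_norm_eq_lintegral_enorm (hqint k)).symm
    have hfin : ∑' k, ∫⁻ x, ‖q k x‖ₑ ≠ ⊤ := by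
      simp only [hq']
      rw [← ENNReal.ofReal_tsum_of_nonneg (fun k => integral_nonneg fun x => norm_nonneg _) hsum]
      exact ENNReal.ofReal_ne_top
    have hcont : Continuous fun x => ∑' k, q k x := by
      simp only [hqsum]
      have := continuous_mobiusSeries hβ hc0
      fun_prop
    refine ⟨hcont.aestronglyMeasurable, ?_⟩
    refine lt_of_le_of_lt ?_ hfin.lt_top
    rw [← lintegral_tsum fun k => (hqcont k).enorm.measurable.aemeasurable]
    exact lintegral_mono fun x => enorm_tsum_le_tsum_enorm
  refine ⟨∫ x, ∑' k, q k x,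
    ⟨(continuous_mobiusSeries hβ hc0).locallyIntegrable, ?_⟩, ?_⟩
  · simp only [hqsum]
    -- On symmetric intervals a function and its even part have the same integral, so the principal
    -- value is an ordinary integral of the even part.
    refine (intervalIntegral_tendsto_integral hqint' tendsto_neg_atTop_atBot tendsto_id).congr
      fun R => ?_
    have hcont := continuous_mobiusSeries hβ hc0
    have e : ∫ x in (-R)..R, mobiusSeries β c (-x) = ∫ x in (-R)..R, mobiusSeries β c x := by
      rw [intervalIntegral.integral_comp_neg, neg_neg]
    simp only [id]
    rw [intervalIntegral.integral_div, intervalIntegral.integral_add, e]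
    · ring
    · exact hcont.intervalIntegrable _ _
    · exact (hcont.comp continuous_neg).intervalIntegrable _ _
  · rw [← hI.tsum_eq]
    have hb : ∀ k, ‖∫ x, q k x‖ ≤ 4 * Real.pi * β * (wt k ^ (1 : ℝ) * ‖c k‖) := fun k =>
      (norm_integral_le_integral_norm _).trans (hqnorm k)
    refine (tsum_of_norm_bounded (hc.mul_left _).hasSum hb).trans_eq ?_
    rw [tsum_mul_left]

/-! ### Weak derivatives in `L¹` -/

/-- The Cauchy criterion for b passes to v through the square root. This gives unconditional
convergence without summability of the norms, which is all the ℓ² hypothesis on derivatives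
provides. -/
theorem summable_and_norm_tsum_le_of_sqrt {E : Type*} [NormedAddCommGroup E] [CompleteSpace E]
    {v : ℤ → E} {b : ℤ → ℝ} {K : ℝ} (hK : 0 ≤ K) (hb0 : ∀ k, 0 ≤ b k) (hb : Summable b)
    (h : ∀ t : Finset ℤ, ‖∑ k ∈ t, v k‖ ≤ K * √(∑ k ∈ t, b k)) :
    Summable v ∧ ‖∑' k, v k‖ ≤ K * √(∑' k, b k) := by
  have hs : Summable v := by
    rw [summable_iff_vanishing_norm]
    intro ε hε
    obtain ⟨s, hs⟩ := summable_iff_vanishing_norm.mp hb ((ε / (K + 1)) ^ 2) (by positivity)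
    refine ⟨s, fun t ht => ?_⟩
    have h1 := hs t ht
    rw [Real.norm_of_nonneg (Finset.sum_nonneg fun k _ => hb0 k)] at h1
    have h2 : √(∑ k ∈ t, b k) ≤ ε / (K + 1) := by
      rw [← Real.sqrt_sq (show 0 ≤ ε / (K + 1) by positivity)]
      exact Real.sqrt_le_sqrt h1.le
    calc _ ≤ K * √(∑ k ∈ t, b k) := h t
      _ ≤ K * (ε / (K + 1)) := by gcongr
      _ < ε := by
        rw [mul_div_assoc', div_lt_iff₀ (by positivity)]
        linarith
  refine ⟨hs, ?_⟩
  refine le_of_tendsto hs.hasSum.norm (Eventually.of_forall fun t => (h t).trans ?_)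
  gcongr
  exact hb.sum_le_tsum t fun k _ => hb0 k

theorem contDiff_mobius_zpow {β : ℝ} (hβ : 0 < β) (k : ℤ) (j : ℕ) :
    ContDiff ℝ j fun x : ℝ => mobius β x ^ k := by
  have h : (fun x : ℝ => mobius β x ^ k) = mobiusSeries β (Pi.single k 1) := by
    funext x
    rw [mobiusSeries, tsum_eq_single k]
    · simp
    · intro l hl
      simp [hl]
  rw [h]
  refine contDiff_mobiusSeries hβ (summable_of_ne_finset_zero (s := {k}) fun l hl => ?_)
  simp [Finset.notMem_singleton.mp hl]

theorem mobiusSeries_ite_mem {β : ℝ} (t : Finset ℤ) (c : ℤ → ℂ) :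
    mobiusSeries β (fun k => if k ∈ t then c k else 0) =
      fun x : ℝ => ∑ k ∈ t, c k * mobius β x ^ k := by
  funext x
  simp only [mobiusSeries, ite_mul, zero_mul]
  exact (hasSum_ite_mem t _).tsum_eq

theorem iteratedDeriv_mobiusSeries_ite_mem {β : ℝ} (hβ : 0 < β) (t : Finset ℤ) (c : ℤ → ℂ) (j : ℕ)
    (x : ℝ) : iteratedDeriv j (mobiusSeries β (fun k => if k ∈ t then c k else 0)) x =
      ∑ k ∈ t, c k * iteratedDeriv j (fun x : ℝ => mobius β x ^ k) x := by
  rw [mobiusSeries_ite_mem, iteratedDeriv_fun_sum]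
  · refine Finset.sum_congr rfl fun k _ => ?_
    exact iteratedDeriv_const_mul _ (contDiff_mobius_zpow hβ k j).contDiffAt
  · exact fun k _ => (contDiff_const.mul (contDiff_mobius_zpow hβ k j)).contDiffAt

theorem summable_wt_ite_mem (t : Finset ℤ) (c : ℤ → ℂ) (p : ℝ) :
    Summable fun k => wt k ^ p * ‖if k ∈ t then c k else 0‖ :=
  summable_of_ne_finset_zero (s := t) fun k hk => by simp [hk]

theorem tsum_wt_sq_ite_mem (t : Finset ℤ) (c : ℤ → ℂ) (p : ℝ) :
    ∑' k, (wt k ^ p * ‖if k ∈ t then c k else 0‖) ^ 2 = ∑ k ∈ t, (wt k ^ p * ‖c k‖) ^ 2 := by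
  rw [← (hasSum_ite_mem t _).tsum_eq]
  refine tsum_congr fun k => ?_
  split_ifs <;> simp

theorem hasCompactSupport_ofReal {φ : ℝ → ℝ} (hφ : HasCompactSupport φ) :
    HasCompactSupport fun x => (φ x : ℂ) :=
  hφ.comp_left Complex.ofReal_zero

theorem hasCompactSupport_iteratedDeriv {φ : ℝ → ℝ} (hφ : HasCompactSupport φ) (j : ℕ) :
    HasCompactSupport (iteratedDeriv j φ) := by
  induction j with
  | zero => simpa
  | succ j ih =>
    rw [iteratedDeriv_succ]
    exact ih.deriv

theorem integral_iteratedDeriv_mul {h : ℝ → ℂ} (hh : ContDiff ℝ ∞ h) (j : ℕ) {φ : ℝ → ℝ}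
    (hφ : ContDiff ℝ ∞ φ) (hsupp : HasCompactSupport φ) :
    ∫ x, ((iteratedDeriv j φ x : ℝ) : ℂ) * h x =
      (-1) ^ j * ∫ x, (φ x : ℂ) * iteratedDeriv j h x := by
  induction j generalizing φ with
  | zero => simp
  | succ j ih =>
    have hφ' : ContDiff ℝ ∞ (deriv φ) := (contDiff_infty_iff_deriv.mp hφ).2
    rw [iteratedDeriv_succ', ih hφ' hsupp.deriv, pow_succ, mul_assoc]
    congr 1
    have hj : ContDiff ℝ ∞ (iteratedDeriv j h) := by
      rw [iteratedDeriv_eq_iterate]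
      exact hh.iterate_deriv j
    have hcs := hasCompactSupport_ofReal hsupp
    have hcs' := hasCompactSupport_ofReal hsupp.deriv
    have hc1 : Continuous fun x => (φ x : ℂ) := Complex.continuous_ofReal.comp hφ.continuous
    have hc2 : Continuous fun x => ((deriv φ x : ℝ) : ℂ) := Complex.continuous_ofReal.comp hφ'.continuous
    have hc3 := hj.continuous
    have hc4 : Continuous (iteratedDeriv (j + 1) h) := by
      rw [iteratedDeriv_succ]
      exact hj.continuous_deriv (by simp)
    have hd : ∀ x, HasDerivAt (iteratedDeriv j h) (iteratedDeriv (j + 1) h x) x := fun x => by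
      rw [iteratedDeriv_succ]
      exact ((hj.differentiable (by simp)) x).hasDerivAt
    have key := integral_mul_deriv_eq_deriv_mul_of_integrable (A := ℂ)
      (u := fun x => (φ x : ℂ)) (v := iteratedDeriv j h) (u' := fun x => ((deriv φ x : ℝ) : ℂ))
      (v' := iteratedDeriv (j + 1) h)
      (fun x _ => ((hφ.differentiable (by simp)) x).hasDerivAt.ofReal_comp)
      (fun x _ => hd x)
      ((hc1.mul hc4).integrable_of_hasCompactSupport hcs.mul_right)
      ((hc2.mul hc3).integrable_of_hasCompactSupport hcs'.mul_right)
      ((hc1.mul hc3).integrable_of_hasCompactSupport hcs.mul_right)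
    rw [key]
    ring

/-- Under a weighted ℓ² condition the j-th derivative series need not converge absolutely at points,
so it is summed in L¹ from the bound on finite sums. The weak derivative identity holds for each M^k
and passes to the sum. -/
theorem exists_isWeakDeriv_mobiusSeries {β : ℝ} (hβ : 0 < β) {j : ℕ} (hj : 0 < j) :
    ∃ K, 0 ≤ K ∧ ∀ c : ℤ → ℂ, Summable (fun k => ‖c k‖) →
      Summable (fun k => (wt k ^ (j : ℝ) * ‖c k‖) ^ 2) →
      ∃ w : ℝ → ℂ, IsWeakDeriv j (mobiusSeries β c) w ∧ Integrable w ∧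
        ∫ x, ‖w x‖ ≤ K * √(∑' k, (wt k ^ (j : ℝ) * ‖c k‖) ^ 2) := by
  obtain ⟨K, hK, h⟩ := exists_lintegral_iteratedDeriv_mobiusSeries_le hβ hj
  refine ⟨K, hK, fun c hc hc2 => ?_⟩
  set e : ℤ → ℝ → ℂ := fun k => iteratedDeriv j (fun x : ℝ => mobius β x ^ k) with he
  have hecont : ∀ k, Continuous (e k) := fun k =>
    (contDiff_mobius_zpow hβ k j).continuous_iteratedDeriv j le_rfl
  have hfin : ∀ (t : Finset ℤ) (a : ℤ → ℂ), ∫⁻ x, ‖∑ k ∈ t, a k * e k x‖ₑ ≤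
      ENNReal.ofReal (K * √(∑ k ∈ t, (wt k ^ (j : ℝ) * ‖a k‖) ^ 2)) := by
    intro t a
    have h1 := h (fun k => if k ∈ t then a k else 0) (summable_wt_ite_mem t a j)
    rw [tsum_wt_sq_ite_mem] at h1
    simpa only [iteratedDeriv_mobiusSeries_ite_mem hβ] using h1
  have heint : ∀ k, Integrable (e k) := fun k => by
    refine ⟨(hecont k).aestronglyMeasurable, ?_⟩
    have h1 := hfin {k} fun _ => 1
    simp only [Finset.sum_singleton, one_mul] at h1
    exact h1.trans_lt ENNReal.ofReal_lt_top
  have hint : ∀ (t : Finset ℤ), Integrable fun x => ∑ k ∈ t, c k * e k x := fun t =>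
    integrable_finsetSum t fun k _ => (heint k).const_mul _
  set v : ℤ → Lp ℂ 1 (volume : Measure ℝ) := fun k => ((heint k).const_mul (c k)).toL1 _ with hv
  have hvsum : ∀ t : Finset ℤ, ∑ k ∈ t, v k = (hint t).toL1 _ := by
    intro t
    refine Lp.ext ?_
    refine EventuallyEq.trans ?_ (Integrable.coeFn_toL1 _).symm
    refine (Lp.coeFn_finsetSum _ _).trans ?_
    have : ∀ᵐ x, ∀ k, v k x = c k * e k x :=
      ae_all_iff.mpr fun k => Integrable.coeFn_toL1 ((heint k).const_mul (c k))
    filter_upwards [this] with x hx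
    simp [hx]
  obtain ⟨hs, hle⟩ := summable_and_norm_tsum_le_of_sqrt (v := v) hK (fun k => sq_nonneg _) hc2
    fun t => by
      rw [hvsum, Integrable.norm_toL1]
      refine ENNReal.toReal_le_of_le_ofReal (by positivity) ?_
      simpa only [edist_zero_right] using hfin t c
  set w := ∑' k, v k with hw
  have hwint : Integrable w := L1.integrable_coeFn w
  refine ⟨w, ⟨(continuous_mobiusSeries hβ hc).locallyIntegrable, hwint.locallyIntegrable,
    fun φ hφ hsupp => ?_⟩, hwint, ?_⟩
  · have hφc := Complex.continuous_ofReal.comp hφ.continuous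
    have hcs : HasCompactSupport fun x => (φ x : ℂ) := hsupp.comp_left Complex.ofReal_zero
    have hφm : MemLp (fun x => (φ x : ℂ)) ⊤ (volume : Measure ℝ) :=
      hφc.memLp_of_hasCompactSupport hcs
    -- Pairing with the bounded function φ is a continuous functional on L¹, so it commutes with the
    -- series.
    have hpair : ∀ u : Lp ℂ 1 (volume : Measure ℝ),
        (ContinuousLinearMap.mul ℂ ℂ).lpPairing volume ⊤ 1 hφm.toLp u = ∫ x, (φ x : ℂ) * u x := by
      intro u
      rw [ContinuousLinearMap.lpPairing_eq_integral]
      refine integral_congr_ae ?_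
      filter_upwards [hφm.coeFn_toLp] with x hx
      simp [hx]
    have h1 := ((ContinuousLinearMap.mul ℂ ℂ).lpPairing volume ⊤ 1 hφm.toLp).hasSum hs.hasSum
    simp only [hpair] at h1
    have h2 : ∀ k, ∫ x, (φ x : ℂ) * v k x = c k * ((-1) ^ j *
        ∫ x, ((iteratedDeriv j φ x : ℝ) : ℂ) * mobius β x ^ k) := by
      intro k
      rw [integral_iteratedDeriv_mul
        (contDiff_infty.mpr fun m => contDiff_mobius_zpow hβ k m) j hφ hsupp,
        ← mul_assoc ((-1) ^ j), ← mul_pow, neg_one_mul, neg_neg, one_pow, one_mul,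
        ← integral_const_mul]
      refine integral_congr_ae ?_
      filter_upwards [Integrable.coeFn_toL1 ((heint k).const_mul (c k))] with x hx
      simp only [hv]
      rw [hx]
      ring
    simp only [h2] at h1
    have hψc : Continuous fun x => ((iteratedDeriv j φ x : ℝ) : ℂ) :=
      Complex.continuous_ofReal.comp (hφ.continuous_iteratedDeriv j (by exact_mod_cast le_top))
    have hψs : HasCompactSupport fun x => ((iteratedDeriv j φ x : ℝ) : ℂ) := by
      exact (hasCompactSupport_iteratedDeriv hsupp j).comp_left Complex.ofReal_zero
    have h3 := hasSum_integral_of_summable_integral_norm (μ := (volume : Measure ℝ))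
      (F := fun k x => ((iteratedDeriv j φ x : ℝ) : ℂ) * (c k * mobius β x ^ k)) (fun k => ?_) ?_
    · have h4 : ∀ k, ∫ x, ((iteratedDeriv j φ x : ℝ) : ℂ) * (c k * mobius β x ^ k) =
          c k * ∫ x, ((iteratedDeriv j φ x : ℝ) : ℂ) * mobius β x ^ k := by
        intro k
        rw [← integral_const_mul]
        congr 1
        funext x
        ring
      have h5 : ∫ x, ((iteratedDeriv j φ x : ℝ) : ℂ) * mobiusSeries β c x =
          ∑' k, c k * ∫ x, ((iteratedDeriv j φ x : ℝ) : ℂ) * mobius β x ^ k := by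
        simp only [h4, tsum_mul_left] at h3
        exact h3.tsum_eq.symm
      rw [h5, ← h1.tsum_eq, ← tsum_mul_left]
      refine tsum_congr fun k => ?_
      rw [mul_left_comm, ← mul_assoc ((-1) ^ j), ← mul_pow, neg_one_mul, neg_neg, one_pow, one_mul]
    · exact (hψc.mul (continuous_const.mul (continuous_mobius_zpow hβ k))).integrable_of_hasCompactSupport
        hψs.mul_right
    · simp only [norm_mul, norm_mobius_zpow hβ, mul_one, integral_mul_const]
      exact hc.mul_left _
  · rw [← L1.norm_eq_integral_norm]
    exact hle

/-! ### The Fourier transform on `L²` and derivatives -/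

theorem toTemperedDistribution_lineDeriv {h h' : ℝ → ℂ} (hd : ∀ x, HasDerivAt h (h' x) x)
    (hh : MemLp h 2 (volume : Measure ℝ)) (hh' : MemLp h' 2 (volume : Measure ℝ)) :
    LineDeriv.lineDerivOp (1 : ℝ) (Lp.toTemperedDistribution (hh.toLp h)) =
      Lp.toTemperedDistribution (hh'.toLp h') := by
  ext φ
  rw [TemperedDistribution.lineDerivOp_apply_apply, Lp.toTemperedDistribution_apply,
    Lp.toTemperedDistribution_apply]
  have hφ : MemLp (fun x => φ x) 2 (volume : Measure ℝ) := φ.memLp 2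
  have hφ' : MemLp (fun x => (LineDeriv.lineDerivOp (1 : ℝ) φ) x) 2 (volume : Measure ℝ) :=
    SchwartzMap.memLp (LineDeriv.lineDerivOp (1 : ℝ) φ) 2 volume
  have hdφ : ∀ x, HasDerivAt (fun x => φ x) ((LineDeriv.lineDerivOp (1 : ℝ) φ) x) x := by
    intro x
    have := (φ.differentiableAt (x := x)).hasDerivAt
    rwa [← SchwartzMap.derivCLM_apply (𝕜 := ℂ)] at this
  have key := integral_mul_deriv_eq_deriv_mul_of_integrable (A := ℂ) (fun x _ => hdφ x)
    (fun x _ => hd x) (hφ.integrable_mul hh') (hφ'.integrable_mul hh) (hφ.integrable_mul hh)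
  have e1 : ∫ x, φ x • hh'.toLp h' x = ∫ x, φ x * h' x := by
    refine integral_congr_ae ?_
    filter_upwards [hh'.coeFn_toLp] with x hx
    rw [hx, smul_eq_mul]
  have e2 : ∫ x, (-(LineDeriv.lineDerivOp (1 : ℝ) φ)) x • hh.toLp h x =
      -∫ x, (LineDeriv.lineDerivOp (1 : ℝ) φ) x * h x := by
    rw [← integral_neg]
    refine integral_congr_ae ?_
    filter_upwards [hh.coeFn_toLp] with x hx
    rw [hx, smul_eq_mul, neg_apply, neg_mul]
  rw [e1, e2, key]

/-- The Fourier transform of tempered distributions turns differentiation into multiplication by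
2πiξ. Testing against smooth compactly supported functions returns to an almost everywhere identity.
-/
theorem fourier_toLp_deriv {h h' : ℝ → ℂ} (hd : ∀ x, HasDerivAt h (h' x) x)
    (hh : MemLp h 2 (volume : Measure ℝ)) (hh' : MemLp h' 2 (volume : Measure ℝ)) :
    ∀ᵐ ξ : ℝ, (𝓕 hh'.toLp : Lp ℂ 2 (volume : Measure ℝ)) ξ =
      2 * Real.pi * Complex.I * ξ * (𝓕 hh.toLp : Lp ℂ 2 (volume : Measure ℝ)) ξ := by
  have h1 := congrArg (fun T => 𝓕 T) (toTemperedDistribution_lineDeriv hd hh hh')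
  simp only [TemperedDistribution.fourier_lineDerivOp_eq,
    Lp.fourier_toTemperedDistribution_eq] at h1
  set Φ := (𝓕 hh.toLp : Lp ℂ 2 (volume : Measure ℝ))
  set Φ' := (𝓕 hh'.toLp : Lp ℂ 2 (volume : Measure ℝ))
  have hΦ : LocallyIntegrable Φ := (Lp.memLp Φ).locallyIntegrable one_le_two
  have hΦ' : LocallyIntegrable Φ' := (Lp.memLp Φ').locallyIntegrable one_le_two
  refine ae_eq_of_integral_contDiff_smul_eq hΦ' ?_ fun φ hφ hsupp => ?_
  · exact (hΦ.continuous_mul (g := fun ξ : ℝ => (2 * Real.pi * Complex.I * ξ : ℂ)) (by fun_prop))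
  · have hg₁ : HasCompactSupport (Complex.ofRealCLM ∘ φ) := hsupp.comp_left rfl
    have hg₂ : ContDiff ℝ ∞ (Complex.ofRealCLM ∘ φ) := by fun_prop
    have h2 := congrArg (fun T => T (hg₁.toSchwartzMap hg₂)) h1
    have hgrowth : (fun x : ℝ => (x : ℂ)).HasTemperateGrowth := by fun_prop
    simp at h2
    rw [← integral_const_mul] at h2
    have h3 : ∫ x, (φ x : ℂ) * Φ' x = ∫ x, φ x • Φ' x := by simp
    rw [← h3]
    refine h2.symm.trans (integral_congr_ae (Eventually.of_forall fun x => ?_))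
    simp only [SchwartzMap.smulLeftCLM_apply_apply hgrowth, HasCompactSupport.toSchwartzMap_toFun,
      Function.comp_apply, Complex.ofRealCLM_apply, smul_eq_mul, Complex.real_smul]
    ring

theorem lintegral_sq_enorm_Lp (u : Lp ℂ 2 (volume : Measure ℝ)) :
    ∫⁻ x, ‖u x‖ₑ ^ 2 = ENNReal.ofReal (‖u‖ ^ 2) := by
  have h := eLpNorm_nnreal_pow_eq_lintegral (μ := (volume : Measure ℝ)) (f := u) (p := 2)
    two_ne_zero
  rw [ENNReal.ofReal_pow (norm_nonneg _), ofReal_norm, Lp.enorm_def]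
  simpa using h.symm

theorem fourier_toLp_iteratedDeriv {h : ℝ → ℂ} (hh : ContDiff ℝ ∞ h)
    (hm : ∀ m, MemLp (iteratedDeriv m h) 2 (volume : Measure ℝ)) (m : ℕ) :
    ∀ᵐ ξ : ℝ, (𝓕 (hm m).toLp : Lp ℂ 2 (volume : Measure ℝ)) ξ =
      (2 * Real.pi * Complex.I * ξ) ^ m * (𝓕 (hm 0).toLp : Lp ℂ 2 (volume : Measure ℝ)) ξ := by
  induction m with
  | zero => simp
  | succ m ih =>
    have hd : ∀ x, HasDerivAt (iteratedDeriv m h) (iteratedDeriv (m + 1) h x) x := fun x => by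
      rw [iteratedDeriv_succ]
      refine DifferentiableAt.hasDerivAt ?_
      exact (hh.differentiable_iteratedDeriv m (by exact_mod_cast ENat.natCast_lt_top m)) x
    filter_upwards [ih, fourier_toLp_deriv hd (hm m) (hm (m + 1))] with ξ h1 h2
    rw [h2, h1]
    ring

/-- Fatou's lemma along a subsequence that converges almost everywhere: weighted bounds pass to L²
limits even for an unbounded weight. -/
theorem lintegral_mul_sq_le_of_tendsto {w : ℝ → ENNReal} (hw : Measurable w)
    (hw' : ∀ x, w x ≠ ⊤)
    {u : ℕ → Lp ℂ 2 (volume : Measure ℝ)} {g : Lp ℂ 2 (volume : Measure ℝ)}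
    (hu : Tendsto u atTop (𝓝 g)) {B : ENNReal} (hB : ∀ n, ∫⁻ x, w x * ‖u n x‖ₑ ^ 2 ≤ B) :
    ∫⁻ x, w x * ‖g x‖ₑ ^ 2 ≤ B := by
  obtain ⟨ns, -, hns⟩ := (tendstoInMeasure_of_tendsto_Lp hu).exists_seq_tendsto_ae
  have hmeas : ∀ i, AEMeasurable (fun x => ‖u (ns i) x‖ₑ ^ 2) (volume : Measure ℝ) := fun i =>
    (Lp.aestronglyMeasurable (u (ns i))).enorm.pow_const 2
  calc ∫⁻ x, w x * ‖g x‖ₑ ^ 2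
      ≤ ∫⁻ x, liminf (fun i => w x * ‖u (ns i) x‖ₑ ^ 2) atTop := by
        refine lintegral_mono_ae ?_
        filter_upwards [hns] with x hx
        have h1 : Tendsto (fun i => ‖u (ns i) x‖ₑ ^ 2) atTop (𝓝 (‖g x‖ₑ ^ 2)) :=
          ((ENNReal.continuous_pow 2).tendsto _).comp hx.enorm
        exact (ENNReal.Tendsto.const_mul h1 (Or.inr (hw' x))).liminf_eq.ge
    _ ≤ liminf (fun i => ∫⁻ x, w x * ‖u (ns i) x‖ₑ ^ 2) atTop :=
        lintegral_liminf_le' fun i => hw.aemeasurable.mul (hmeas i)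
    _ ≤ B := by
        refine liminf_le_of_frequently_le' (Frequently.of_forall fun i => hB _)

/-! ### The error as an element of `L²` -/

section LineSeries

variable {β : ℝ}

theorem memLp_mobius_zpow_sub_one (hβ : 0 < β) (k : ℤ) :
    MemLp (fun x : ℝ => mobius β x ^ k - 1) 2 (volume : Measure ℝ) := by
  have hcont : Continuous fun x : ℝ => mobius β x ^ k - 1 :=
    (continuous_mobius_zpow hβ k).sub continuous_const
  rw [memLp_two_iff_integrable_sq_norm hcont.aestronglyMeasurable]
  refine ((integrable_inv_one_add_div_sq (mul_pos hβ (wt_pos k))).const_mul 8).mono'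
    (hcont.norm.pow 2).aestronglyMeasurable (Eventually.of_forall fun x => ?_)
  rw [Real.norm_of_nonneg (sq_nonneg _)]
  exact norm_sq_mobius_zpow_sub_one_le hβ k x

/-- The function `M_β^k - 1` as an element of `L²`. -/
def mobiusLp (hβ : 0 < β) (k : ℤ) : Lp ℂ 2 (volume : Measure ℝ) :=
  (memLp_mobius_zpow_sub_one hβ k).toLp

theorem norm_mobiusLp_le (hβ : 0 < β) (k : ℤ) :
    ‖mobiusLp hβ k‖ ≤ √(8 * Real.pi * β) * wt k ^ (1 / 2 : ℝ) := by
  have hκ : 0 < β * wt k := mul_pos hβ (wt_pos k)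
  have h1 : ‖mobiusLp hβ k‖ ^ 2 ≤ 8 * Real.pi * β * wt k := by
    rw [← ENNReal.ofReal_le_ofReal_iff (by have := wt_pos k; positivity),
      ← lintegral_sq_enorm_Lp]
    have h2 : ∫⁻ x, ‖mobiusLp hβ k x‖ₑ ^ 2 ≤
        ∫⁻ x : ℝ, ENNReal.ofReal (8 * (1 + (x / (β * wt k)) ^ 2)⁻¹) := by
      refine lintegral_mono_ae ?_
      filter_upwards [(memLp_mobius_zpow_sub_one hβ k).coeFn_toLp] with x hx
      rw [mobiusLp, hx, ← ofReal_norm, ← ENNReal.ofReal_pow (norm_nonneg _)]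
      exact ENNReal.ofReal_le_ofReal (norm_sq_mobius_zpow_sub_one_le hβ k x)
    refine h2.trans_eq ?_
    rw [← ofReal_integral_eq_lintegral_ofReal
      ((integrable_inv_one_add_div_sq hκ).const_mul 8)
      (Eventually.of_forall fun x => by positivity), integral_const_mul,
      integral_inv_one_add_div_sq hκ]
    congr 1
    ring
  have h3 := Real.abs_le_sqrt h1
  rw [abs_of_nonneg (norm_nonneg _), Real.sqrt_mul (by positivity)] at h3
  rwa [← Real.sqrt_eq_rpow]

theorem mobiusLp_sum_coeFn (hβ : 0 < β) (t : Finset ℤ) (c : ℤ → ℂ) :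
    ∀ᵐ x, (∑ k ∈ t, c k • mobiusLp hβ k) x = ∑ k ∈ t, c k * (mobius β x ^ k - 1) := by
  have h : ∀ᵐ x, ∀ k, (c k • mobiusLp hβ k) x = c k * (mobius β x ^ k - 1) := by
    rw [ae_all_iff]
    intro k
    filter_upwards [Lp.coeFn_smul (c k) (mobiusLp hβ k),
      (memLp_mobius_zpow_sub_one hβ k).coeFn_toLp] with x h1 h2
    rw [h1, Pi.smul_apply, mobiusLp, h2, smul_eq_mul]
  filter_upwards [h, Lp.coeFn_finsetSum t (fun k => c k • mobiusLp hβ k)] with x h1 h2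
  rw [h2]
  simp [h1]

theorem iteratedDeriv_sum_mobius_sub_one (t : Finset ℤ) (c : ℤ → ℂ) {m : ℕ}
    (hm : 0 < m) : iteratedDeriv m (fun x : ℝ => ∑ k ∈ t, c k * (mobius β x ^ k - 1)) =
      iteratedDeriv m (mobiusSeries β (fun k => if k ∈ t then c k else 0)) := by
  have e : (fun x : ℝ => ∑ k ∈ t, c k * (mobius β x ^ k - 1)) =
      fun x => mobiusSeries β (fun k => if k ∈ t then c k else 0) x - ∑ k ∈ t, c k := by
    funext x
    rw [mobiusSeries_ite_mem, ← Finset.sum_sub_distrib]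
    exact Finset.sum_congr rfl fun k _ => by ring
  obtain ⟨i, rfl⟩ : ∃ i, m = i + 1 := ⟨m - 1, by omega⟩
  rw [e, iteratedDeriv_succ', iteratedDeriv_succ']
  congr 1
  funext x
  exact deriv_sub_const _

/-- Plancherel applied to the m-th derivative, which does not see the subtracted constants. The sum
is finite, so m is not limited by s. -/
theorem exists_lintegral_fourier_sum_mobiusLp_le (hβ : 0 < β) {m : ℕ} (hm : 0 < m) :
    ∃ K, 0 ≤ K ∧ ∀ (t : Finset ℤ) (c : ℤ → ℂ),
      ∫⁻ ξ, ENNReal.ofReal ((2 * Real.pi * |ξ|) ^ (2 * m)) *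
        ‖(𝓕 (∑ k ∈ t, c k • mobiusLp hβ k) : Lp ℂ 2 (volume : Measure ℝ)) ξ‖ₑ ^ 2 ≤
      ENNReal.ofReal (K * ∑ k ∈ t, (wt k ^ (m : ℝ) * ‖c k‖) ^ 2) := by
  obtain ⟨K, hK, h⟩ := exists_lintegral_sq_iteratedDeriv_mobiusSeries_le hβ hm
  refine ⟨K, hK, fun t c => ?_⟩
  set g : ℝ → ℂ := fun x => ∑ k ∈ t, c k * (mobius β x ^ k - 1) with hg
  have hgs : ContDiff ℝ ∞ g := contDiff_infty.mpr fun j => ContDiff.sum fun k _ =>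
    contDiff_const.mul ((contDiff_mobius_zpow hβ k j).sub contDiff_const)
  have hmem : ∀ i, MemLp (iteratedDeriv i g) 2 (volume : Measure ℝ) := by
    intro i
    rcases Nat.eq_zero_or_pos i with rfl | hi
    · rw [iteratedDeriv_zero]
      exact memLp_finsetSum _ fun k _ => (memLp_mobius_zpow_sub_one hβ k).const_mul (c k)
    · obtain ⟨K', hK', h'⟩ := exists_lintegral_sq_iteratedDeriv_mobiusSeries_le hβ hi
      have h1 := h' (fun k => if k ∈ t then c k else 0) (summable_wt_ite_mem t c i)
      rw [← iteratedDeriv_sum_mobius_sub_one t c hi] at h1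
      refine ⟨(hgs.continuous_iteratedDeriv i (by exact_mod_cast le_top)).aestronglyMeasurable, ?_⟩
      rw [eLpNorm_lt_top_iff_lintegral_rpow_enorm_lt_top two_ne_zero ENNReal.ofNat_ne_top]
      simpa using h1.trans_lt ENNReal.ofReal_lt_top
  have h0 : (hmem 0).toLp = ∑ k ∈ t, c k • mobiusLp hβ k := by
    refine Lp.ext ?_
    filter_upwards [(hmem 0).coeFn_toLp, mobiusLp_sum_coeFn hβ t c] with x h1 h2
    rw [h1, h2, iteratedDeriv_zero]
  have h1 := h (fun k => if k ∈ t then c k else 0) (summable_wt_ite_mem t c m)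
  rw [← iteratedDeriv_sum_mobius_sub_one t c hm, tsum_wt_sq_ite_mem] at h1
  refine le_trans (le_of_eq ?_) h1
  have h2 : ∫⁻ x, ‖iteratedDeriv m g x‖ₑ ^ 2 = ∫⁻ x, ‖(hmem m).toLp (iteratedDeriv m g) x‖ₑ ^ 2 := by
    refine lintegral_congr_ae ?_
    filter_upwards [(hmem m).coeFn_toLp] with x hx
    rw [hx]
  rw [h2, lintegral_sq_enorm_Lp, ← Lp.norm_fourier_eq, ← lintegral_sq_enorm_Lp, ← h0]
  refine lintegral_congr_ae ?_
  filter_upwards [fourier_toLp_iteratedDeriv hgs hmem m] with ξ hξ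
  have h3 : ‖(2 * Real.pi * Complex.I * ξ : ℂ)‖ = 2 * Real.pi * |ξ| := by
    simp [abs_of_pos Real.pi_pos]
  rw [hξ, enorm_mul, enorm_pow, mul_pow (_ ^ m), ← ofReal_norm (2 * Real.pi * Complex.I * ξ : ℂ),
    h3, ← ENNReal.ofReal_pow (by positivity), ← ENNReal.ofReal_pow (by positivity), ← pow_mul,
    mul_comm m 2]

variable {c : ℤ → ℂ}

theorem summable_smul_mobiusLp (hβ : 0 < β) (hc : Summable fun k => wt k ^ (1 / 2 : ℝ) * ‖c k‖) :
    Summable (fun k => c k • mobiusLp hβ k) ∧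
      ‖∑' k, c k • mobiusLp hβ k‖ ≤
        √(8 * Real.pi * β) * ∑' k, wt k ^ (1 / 2 : ℝ) * ‖c k‖ := by
  have hb : ∀ k, ‖c k • mobiusLp hβ k‖ ≤
      √(8 * Real.pi * β) * (wt k ^ (1 / 2 : ℝ) * ‖c k‖) := fun k => by
    rw [norm_smul]
    have := norm_mobiusLp_le hβ k
    calc _ ≤ ‖c k‖ * (√(8 * Real.pi * β) * wt k ^ (1 / 2 : ℝ)) := by gcongr
      _ = _ := by ring
  refine ⟨Summable.of_norm_bounded (hc.mul_left _) hb, ?_⟩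
  rw [← tsum_mul_left]
  exact tsum_of_norm_bounded (hc.mul_left _).hasSum hb

/-- Along suitable partial sums the L² limit is also an almost everywhere limit, and pointwise the
-1's contribute -∑ c_k = 0. -/
theorem coeFn_tsum_mobiusLp (hβ : 0 < β) (hc : Summable fun k => wt k ^ (1 / 2 : ℝ) * ‖c k‖)
    (h0 : ∑' k, c k = 0) : (∑' k, c k • mobiusLp hβ k : Lp ℂ 2 (volume : Measure ℝ)) =ᵐ[volume]
      mobiusSeries β c := by
  have hs := (summable_smul_mobiusLp hβ hc).1.hasSum
  have hc0 : Summable fun k => ‖c k‖ := summable_norm_of_wt_rpow (by norm_num) hc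
  obtain ⟨t, ht⟩ := exists_seq_tendsto (atTop : Filter (Finset ℤ))
  obtain ⟨ns, hns, hae⟩ :=
    (tendstoInMeasure_of_tendsto_Lp (hs.comp ht)).exists_seq_tendsto_ae
  have hall : ∀ᵐ x, ∀ n, (∑ k ∈ t n, c k • mobiusLp hβ k) x =
      ∑ k ∈ t n, c k * (mobius β x ^ k - 1) :=
    ae_all_iff.mpr fun n => mobiusLp_sum_coeFn hβ (t n) c
  filter_upwards [hae, hall] with x h1 h2
  refine tendsto_nhds_unique h1 ?_
  have h3 : HasSum (fun k => c k * (mobius β x ^ k - 1)) (mobiusSeries β c x) := by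
    have h4 := (hasSum_mobiusSeries hβ hc0 x).sub hc0.of_norm.hasSum
    rw [h0, sub_zero] at h4
    simpa only [mul_sub, mul_one] using h4
  exact ((h3.comp ht).comp hns.tendsto_atTop).congr fun i => (h2 _).symm

theorem exists_lintegral_fourier_tsum_mobiusLp_le (hβ : 0 < β) :
    ∃ K, 0 ≤ K ∧ ∀ c : ℤ → ℂ, Summable (fun k => wt k ^ (1 / 2 : ℝ) * ‖c k‖) →
      Summable (fun k => (wt k ^ (1 : ℝ) * ‖c k‖) ^ 2) →
      ∫⁻ ξ, ENNReal.ofReal ((2 * Real.pi * |ξ|) ^ 2) *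
        ‖(𝓕 (∑' k, c k • mobiusLp hβ k) : Lp ℂ 2 (volume : Measure ℝ)) ξ‖ₑ ^ 2 ≤
      ENNReal.ofReal (K * ∑' k, (wt k ^ (1 : ℝ) * ‖c k‖) ^ 2) := by
  obtain ⟨K, hK, h⟩ := exists_lintegral_fourier_sum_mobiusLp_le hβ one_pos
  refine ⟨K, hK, fun c hc hc2 => ?_⟩
  have hs := (summable_smul_mobiusLp hβ hc).1.hasSum
  obtain ⟨t, ht⟩ := exists_seq_tendsto (atTop : Filter (Finset ℤ))
  have htend : Tendsto (fun n => (𝓕 (∑ k ∈ t n, c k • mobiusLp hβ k) :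
      Lp ℂ 2 (volume : Measure ℝ))) atTop (𝓝 (𝓕 (∑' k, c k • mobiusLp hβ k))) :=
    ((Lp.fourierTransformₗᵢ ℝ ℂ).continuous.tendsto _).comp (hs.comp ht)
  refine lintegral_mul_sq_le_of_tendsto (by fun_prop) (fun _ => ENNReal.ofReal_ne_top) htend fun n => ?_
  refine (h (t n) c).trans (ENNReal.ofReal_le_ofReal ?_)
  rw [Nat.cast_one]
  exact mul_le_mul_of_nonneg_left (hc2.sum_le_tsum _ fun k _ => sq_nonneg _) hK

end LineSeries

/-! ### Decay of the transform at high frequencies -/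

theorem setLIntegral_le_inv_mul_lintegral {N : ℝ} (hN : 0 < N) (m : ℕ) (v : ℝ → ENNReal) :
    ∫⁻ ξ in {ξ : ℝ | N ≤ 2 * Real.pi * |ξ|}, v ξ ≤
      ENNReal.ofReal ((N ^ (2 * m))⁻¹) *
        ∫⁻ ξ, ENNReal.ofReal ((2 * Real.pi * |ξ|) ^ (2 * m)) * v ξ := by
  have hS : MeasurableSet {ξ : ℝ | N ≤ 2 * Real.pi * |ξ|} :=
    measurableSet_le measurable_const (by fun_prop)
  rw [← lintegral_const_mul' _ _ ENNReal.ofReal_ne_top]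
  refine le_trans (setLIntegral_mono' hS fun ξ hξ => ?_) (setLIntegral_le_lintegral _ _)
  rw [← mul_assoc, ← ENNReal.ofReal_mul (by positivity)]
  refine le_mul_of_one_le_left zero_le ?_
  rw [← ENNReal.ofReal_one]
  refine ENNReal.ofReal_le_ofReal ?_
  rw [inv_mul_eq_div, one_le_div (by positivity)]
  exact pow_le_pow_left₀ hN.le hξ _

theorem sq_enorm_add_le (x y : ℂ) : ‖x + y‖ₑ ^ 2 ≤ 2 * ‖x‖ₑ ^ 2 + 2 * ‖y‖ₑ ^ 2 := by
  have h : ‖x + y‖ ^ 2 ≤ 2 * ‖x‖ ^ 2 + 2 * ‖y‖ ^ 2 := by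
    have h1 := norm_add_le x y
    have h2 : ‖x + y‖ ^ 2 ≤ (‖x‖ + ‖y‖) ^ 2 := by gcongr
    nlinarith [sq_nonneg (‖x‖ - ‖y‖)]
  have h3 := ENNReal.ofReal_le_ofReal h
  rw [ENNReal.ofReal_add (by positivity) (by positivity), ENNReal.ofReal_mul (by norm_num),
    ENNReal.ofReal_mul (by norm_num), ENNReal.ofReal_pow (norm_nonneg _),
    ENNReal.ofReal_pow (norm_nonneg _), ENNReal.ofReal_pow (norm_nonneg _), ofReal_norm,
    ofReal_norm, ofReal_norm] at h3
  simpa using h3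

/-- Bernstein's inequality: on |k| ≤ N one has wt ≤ 2N, so raising the exponent from s to M costs
(2N)^{2(M-s)}, and the prefactor N^{-2M} leaves N^{-2s}. -/
theorem sum_wt_sq_low_le {s N : ℝ} (hN : 1 ≤ N) {M : ℕ} (hM : s ≤ M) {c : ℤ → ℂ}
    (hc : Summable fun k => (wt k ^ s * ‖c k‖) ^ 2) (t : Finset ℤ)
    (ht : ∀ k : ℤ, k ∈ t → |(k : ℝ)| ≤ N) :
    (N ^ (2 * M))⁻¹ * ∑ k ∈ t, (wt k ^ (M : ℝ) * ‖c k‖) ^ 2 ≤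
      2 ^ (2 * (M - s)) * N ^ (-2 * s) * ∑' k, (wt k ^ s * ‖c k‖) ^ 2 := by
  have hN0 : 0 < N := by linarith
  have h1 : ∑ k ∈ t, (wt k ^ (M : ℝ) * ‖c k‖) ^ 2 ≤
      (2 * N) ^ (2 * (M - s)) * ∑' k, (wt k ^ s * ‖c k‖) ^ 2 := by
    refine le_trans ?_ (mul_le_mul_of_nonneg_left (hc.sum_le_tsum t fun k _ => sq_nonneg _)
      (by positivity))
    rw [Finset.mul_sum]
    refine Finset.sum_le_sum fun k hk => ?_
    have hw : wt k ≤ 2 * N := by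
      have := ht k hk
      unfold wt
      linarith
    have h2 : wt k ^ (2 * (M : ℝ)) ≤ (2 * N) ^ (2 * (M - s)) * wt k ^ (2 * s) := by
      rw [show 2 * (M : ℝ) = 2 * (M - s) + 2 * s by ring, Real.rpow_add (wt_pos k)]
      have := wt_pos k
      gcongr
    rw [mul_pow, mul_pow, wt_rpow_sq, wt_rpow_sq, ← mul_assoc]
    gcongr
  calc _ ≤ (N ^ (2 * M))⁻¹ * ((2 * N) ^ (2 * (M - s)) * ∑' k, (wt k ^ s * ‖c k‖) ^ 2) := by
        gcongr
    _ = _ := by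
        have h3 : (N ^ (2 * M))⁻¹ * N ^ (2 * (M - s)) = N ^ (-2 * s) := by
          rw [← Real.rpow_natCast, ← Real.rpow_neg hN0.le, ← Real.rpow_add hN0]
          congr 1
          push_cast
          ring
        rw [Real.mul_rpow (by norm_num) hN0.le, ← h3]
        ring

theorem tsum_wt_sq_high_le {s N : ℝ} (hs : 1 ≤ s) (hN : 1 ≤ N) {c : ℤ → ℂ}
    (hc : Summable fun k => (wt k ^ s * ‖c k‖) ^ 2) (hc' : ∀ k : ℤ, |(k : ℝ)| ≤ N → c k = 0) :
    Summable (fun k => (wt k ^ (1 : ℝ) * ‖c k‖) ^ 2) ∧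
      (N ^ (2 * 1))⁻¹ * ∑' k, (wt k ^ (1 : ℝ) * ‖c k‖) ^ 2 ≤
        N ^ (-2 * s) * ∑' k, (wt k ^ s * ‖c k‖) ^ 2 := by
  have hN0 : 0 < N := by linarith
  have hb : ∀ k, (wt k ^ (1 : ℝ) * ‖c k‖) ^ 2 ≤
      N ^ (2 * (1 - s)) * (wt k ^ s * ‖c k‖) ^ 2 := fun k => by
    by_cases hk : |(k : ℝ)| ≤ N
    · simp [hc' k hk]
    · have hw : N ≤ wt k := by
        unfold wt
        linarith
      have h2 : wt k ^ (2 * (1 : ℝ)) ≤ N ^ (2 * (1 - s)) * wt k ^ (2 * s) := by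
        rw [show 2 * (1 : ℝ) = 2 * (1 - s) + 2 * s by ring, Real.rpow_add (wt_pos k)]
        have h3 := Real.rpow_le_rpow_of_nonpos hN0 hw (show 2 * (1 - s) ≤ 0 by linarith)
        have := (wt_pos k).le
        gcongr
      rw [mul_pow, mul_pow, wt_rpow_sq, wt_rpow_sq, ← mul_assoc]
      gcongr
  have hsum : Summable (fun k => (wt k ^ (1 : ℝ) * ‖c k‖) ^ 2) :=
    Summable.of_nonneg_of_le (fun k => sq_nonneg _) hb (hc.mul_left _)
  refine ⟨hsum, ?_⟩
  have h1 := hsum.tsum_le_tsum hb (hc.mul_left _)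
  rw [tsum_mul_left] at h1
  calc _ ≤ (N ^ (2 * 1))⁻¹ * (N ^ (2 * (1 - s)) * ∑' k, (wt k ^ s * ‖c k‖) ^ 2) := by gcongr
    _ = _ := by
        have h3 : (N ^ (2 * 1))⁻¹ * N ^ (2 * (1 - s)) = N ^ (-2 * s) := by
          rw [← Real.rpow_natCast, ← Real.rpow_neg hN0.le, ← Real.rpow_add hN0]
          congr 1
          push_cast
          ring
        rw [← mul_assoc, h3]

/-- The coefficients are split at |k| = N. Chebyshev's inequality uses M derivatives on the low part
and one on the high part, and each yields N^{-2s}: the low part as M ≥ s, the high part as s ≥ 1.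
This replaces interpolation between integer orders. -/
theorem exists_setLIntegral_fourier_tsum_mobiusLp_le {β s : ℝ} (hβ : 0 < β) (hs : 1 ≤ s) :
    ∃ K, 0 ≤ K ∧ ∀ c : ℤ → ℂ, Summable (fun k => wt k ^ (1 / 2 : ℝ) * ‖c k‖) →
      Summable (fun k => (wt k ^ s * ‖c k‖) ^ 2) → ∀ N : ℝ, 1 ≤ N →
      ∫⁻ ξ in {ξ : ℝ | N ≤ 2 * Real.pi * |ξ|},
        ‖(𝓕 (∑' k, c k • mobiusLp hβ k) : Lp ℂ 2 (volume : Measure ℝ)) ξ‖ₑ ^ 2 ≤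
      ENNReal.ofReal (N ^ (-2 * s) * (K * ∑' k, (wt k ^ s * ‖c k‖) ^ 2)) := by
  -- Any integer order at least s would do; the finite low part is smooth enough for all of them.
  set M : ℕ := ⌈s⌉₊
  have hM : 0 < M := Nat.ceil_pos.mpr (by linarith)
  obtain ⟨K₁, hK₁, hlow⟩ := exists_lintegral_fourier_sum_mobiusLp_le hβ hM
  obtain ⟨K₂, hK₂, hhigh⟩ := exists_lintegral_fourier_tsum_mobiusLp_le hβ
  refine ⟨2 * (K₁ * 2 ^ (2 * (M - s)) + K₂), by positivity, fun c hc hcs N hN => ?_⟩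
  have hN0 : 0 < N := by linarith
  set t : Finset ℤ := Finset.Icc (-⌊N⌋) ⌊N⌋
  have ht : ∀ k : ℤ, k ∈ t ↔ |(k : ℝ)| ≤ N := fun k => by
    rw [Finset.mem_Icc, ← abs_le, Int.le_floor]
    push_cast
    rfl
  set d : ℤ → ℂ := fun k => if k ∈ t then 0 else c k with hd
  have hdc : ∀ k, ‖d k‖ ≤ ‖c k‖ := fun k => by
    rw [hd]
    dsimp only
    split_ifs <;> simp
  have hd1 : Summable (fun k => wt k ^ (1 / 2 : ℝ) * ‖d k‖) :=
    Summable.of_nonneg_of_le (fun k => by have := wt_pos k; positivity)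
      (fun k => mul_le_mul_of_nonneg_left (hdc k) (wt_rpow_pos k _).le) hc
  have hble : ∀ k, (wt k ^ s * ‖d k‖) ^ 2 ≤ (wt k ^ s * ‖c k‖) ^ 2 := fun k => by
    have := wt_rpow_pos k s
    have := hdc k
    gcongr
  have hd2 : Summable (fun k => (wt k ^ s * ‖d k‖) ^ 2) :=
    Summable.of_nonneg_of_le (fun k => sq_nonneg _) hble hcs
  have hsplit : ∑' k, c k • mobiusLp hβ k =
      ∑ k ∈ t, c k • mobiusLp hβ k + ∑' k, d k • mobiusLp hβ k := by
    have h1 : HasSum (fun k => if k ∈ t then c k • mobiusLp hβ k else 0)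
        (∑ k ∈ t, c k • mobiusLp hβ k) := by
      have : HasSum (fun k => if k ∈ t then c k • mobiusLp hβ k else 0)
          (∑ k ∈ t, if k ∈ t then c k • mobiusLp hβ k else 0) :=
        hasSum_sum_of_ne_finset_zero fun k hk => if_neg hk
      rwa [Finset.sum_congr rfl fun k hk => if_pos hk] at this
    have h2 := h1.add (summable_smul_mobiusLp hβ hd1).1.hasSum
    rw [← h2.tsum_eq]
    refine tsum_congr fun k => ?_
    by_cases hk : k ∈ t <;> simp [hd, hk]
  have hF : (𝓕 (∑' k, c k • mobiusLp hβ k) : Lp ℂ 2 (volume : Measure ℝ)) =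
      𝓕 (∑ k ∈ t, c k • mobiusLp hβ k) + 𝓕 (∑' k, d k • mobiusLp hβ k) := by
    rw [hsplit]
    exact (Lp.fourierTransformₗᵢ ℝ ℂ).map_add _ _
  obtain ⟨hd3, hd4⟩ := tsum_wt_sq_high_le hs hN hd2 fun k hk => if_pos ((ht k).mpr hk)
  have e1 := (setLIntegral_le_inv_mul_lintegral hN0 M fun ξ =>
    ‖(𝓕 (∑ k ∈ t, c k • mobiusLp hβ k) : Lp ℂ 2 (volume : Measure ℝ)) ξ‖ₑ ^ 2).trans
    (mul_le_mul_right (hlow t c) _)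
  have e2 := (setLIntegral_le_inv_mul_lintegral hN0 1 fun ξ =>
    ‖(𝓕 (∑' k, d k • mobiusLp hβ k) : Lp ℂ 2 (volume : Measure ℝ)) ξ‖ₑ ^ 2).trans
    (mul_le_mul_right (hhigh d hd1 hd3) _)
  rw [← ENNReal.ofReal_mul (by positivity)] at e1 e2
  have l1 := sum_wt_sq_low_le hN (Nat.le_ceil s) hcs t fun k => (ht k).mp
  have l2 := hd2.tsum_le_tsum hble hcs
  set A := ∑' k, (wt k ^ s * ‖c k‖) ^ 2
  have hA : 0 ≤ A := tsum_nonneg fun k => sq_nonneg _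
  calc _ ≤ ∫⁻ ξ in {ξ : ℝ | N ≤ 2 * Real.pi * |ξ|},
        (2 * ‖(𝓕 (∑ k ∈ t, c k • mobiusLp hβ k) : Lp ℂ 2 (volume : Measure ℝ)) ξ‖ₑ ^ 2 +
        2 * ‖(𝓕 (∑' k, d k • mobiusLp hβ k) : Lp ℂ 2 (volume : Measure ℝ)) ξ‖ₑ ^ 2) := by
        refine lintegral_mono_ae (ae_restrict_of_ae ?_)
        rw [hF]
        filter_upwards [Lp.coeFn_add
          (𝓕 (∑ k ∈ t, c k • mobiusLp hβ k) : Lp ℂ 2 (volume : Measure ℝ))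
          (𝓕 (∑' k, d k • mobiusLp hβ k))] with ξ hξ
        rw [hξ]
        exact sq_enorm_add_le _ _
    _ ≤ 2 * ENNReal.ofReal (K₁ * (2 ^ (2 * (M - s)) * N ^ (-2 * s) * A)) +
        2 * ENNReal.ofReal (K₂ * (N ^ (-2 * s) * A)) := by
        rw [lintegral_add_left'
          (((Lp.aestronglyMeasurable _).enorm.pow_const 2).const_mul 2).restrict,
          lintegral_const_mul' _ _ (by simp), lintegral_const_mul' _ _ (by simp)]
        gcongr
        · refine e1.trans (ENNReal.ofReal_le_ofReal ?_)
          rw [mul_left_comm]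
          gcongr
        · refine e2.trans (ENNReal.ofReal_le_ofReal ?_)
          rw [mul_left_comm]
          refine mul_le_mul_of_nonneg_left (hd4.trans ?_) hK₂
          gcongr
    _ = _ := by
        rw [← mul_add, ← ENNReal.ofReal_add (by positivity) (by positivity),
          show (2 : ENNReal) = ENNReal.ofReal 2 by simp, ← ENNReal.ofReal_mul (by norm_num)]
        congr 1
        ring

/-! ### Sobolev weights -/

theorem lintegral_sobolev_weight_le_of_le_one {t D : ℝ} (ht : t ≤ 1)
    {v : ℝ → ENNReal} (hv : AEMeasurable v) (h0 : ∫⁻ ξ, v ξ ≤ ENNReal.ofReal D)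
    (h1 : ∫⁻ ξ, ENNReal.ofReal ((2 * Real.pi * |ξ|) ^ 2) * v ξ ≤ ENNReal.ofReal D) :
    ∫⁻ ξ, ENNReal.ofReal ((1 + 2 * Real.pi * |ξ|) ^ (2 * t)) * v ξ ≤
      ENNReal.ofReal (4 * D) := by
  calc _ ≤ ∫⁻ ξ, (2 * v ξ + 2 * (ENNReal.ofReal ((2 * Real.pi * |ξ|) ^ 2) * v ξ)) := by
        refine lintegral_mono fun ξ => ?_
        have hu : 0 ≤ 2 * Real.pi * |ξ| := by positivity
        have e : (1 + 2 * Real.pi * |ξ|) ^ (2 * t) ≤ 2 + 2 * (2 * Real.pi * |ξ|) ^ 2 := by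
          refine (Real.rpow_le_rpow_of_exponent_le (by linarith)
            (show 2 * t ≤ (2 : ℕ) by push_cast; linarith)).trans ?_
          rw [Real.rpow_natCast]
          nlinarith [sq_nonneg (1 - 2 * Real.pi * |ξ|)]
        refine (mul_le_mul_left (ENNReal.ofReal_le_ofReal e) (v ξ)).trans_eq ?_
        rw [ENNReal.ofReal_add (by norm_num) (by positivity), ENNReal.ofReal_mul (by norm_num),
          ENNReal.ofReal_ofNat]
        ring
    _ ≤ 2 * ENNReal.ofReal D + 2 * ENNReal.ofReal D := by
        rw [lintegral_add_left' (hv.const_mul 2), lintegral_const_mul' _ _ (by simp),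
          lintegral_const_mul' _ _ (by simp)]
        gcongr
    _ = _ := by
        rw [ENNReal.ofReal_mul (by norm_num), ENNReal.ofReal_ofNat]
        ring

/-- The three terms cover u < 1, 1 ≤ u < n and u ≥ n. In the last range u lies in a dyadic shell
from n 2^i to n 2^{i+1}, where 1 + u ≤ 2u ≤ 4n 2^i. -/
theorem sobolev_weight_le {t n u : ℝ} (ht : 1 ≤ t) (hn : 1 ≤ n) (hu : 0 ≤ u) :
    ENNReal.ofReal ((1 + u) ^ (2 * t)) ≤
      ENNReal.ofReal (4 ^ t) + ENNReal.ofReal (4 ^ t * n ^ (2 * (t - 1))) * ENNReal.ofReal (u ^ 2) +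
      ∑' i : ℕ, ENNReal.ofReal ((4 * (n * 2 ^ i)) ^ (2 * t)) *
        Set.indicator {x : ℝ | n * 2 ^ i ≤ x} 1 u := by
  have h4 : (4 : ℝ) ^ t = 2 ^ (2 * t) := by
    rw [Real.rpow_mul (by norm_num)]
    norm_num
  have hn0 : 0 < n := by linarith
  rcases lt_or_ge u 1 with h1 | h1
  · refine le_trans ?_ (le_self_add.trans le_self_add)
    rw [h4]
    exact ENNReal.ofReal_le_ofReal (Real.rpow_le_rpow (by linarith) (by linarith) (by linarith))
  rcases lt_or_ge u n with h2 | h2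
  · refine le_trans ?_ ((le_add_self).trans le_self_add)
    rw [← ENNReal.ofReal_mul (by positivity)]
    refine ENNReal.ofReal_le_ofReal ?_
    calc (1 + u) ^ (2 * t) ≤ (2 * u) ^ (2 * t) :=
          Real.rpow_le_rpow (by linarith) (by linarith) (by linarith)
      _ = 4 ^ t * u ^ (2 * (t - 1)) * u ^ 2 := by
          rw [Real.mul_rpow (by norm_num) hu, h4, mul_assoc, ← Real.rpow_natCast u 2,
            ← Real.rpow_add (by linarith)]
          congr 2
          push_cast
          ring
      _ ≤ _ := by gcongr
  · obtain ⟨i, hi1, hi2⟩ := exists_nat_pow_near ((one_le_div hn0).mpr h2) (one_lt_two (α := ℝ))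
    rw [le_div_iff₀ hn0] at hi1
    rw [div_lt_iff₀ hn0] at hi2
    refine le_trans ?_ (le_add_self.trans' (ENNReal.le_tsum i))
    rw [Set.indicator_of_mem (by rw [Set.mem_ofPred_eq]; linarith), Pi.one_apply, mul_one]
    refine ENNReal.ofReal_le_ofReal (Real.rpow_le_rpow (by linarith) ?_ (by linarith))
    rw [pow_succ] at hi2
    linarith

theorem exists_lintegral_sobolev_weight_le {t s : ℝ} (ht : 1 ≤ t) (hts : t < s) :
    ∃ K, 0 ≤ K ∧ ∀ (n D : ℝ), 1 ≤ n → 0 ≤ D → ∀ v : ℝ → ENNReal, AEMeasurable v →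
      ∫⁻ ξ, v ξ ≤ ENNReal.ofReal (n ^ (2 * (1 - s)) * D) →
      ∫⁻ ξ, ENNReal.ofReal ((2 * Real.pi * |ξ|) ^ 2) * v ξ ≤
        ENNReal.ofReal (n ^ (2 * (1 - s)) * D) →
      (∀ N : ℝ, 1 ≤ N → ∫⁻ ξ in {ξ : ℝ | N ≤ 2 * Real.pi * |ξ|}, v ξ ≤
        ENNReal.ofReal (N ^ (-2 * s) * D)) →
      ∫⁻ ξ, ENNReal.ofReal ((1 + 2 * Real.pi * |ξ|) ^ (2 * t)) * v ξ ≤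
        ENNReal.ofReal (K * (n ^ (2 * (t - s)) * D)) := by
  set q : ℝ := 2 ^ (2 * (t - s)) with hq
  have hq0 : 0 ≤ q := by positivity
  have hq1 : q < 1 := Real.rpow_lt_one_of_one_lt_of_neg (by norm_num) (by linarith)
  have hgeo := summable_geometric_of_lt_one hq0 hq1
  -- One summand per range of the weight. The i-th shell contributes (n 2^i)^{2(t-s)} = n^{2(t-s)}
  -- q^i, and q < 1 because t < s.
  refine ⟨4 ^ t + 4 ^ t + ∑' i : ℕ, 4 ^ (2 * t) * q ^ i, by positivity, ?_⟩
  intro n D hn hD v hv h0 h1 h2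
  have hn0 : 0 < n := by linarith
  have hS : ∀ i : ℕ, MeasurableSet {ξ : ℝ | n * 2 ^ i ≤ 2 * Real.pi * |ξ|} := fun i =>
    measurableSet_le measurable_const (by fun_prop)
  set E : ℝ := n ^ (2 * (t - s)) * D with hE
  have hE0 : 0 ≤ E := by positivity
  have hshell : ∀ i : ℕ, ∫⁻ ξ, ENNReal.ofReal ((4 * (n * 2 ^ i)) ^ (2 * t)) *
      Set.indicator {ξ : ℝ | n * 2 ^ i ≤ 2 * Real.pi * |ξ|} v ξ ≤
      ENNReal.ofReal (4 ^ (2 * t) * q ^ i * E) := fun i => by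
    have hN : 1 ≤ n * 2 ^ i := one_le_mul_of_one_le_of_one_le hn (one_le_pow₀ (by norm_num))
    have hN0 : 0 < n * 2 ^ i := by linarith
    rw [lintegral_const_mul' _ _ ENNReal.ofReal_ne_top, lintegral_indicator (hS i)]
    refine (mul_le_mul_right (h2 _ hN) _).trans_eq ?_
    rw [← ENNReal.ofReal_mul (by positivity)]
    congr 1
    have e1 : (n * 2 ^ i) ^ (2 * t) * (n * 2 ^ i) ^ (-2 * s) = q ^ i * n ^ (2 * (t - s)) := by
      rw [← Real.rpow_add hN0, show 2 * t + -2 * s = 2 * (t - s) by ring,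
        Real.mul_rpow hn0.le (by positivity), hq, ← Real.rpow_pow_comm (by norm_num), mul_comm]
    rw [Real.mul_rpow (by norm_num) hN0.le, hE, ← mul_assoc, mul_assoc (4 ^ (2 * t)) _ (_ ^ (-2 * s)), e1]
    ring
  calc _ ≤ ∫⁻ ξ, (ENNReal.ofReal (4 ^ t) * v ξ +
        ENNReal.ofReal (4 ^ t * n ^ (2 * (t - 1))) *
          (ENNReal.ofReal ((2 * Real.pi * |ξ|) ^ 2) * v ξ) +
        ∑' i : ℕ, ENNReal.ofReal ((4 * (n * 2 ^ i)) ^ (2 * t)) *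
          Set.indicator {ξ : ℝ | n * 2 ^ i ≤ 2 * Real.pi * |ξ|} v ξ) := by
        refine lintegral_mono fun ξ => ?_
        refine (mul_le_mul_left (sobolev_weight_le ht hn
          (show 0 ≤ 2 * Real.pi * |ξ| by positivity)) (v ξ)).trans_eq ?_
        rw [add_mul, add_mul, mul_assoc, ← ENNReal.tsum_mul_right]
        congr 1
        refine tsum_congr fun i => ?_
        by_cases h : n * 2 ^ i ≤ 2 * Real.pi * |ξ| <;> simp [Set.indicator, h]
    _ ≤ ENNReal.ofReal (4 ^ t * E) + ENNReal.ofReal (4 ^ t * E) +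
        ∑' i : ℕ, ENNReal.ofReal (4 ^ (2 * t) * q ^ i * E) := by
        rw [lintegral_add_left' (by fun_prop), lintegral_add_left' (by fun_prop),
          lintegral_const_mul' _ _ ENNReal.ofReal_ne_top,
          lintegral_const_mul' _ _ ENNReal.ofReal_ne_top,
          lintegral_tsum fun i => (hv.indicator (hS i)).const_mul _]
        refine add_le_add (add_le_add ?_ ?_) (ENNReal.tsum_le_tsum hshell)
        · refine (mul_le_mul_right h0 _).trans ?_
          rw [← ENNReal.ofReal_mul (by positivity)]
          refine ENNReal.ofReal_le_ofReal ?_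
          rw [hE]
          gcongr
        · refine (mul_le_mul_right h1 _).trans_eq ?_
          rw [← ENNReal.ofReal_mul (by positivity)]
          congr 1
          rw [hE, show 2 * (t - s) = 2 * (t - 1) + 2 * (1 - s) by ring, Real.rpow_add hn0]
          ring
    _ = _ := by
        rw [← ENNReal.ofReal_tsum_of_nonneg (fun i => by positivity)
          ((hgeo.mul_left _).mul_right _), ← ENNReal.ofReal_add (by positivity) (by positivity),
          ← ENNReal.ofReal_add (by positivity)
            (tsum_nonneg fun i => by positivity), tsum_mul_right]
        congr 1
        ring

/-! ### The norm of `H^t(ℝ)` -/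

theorem memSobolevLine_and_normSobolevLine_le {t B : ℝ} (hB : 0 ≤ B) {g : ℝ → ℂ}
    {u : Lp ℂ 2 (volume : Measure ℝ)} (hu : u =ᵐ[volume] g)
    (h : ∫⁻ ξ, ENNReal.ofReal ((1 + 2 * Real.pi * |ξ|) ^ (2 * t)) *
      ‖(𝓕 u : Lp ℂ 2 (volume : Measure ℝ)) ξ‖ₑ ^ 2 ≤ ENNReal.ofReal B) :
    MemSobolevLine t g ∧ normSobolevLine t g ≤ √(2 * Real.pi * B) := by
  have hg : MemLp g 2 (volume : Measure ℝ) := (memLp_congr_ae hu).mp (Lp.memLp u)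
  have hug : hg.toLp g = u := Lp.ext (hg.coeFn_toLp.trans hu.symm)
  set G : ℝ → ℝ := fun ξ => (1 + 2 * Real.pi * |ξ|) ^ (2 * t) *
    ‖(𝓕 u : Lp ℂ 2 (volume : Measure ℝ)) ξ‖ ^ 2 with hG
  have hG0 : ∀ ξ, 0 ≤ G ξ := fun ξ => by positivity
  have hGE : (fun k : ℝ => (1 + |k|) ^ (2 * t) * ‖fourierL2 g k‖ ^ 2) =
      fun k => G (k / (2 * Real.pi)) := by
    funext k
    have e : 2 * Real.pi * |k / (2 * Real.pi)| = |k| := by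
      rw [abs_div, abs_of_pos Real.two_pi_pos, mul_div_cancel₀ _ Real.two_pi_pos.ne']
    rw [fourierL2, dif_pos hg, hug]
    simp only [hG, e]
  have hmeas : AEStronglyMeasurable G (volume : Measure ℝ) := by
    have h1 : Measurable fun ξ : ℝ => (1 + 2 * Real.pi * |ξ|) ^ (2 * t) := by fun_prop
    exact h1.aestronglyMeasurable.mul ((Lp.aestronglyMeasurable _).norm.pow 2)
  have hlint : ∫⁻ ξ, ENNReal.ofReal (G ξ) ≤ ENNReal.ofReal B := by
    refine le_trans (le_of_eq (lintegral_congr fun ξ => ?_)) h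
    rw [hG, ENNReal.ofReal_mul (by positivity), ENNReal.ofReal_pow (norm_nonneg _), ofReal_norm]
  have hint : Integrable G := by
    refine ⟨hmeas, ?_⟩
    rw [hasFiniteIntegral_iff_ofReal (Eventually.of_forall hG0)]
    exact hlint.trans_lt ENNReal.ofReal_lt_top
  have hle : ∫ ξ, G ξ ≤ B := by
    rw [← ENNReal.ofReal_le_ofReal_iff hB,
      ofReal_integral_eq_lintegral_ofReal hint (Eventually.of_forall hG0)]
    exact hlint
  refine ⟨⟨hg, ?_⟩, ?_⟩
  · rw [hGE]
    exact hint.comp_div Real.two_pi_pos.ne'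
  · rw [normSobolevLine, hGE, Measure.integral_comp_div, abs_of_pos Real.two_pi_pos, smul_eq_mul]
    exact Real.sqrt_le_sqrt (by gcongr)

/-! ### Spectral bounds for the interpolation error and its norm in H^t -/

theorem exists_lintegral_fourier_errCoeff_le {β s : ℝ} (hβ : 0 < β) (hs : 1 < s) :
    ∃ K, 0 ≤ K ∧ ∀ n : ℕ, 1 ≤ n → ∀ a : ℤ → ℂ, Summable (fun k => (wt k ^ s * ‖a k‖) ^ 2) →
      ((∑' k, errCoeff n a k • mobiusLp hβ k : Lp ℂ 2 (volume : Measure ℝ)) =ᵐ[volume]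
        mobiusSeries β (errCoeff n a)) ∧
      ∫⁻ ξ, ‖(𝓕 (∑' k, errCoeff n a k • mobiusLp hβ k) : Lp ℂ 2 (volume : Measure ℝ)) ξ‖ₑ ^ 2 ≤
        ENNReal.ofReal ((n : ℝ) ^ (2 * (1 - s)) * (K * ∑' k, (wt k ^ s * ‖a k‖) ^ 2)) ∧
      ∫⁻ ξ, ENNReal.ofReal ((2 * Real.pi * |ξ|) ^ 2) *
        ‖(𝓕 (∑' k, errCoeff n a k • mobiusLp hβ k) : Lp ℂ 2 (volume : Measure ℝ)) ξ‖ₑ ^ 2 ≤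
        ENNReal.ofReal ((n : ℝ) ^ (2 * (1 - s)) * (K * ∑' k, (wt k ^ s * ‖a k‖) ^ 2)) ∧
      ∀ N : ℝ, 1 ≤ N → ∫⁻ ξ in {ξ : ℝ | N ≤ 2 * Real.pi * |ξ|},
        ‖(𝓕 (∑' k, errCoeff n a k • mobiusLp hβ k) : Lp ℂ 2 (volume : Measure ℝ)) ξ‖ₑ ^ 2 ≤
        ENNReal.ofReal (N ^ (-2 * s) * (K * ∑' k, (wt k ^ s * ‖a k‖) ^ 2)) := by
  have hs2 : 1 / 2 < s := by linarith
  -- The exponent 1/2 matches the growth of ‖M^k - 1‖ in L², and s > 1 is exactly what the ℓ¹ bound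
  -- requires for it.
  obtain ⟨L₀, hL₀, h0⟩ := exists_tsum_errCoeff_le (r := 1 / 2) (s := s) (by norm_num) (by linarith)
  obtain ⟨L₁, hL₁, h1⟩ := exists_tsum_sq_errCoeff_le (t := 1) hs2 zero_le_one hs.le
  obtain ⟨L₂, hL₂, h2⟩ := exists_tsum_sq_errCoeff_le (t := s) hs2 (by linarith) le_rfl
  obtain ⟨K₁, hK₁, e1⟩ := exists_lintegral_fourier_tsum_mobiusLp_le hβ
  obtain ⟨K₂, hK₂, e2⟩ := exists_setLIntegral_fourier_tsum_mobiusLp_le hβ hs.le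
  refine ⟨8 * Real.pi * β * L₀ ^ 2 + K₁ * L₁ + K₂ * L₂, by positivity, fun n hn a ha => ?_⟩
  obtain ⟨h0s, h0b⟩ := h0 n hn a ha
  obtain ⟨h1s, h1b⟩ := h1 n hn a ha
  obtain ⟨h2s, h2b⟩ := h2 n hn a ha
  set A := ∑' k, (wt k ^ s * ‖a k‖) ^ 2 with hA
  have hA0 : 0 ≤ A := tsum_nonneg fun k => sq_nonneg _
  have hn0 : (0 : ℝ) < n := by exact_mod_cast hn
  have hzero := tsum_errCoeff hn (summable_norm_of_summable_sq hs2 ha).of_norm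
  have p0 : 0 ≤ 8 * Real.pi * β * L₀ ^ 2 := by positivity
  have p1 : 0 ≤ K₁ * L₁ := by positivity
  have p2 : 0 ≤ K₂ * L₂ := by positivity
  refine ⟨coeFn_tsum_mobiusLp hβ h0s hzero, ?_, ?_, fun N hN => ?_⟩
  · rw [lintegral_sq_enorm_Lp, Lp.norm_fourier_eq]
    refine ENNReal.ofReal_le_ofReal ?_
    have h3 := (summable_smul_mobiusLp hβ h0s).2
    have h4 : ‖∑' k, errCoeff n a k • mobiusLp hβ k‖ ≤
        √(8 * Real.pi * β) * (L₀ * (n : ℝ) ^ (1 - s) * √A) := by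
      refine h3.trans (mul_le_mul_of_nonneg_left (h0b.trans_eq ?_) (Real.sqrt_nonneg _))
      norm_num
    calc _ ≤ (√(8 * Real.pi * β) * (L₀ * (n : ℝ) ^ (1 - s) * √A)) ^ 2 := by gcongr
      _ = (n : ℝ) ^ (2 * (1 - s)) * (8 * Real.pi * β * L₀ ^ 2 * A) := by
        rw [mul_pow, mul_pow, mul_pow, Real.sq_sqrt (by positivity), Real.sq_sqrt hA0,
          mul_comm 2 (1 - s), Real.rpow_mul hn0.le, Real.rpow_ofNat]
        ring
      _ ≤ _ := by
        gcongr
        linarith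
  · refine (e1 _ h0s h1s).trans (ENNReal.ofReal_le_ofReal ?_)
    calc _ ≤ K₁ * (L₁ * (n : ℝ) ^ (2 * (1 - s)) * A) := by gcongr
      _ = (n : ℝ) ^ (2 * (1 - s)) * (K₁ * L₁ * A) := by ring
      _ ≤ _ := by
        gcongr
        linarith
  · refine (e2 _ h0s h2s N hN).trans (ENNReal.ofReal_le_ofReal ?_)
    rw [sub_self, mul_zero, Real.rpow_zero, mul_one] at h2b
    calc _ ≤ N ^ (-2 * s) * (K₂ * (L₂ * A)) := by gcongr
      _ = N ^ (-2 * s) * (K₂ * L₂ * A) := by ring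
      _ ≤ _ := by
        gcongr
        linarith

theorem exists_normSobolevLine_mobiusSeries_errCoeff_le {β s : ℝ} (hβ : 0 < β) (hs : 1 < s) :
    ∃ C : ℝ, 0 ≤ C ∧ ∀ t, t < s → ∃ C' : ℝ, 0 ≤ C' ∧ ∀ n : ℕ, 1 ≤ n → ∀ a : ℤ → ℂ,
      Summable (fun k => (wt k ^ s * ‖a k‖) ^ 2) →
      MemSobolevLine t (mobiusSeries β (errCoeff n a)) ∧
      normSobolevLine t (mobiusSeries β (errCoeff n a)) ≤
        (C * (n : ℝ) ^ (1 - s) + C' * (n : ℝ) ^ (t - s)) * √(∑' k, (wt k ^ s * ‖a k‖) ^ 2) := by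
  obtain ⟨K, hK, h⟩ := exists_lintegral_fourier_errCoeff_le hβ hs
  refine ⟨√(2 * Real.pi * (4 * K)), Real.sqrt_nonneg _, fun t ht => ?_⟩
  have hmeas : ∀ u : Lp ℂ 2 (volume : Measure ℝ), AEMeasurable fun ξ => ‖u ξ‖ₑ ^ 2 := fun u =>
    (Lp.aestronglyMeasurable u).enorm.pow_const 2
  rcases le_or_gt t 1 with ht1 | ht1
  -- For t ≤ 1 the term n^{1-s} suffices, with a constant free of t. For t > 1 the term n^{t-s}
  -- alone suffices.
  · refine ⟨0, le_rfl, fun n hn a ha => ?_⟩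
    obtain ⟨h0, h1, h2, -⟩ := h n hn a ha
    have hA0 : 0 ≤ ∑' k, (wt k ^ s * ‖a k‖) ^ 2 := tsum_nonneg fun k => sq_nonneg _
    obtain ⟨h3, h4⟩ := memSobolevLine_and_normSobolevLine_le (by positivity) h0
      (lintegral_sobolev_weight_le_of_le_one ht1 (hmeas _) h1 h2)
    refine ⟨h3, h4.trans_eq ?_⟩
    rw [zero_mul, add_zero, ← sqrt_mul_rpow (Nat.cast_nonneg n) _ _ (by positivity),
      ← Real.sqrt_mul (by positivity)]
    congr 1
    ring
  · obtain ⟨L, hL, hw⟩ := exists_lintegral_sobolev_weight_le ht1.le ht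
    refine ⟨√(2 * Real.pi * (L * K)), Real.sqrt_nonneg _, fun n hn a ha => ?_⟩
    obtain ⟨h0, h1, h2, h3⟩ := h n hn a ha
    have hA0 : 0 ≤ ∑' k, (wt k ^ s * ‖a k‖) ^ 2 := tsum_nonneg fun k => sq_nonneg _
    obtain ⟨h4, h5⟩ := memSobolevLine_and_normSobolevLine_le (by positivity) h0
      (hw n _ (by exact_mod_cast hn) (by positivity) _ (hmeas _) h1 h2 h3)
    refine ⟨h4, h5.trans ?_⟩
    rw [add_mul]
    refine le_trans (le_of_eq ?_) (le_add_of_nonneg_left (by positivity))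
    rw [← sqrt_mul_rpow (Nat.cast_nonneg n) _ _ (by positivity), ← Real.sqrt_mul (by positivity)]
    congr 1
    ring

theorem rpow_le_rpow_natCast {n : ℕ} (hn : 1 ≤ n) {p q : ℝ} (hpq : p ≤ q) :
    (n : ℝ) ^ p ≤ (n : ℝ) ^ q :=
  Real.rpow_le_rpow_of_exponent_le (by exact_mod_cast hn) hpq

/-! ### Convergence of the rational interpolants -/

section Convergence

variable {β s : ℝ}

theorem exists_normC0_ratInterp_sub_le (hβ : 0 < β) (hs : 1 / 2 < s) (r : ℕ)
    (hr : (r : ℝ) < s - 1 / 2) : ∃ C : ℝ,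
      ∀ f : ℝ → ℂ, Continuous f → MemSobolevTorus s (toTorus β f) → ∀ n : ℕ, 1 ≤ n →
        MemC0 r (fun x => ratInterp β n f x - f x) ∧
        normC0 r (fun x => ratInterp β n f x - f x) ≤
          C * (n : ℝ) ^ (1 / 2 + r - s) * normSobolevTorus s (toTorus β f) := by
  obtain ⟨K, hK, h⟩ := exists_memC0_mobiusSeries hβ r
  obtain ⟨L, hL, h'⟩ := exists_tsum_errCoeff_le (r := (r : ℝ)) (s := s) (Nat.cast_nonneg r) hr
  refine ⟨K * L, fun f hf hF n hn => ?_⟩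
  have ha := summable_sq_of_memSobolevTorus hF
  rw [ratInterp_sub_eq hβ hs hf hF hn, normSobolevTorus_eq]
  obtain ⟨h1, h2⟩ := h' n hn _ ha
  obtain ⟨h3, h4⟩ := h _ h1 (tsum_errCoeff hn (summable_norm_of_summable_sq hs ha).of_norm)
  refine ⟨h3, h4.trans ((mul_le_mul_of_nonneg_left h2 hK).trans_eq ?_)⟩
  ring

theorem exists_normSobolevLine_ratInterp_sub_le (hβ : 0 < β) (hs : 1 / 2 < s) :
    ∃ C₁ C₂ : ℝ → ℝ, ∀ ε : ℝ, 0 < ε → 1 + ε < s → ∀ t : ℝ, t < s →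
      ∀ f : ℝ → ℂ, Continuous f → MemSobolevTorus s (toTorus β f) → ∀ n : ℕ, 1 ≤ n →
        MemSobolevLine t (fun x => ratInterp β n f x - f x) ∧
        normSobolevLine t (fun x => ratInterp β n f x - f x) ≤
          (C₁ ε * (n : ℝ) ^ (1 + ε - s) + C₂ t * (n : ℝ) ^ (t - s)) *
            normSobolevTorus s (toTorus β f) := by
  by_cases hs1 : 1 < s
  · obtain ⟨C, hC, h⟩ := exists_normSobolevLine_mobiusSeries_errCoeff_le hβ hs1
    choose! C' hC' h' using h
    refine ⟨fun _ => C, C', fun ε hε _ t ht f hf hF n hn => ?_⟩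
    rw [ratInterp_sub_eq hβ hs hf hF hn, normSobolevTorus_eq]
    obtain ⟨h1, h2⟩ := h' t ht n hn _ (summable_sq_of_memSobolevTorus hF)
    refine ⟨h1, h2.trans ?_⟩
    have := rpow_le_rpow_natCast hn (show 1 - s ≤ 1 + ε - s by linarith)
    gcongr
  -- For s ≤ 1 no admissible ε exists, so any constants serve.
  · exact ⟨0, 0, fun ε hε h => absurd (by linarith) hs1⟩

theorem exists_hasPVIntegral_ratInterp_sub (hβ : 0 < β) (hs : 1 / 2 < s) (ε : ℝ) (hε : 0 < ε)
    (hεs : 3 / 2 + ε < s) : ∃ C : ℝ,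
      ∀ f : ℝ → ℂ, Continuous f → MemSobolevTorus s (toTorus β f) → ∀ n : ℕ, 1 ≤ n →
        ∃ I : ℂ, HasPVIntegral (fun x => ratInterp β n f x - f x) I ∧
          ‖I‖ ≤ C * (n : ℝ) ^ (3 / 2 + ε - s) * normSobolevTorus s (toTorus β f) := by
  obtain ⟨L, hL, h'⟩ := exists_tsum_errCoeff_le (r := 1) (s := s) zero_le_one (by linarith)
  refine ⟨4 * Real.pi * β * L, fun f hf hF n hn => ?_⟩
  have ha := summable_sq_of_memSobolevTorus hF
  rw [ratInterp_sub_eq hβ hs hf hF hn, normSobolevTorus_eq]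
  obtain ⟨h1, h2⟩ := h' n hn _ ha
  obtain ⟨I, h3, h4⟩ := exists_hasPVIntegral_mobiusSeries hβ h1
    (tsum_errCoeff hn (summable_norm_of_summable_sq hs ha).of_norm)
  refine ⟨I, h3, h4.trans ?_⟩
  have := rpow_le_rpow_natCast hn (show 1 / 2 + 1 - s ≤ 3 / 2 + ε - s by linarith)
  rw [mul_assoc (4 * Real.pi * β), mul_assoc (4 * Real.pi * β)]
  refine mul_le_mul_of_nonneg_left (h2.trans ?_) (by positivity)
  gcongr

theorem exists_isWeakDeriv_ratInterp_sub (hβ : 0 < β) (hs : 1 / 2 < s) (j : ℕ) (hj : 0 < j)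
    (hjs : (j : ℝ) ≤ s) : ∃ C : ℝ,
      ∀ f : ℝ → ℂ, Continuous f → MemSobolevTorus s (toTorus β f) → ∀ n : ℕ, 1 ≤ n →
        ∃ w : ℝ → ℂ, IsWeakDeriv j (fun x => ratInterp β n f x - f x) w ∧
          MeasureTheory.Integrable w ∧
          ∫ x, ‖w x‖ ≤ C * (n : ℝ) ^ ((j : ℝ) - s) * normSobolevTorus s (toTorus β f) := by
  obtain ⟨K, hK, h⟩ := exists_isWeakDeriv_mobiusSeries hβ hj
  obtain ⟨L, hL, h'⟩ := exists_tsum_sq_errCoeff_le (t := j) hs (Nat.cast_nonneg j) hjs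
  -- Plain ℓ¹ summability makes the error continuous; the rate itself comes from the ℓ² bound, which
  -- admits the endpoint j = s.
  obtain ⟨L₀, hL₀, h0⟩ := exists_tsum_errCoeff_le (r := 0) (s := s) le_rfl (by linarith)
  refine ⟨K * √L, fun f hf hF n hn => ?_⟩
  have ha := summable_sq_of_memSobolevTorus hF
  rw [ratInterp_sub_eq hβ hs hf hF hn, normSobolevTorus_eq]
  obtain ⟨h1, h2⟩ := h' n hn _ ha
  obtain ⟨w, h3, h4, h5⟩ := h _ (summable_norm_of_wt_rpow le_rfl (h0 n hn _ ha).1) h1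
  refine ⟨w, h3, h4, h5.trans ?_⟩
  rw [mul_assoc K, ← sqrt_mul_rpow (Nat.cast_nonneg n) _ _ hL, mul_assoc K,
    ← Real.sqrt_mul (by positivity)]
  gcongr

end Convergence

end

end RationalInterpolation

open RationalInterpolation in
theorem mainTheorem1 (β : ℝ) (hβ : 0 < β) (s : ℝ) (hs : 1 / 2 < s) :
    -- convergence in `C_0^r(ℝ)`
    (∀ r : ℕ, (r : ℝ) < s - 1 / 2 → ∃ C : ℝ,
      ∀ f : ℝ → ℂ, Continuous f → MemSobolevTorus s (toTorus β f) → ∀ n : ℕ, 1 ≤ n →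
        MemC0 r (fun x => ratInterp β n f x - f x) ∧
        normC0 r (fun x => ratInterp β n f x - f x) ≤
          C * (n : ℝ) ^ (1 / 2 + r - s) * normSobolevTorus s (toTorus β f)) ∧
    -- convergence in `H^t(ℝ)`; the first constant depends on `ε` only, the second on `t` only
    (∃ C₁ C₂ : ℝ → ℝ, ∀ ε : ℝ, 0 < ε → 1 + ε < s → ∀ t : ℝ, t < s →
      ∀ f : ℝ → ℂ, Continuous f → MemSobolevTorus s (toTorus β f) → ∀ n : ℕ, 1 ≤ n →
        MemSobolevLine t (fun x => ratInterp β n f x - f x) ∧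
        normSobolevLine t (fun x => ratInterp β n f x - f x) ≤
          (C₁ ε * (n : ℝ) ^ (1 + ε - s) + C₂ t * (n : ℝ) ^ (t - s)) *
            normSobolevTorus s (toTorus β f)) ∧
    -- convergence of the principal-value integral
    (∀ ε : ℝ, 0 < ε → 3 / 2 + ε < s → ∃ C : ℝ,
      ∀ f : ℝ → ℂ, Continuous f → MemSobolevTorus s (toTorus β f) → ∀ n : ℕ, 1 ≤ n →
        ∃ I : ℂ, HasPVIntegral (fun x => ratInterp β n f x - f x) I ∧
          ‖I‖ ≤ C * (n : ℝ) ^ (3 / 2 + ε - s) * normSobolevTorus s (toTorus β f)) ∧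
    -- convergence of the derivatives in `L¹(ℝ)`
    (∀ j : ℕ, 0 < j → (j : ℝ) ≤ s → ∃ C : ℝ,
      ∀ f : ℝ → ℂ, Continuous f → MemSobolevTorus s (toTorus β f) → ∀ n : ℕ, 1 ≤ n →
        ∃ w : ℝ → ℂ, IsWeakDeriv j (fun x => ratInterp β n f x - f x) w ∧
          MeasureTheory.Integrable w ∧
          ∫ x, ‖w x‖ ≤ C * (n : ℝ) ^ ((j : ℝ) - s) * normSobolevTorus s (toTorus β f)) := by
  exact ⟨exists_normC0_ratInterp_sub_le hβ hs, exists_normSobolevLine_ratInterp_sub_le hβ hs,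
    exists_hasPVIntegral_ratInterp_sub hβ hs, exists_isWeakDeriv_ratInterp_sub hβ hs⟩
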